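/- **Setting.** For a Polish space $G$ let $D_G$ be the set of right-continuous paths $[0,\infty)\to G$ with left limits (RCLL), with the $\sigma$-algebra generated by the coordinate maps. For $\omega,\omega'\in D_G$ and $s\in[0,\infty)$ let $\omega *_s\omega'$ be the path equal to $\omega(t)$ for $t<s$ and to $\omega'(t-s)$ for $t\ge s$, and let $\omega*_\infty\omega'=\omega$. Given a probability $\mu$ on $D_G$, a random time $\tau:D_G\to[0,\infty]$ and a kernel $\nu=(\nu_g)_{g\in G}$ of probabilities on $D_G$, let $\mu*_\tau\nu$ be the law of $\omega*_{\tau(\omega)}\omega'$ when $\omega\sim\mu$ and, given $\omega$, $\omega'\sim\nu_{\omega(\tau(\omega))}$ (when $\tau(\omega)=\infty$, $\omega'$ plays no role). A *selector* of a family $(\mathcal P^g)_{g\in G}$ of sets of probabilities is a family $\nu_g\in\mathcal P^g$ such that $g\mapsto\nu_g(A)$ is universally measurable for every measurable $A$. Let $E=[0,\infty)\times\mathbb R^d\times F$, with $F$ locally compact Hausdorff with a countable base. Write $X=(T,S,\eta)$ for the coordinate process on $D_E$, $\mathbb F^0$ for its raw filtration, $\mathbb F=(\mathcal F_t)$ for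 the right-continuous hull of $\mathbb F^0$, and $\theta$ for the shifts. Let $(\mathbb P^x)_{x\in E}$ be a Borel measurable family of probabilities on $D_E$ such that 1. $\mathbb P^x[X_0=x]=1$, and the strong Markov property $\mathbb E^x[Y\circ\theta_\tau\mid\mathcal F_\tau]=\mathbb E^{X_\tau}[Y]$ holds $\mathbb P^x$-a.s. for all $x\in E$, all bounded $\mathbb F$-stopping times $\tau$ and all bounded Borel $Y$; 2. $T_t=T_0-t$ for all $t\le T_0$, $\mathbb P^x$-a.s., for all $x\in E$; and for $x\in\{0\}\times\mathbb R^d\times F$, $\mathbb P^x$ is the Dirac mass at the constant path $x$; 3. for every $x\in E$ the set $\mathcal M^x$ of probabilities $\mathbb Q\sim\mathbb P^x$ under which $S$ is an $\mathbb F^0$-local martingale is non-empty; 4. for each $n\in\mathbb N$ there is $a_n\in\mathbb R$ such that, with $\tau_n=\inf\{t\ge0:|S_t|\ge n\}$, all coordinates of the stopped process $S^{\tau_n}$ are $\ge a_n$, $\mathbb P^x$-a.s., for all $x=(T,S,\eta)\in E$ with $|S|<n$. For $x\in E$, $z\ge 0$ and $\mathbb Q\in\mathcal M^x$, let $Z^{\mathbb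 Q}$ be an RCLL version of $t\mapsto\mathbb E^x[d\mathbb Q/d\mathbb P^x\mid\mathcal F_t]$, let $\mathbb P^{x,z;\mathbb Q}$ be the $\mathbb P^x$-law of $(X,zZ^{\mathbb Q})$ on $D_{\tilde E}$, where $\tilde E=E\times[0,\infty)$, and let $\tilde{\mathcal P}^{x,z}=\{\mathbb P^{x,z;\mathbb Q}:\mathbb Q\in\mathcal M^x\}$. Let $\tilde{\mathbb F}$ be the right-continuous hull of the raw filtration of the coordinate process $\tilde X$ on $D_{\tilde E}$. **Statement.** The family $(\tilde{\mathcal P}^{x,z})_{(x,z)\in\tilde E}$ is closed under concatenation: for all $(x,z)\in\tilde E$, all $\mu\in\tilde{\mathcal P}^{x,z}$, all $\tilde{\mathbb F}$-stopping times $\tilde\tau:D_{\tilde E}\to[0,\infty]$ and all selectors $\nu$ of $\tilde{\mathcal P}$, one has $\mu*_{\tilde\tau}\nu\in\tilde{\mathcal P}^{x,z}$. More precisely, let $\mu=\mathbb P^{x,z;\mathbb Q_0}$ with $\mathbb Q_0\in\mathcal M^x$. Then there is a universally measurable kernel $\kappa$ from $\tilde E$ to $D_E$ with $\kappa_{x',z'}\in\mathcal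 M^{x'}$ and $\nu_{x',z'}=\mathbb P^{x',z';\kappa_{x',z'}}$ for all $(x',z')\in\tilde E$, such that, with $\tau(\omega)=\tilde\tau(\omega,zZ^{\mathbb Q_0}(\omega))$, the pasted measure $$\hat{\mathbb Q}[A]=\int\!\!\int 1_A(\omega*_{\tau(\omega)}\omega')\,\kappa_{X_\tau(\omega),\,zZ^{\mathbb Q_0}_\tau(\omega)}(d\omega')\,\mathbb Q_0(d\omega)$$ belongs to $\mathcal M^x$ and $\mu*_{\tilde\tau}\nu=\mathbb P^{x,z;\hat{\mathbb Q}}$. -/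

import Mathlib

open MeasureTheory ProbabilityTheory Filter Set
open scoped NNReal ENNReal Topology

noncomputable section

namespace MarkovControl

/-! ### Path space -/

/-- The set `D_E` of right-continuous paths with left limits, indexed by `[0, ∞)`. -/
structure CadlagPath (E : Type*) [TopologicalSpace E] where
  toFun : ℝ≥0 → E
  rightCts : ∀ t, ContinuousWithinAt toFun (Ici t) t
  leftLim : ∀ t, ∃ l, Tendsto toFun (𝓝[<] t) (𝓝 l)

instance {E : Type*} [TopologicalSpace E] : CoeFun (CadlagPath E) (fun _ => ℝ≥0 → E) :=
  ⟨CadlagPath.toFun⟩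

/-- The σ-algebra generated by the coordinate maps (for Polish `E`, this is the Borel σ-algebra
of the Skorokhod topology). -/
instance {E : Type*} [TopologicalSpace E] [MeasurableSpace E] : MeasurableSpace (CadlagPath E) :=
  ⨆ t : ℝ≥0, MeasurableSpace.comap (fun ω : CadlagPath E => ω t) inferInstance

/-- The constant path. -/
def constPath {E : Type*} [TopologicalSpace E] (x : E) : CadlagPath E where
  toFun := fun _ => x
  rightCts := fun _ => continuousWithinAt_const
  leftLim := fun _ => ⟨x, tendsto_const_nhds⟩

theorem tendsto_tsub_nhdsLT {s t : ℝ≥0} (h : s < t) :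
    Tendsto (fun u : ℝ≥0 => u - s) (𝓝[<] t) (𝓝[<] (t - s)) := by
  refine tendsto_nhdsWithin_iff.2 ⟨?_, ?_⟩
  · exact ((continuous_id.sub continuous_const).tendsto t).mono_left nhdsWithin_le_nhds
  · have h1 : ∀ᶠ u in 𝓝[<] t, s < u := mem_nhdsWithin_of_mem_nhds (Ioi_mem_nhds h)
    filter_upwards [h1, self_mem_nhdsWithin] with u hu hut
    exact tsub_lt_tsub_right_of_le hu.le hut

theorem continuousWithinAt_comp_tsub {E : Type*} [TopologicalSpace E] (ω : CadlagPath E)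
    {s t : ℝ≥0} : ContinuousWithinAt (fun u => ω (u - s)) (Ici t) t := by
  have h : Tendsto (fun u : ℝ≥0 => u - s) (𝓝[≥] t) (𝓝[≥] (t - s)) := by
    refine tendsto_nhdsWithin_iff.2 ⟨?_, ?_⟩
    · exact ((continuous_id.sub continuous_const).tendsto t).mono_left nhdsWithin_le_nhds
    · filter_upwards [self_mem_nhdsWithin] with u hu
      exact tsub_le_tsub_right hu s
  exact (ω.rightCts (t - s)).tendsto.comp h

/-- The shift `θ_t`. -/
def shift {E : Type*} [TopologicalSpace E] (s : ℝ≥0) (ω : CadlagPath E) : CadlagPath E where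
  toFun := fun t => ω (s + t)
  rightCts := fun t => by
    have h : Tendsto (fun u : ℝ≥0 => s + u) (𝓝[≥] t) (𝓝[≥] (s + t)) := by
      refine tendsto_nhdsWithin_iff.2 ⟨?_, ?_⟩
      · exact ((continuous_const.add continuous_id).tendsto t).mono_left nhdsWithin_le_nhds
      · filter_upwards [self_mem_nhdsWithin] with u hu
        exact add_le_add_right (mem_Ici.1 hu) s
    exact (ω.rightCts (s + t)).tendsto.comp h
  leftLim := fun t => by
    obtain ⟨l, hl⟩ := ω.leftLim (s + t)
    refine ⟨l, hl.comp (tendsto_nhdsWithin_iff.2 ⟨?_, ?_⟩)⟩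
    · exact ((continuous_const.add continuous_id).tendsto t).mono_left nhdsWithin_le_nhds
    · filter_upwards [self_mem_nhdsWithin] with u hu
      exact add_lt_add_right (mem_Iio.1 hu) s

/-- Concatenation of paths at a finite time `s`: follow `ω` on `[0, s)`, and from time `s` on
follow `ω'`, started at time `s`. -/
def spliceAt {E : Type*} [TopologicalSpace E] (ω : CadlagPath E) (s : ℝ≥0) (ω' : CadlagPath E) :
    CadlagPath E where
  toFun := fun t => if t < s then ω t else ω' (t - s)
  rightCts := fun t => by
    by_cases h : t < s
    · have he : (fun u => if u < s then ω u else ω' (u - s)) =ᶠ[𝓝[≥] t] ω := by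
        have h1 : ∀ᶠ u in 𝓝[≥] t, u < s := mem_nhdsWithin_of_mem_nhds (Iio_mem_nhds h)
        filter_upwards [h1] with u hu
        simp [hu]
      exact (ω.rightCts t).congr_of_eventuallyEq he (by simp [h])
    · have he : (fun u => if u < s then ω u else ω' (u - s)) =ᶠ[𝓝[≥] t] fun u => ω' (u - s) := by
        filter_upwards [self_mem_nhdsWithin] with u hu
        simp [not_lt.2 ((not_lt.1 h).trans hu)]
      exact (continuousWithinAt_comp_tsub ω').congr_of_eventuallyEq he (by simp [h])
  leftLim := fun t => by
    by_cases h : t ≤ s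
    · obtain ⟨l, hl⟩ := ω.leftLim t
      refine ⟨l, hl.congr' ?_⟩
      filter_upwards [self_mem_nhdsWithin] with u hu
      simp [lt_of_lt_of_le (mem_Iio.1 hu) h]
    · obtain ⟨l, hl⟩ := ω'.leftLim (t - s)
      refine ⟨l, (hl.comp (tendsto_tsub_nhdsLT (not_le.1 h))).congr' ?_⟩
      have h1 : ∀ᶠ u in 𝓝[<] t, s < u := mem_nhdsWithin_of_mem_nhds (Ioi_mem_nhds (not_le.1 h))
      filter_upwards [h1] with u hu
      simp [not_lt.2 hu.le]

/-- The concatenation `ω *_σ ω'` at a time `σ ∈ [0, ∞]`; for `σ = ∞` it is `ω`. If `ω'` starts at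
the point `ω σ`, this agrees with the formula `ω σ + ω' (t - σ) - ω' 0` for `t ≥ σ` whenever the
state space has an addition. -/
def splice {E : Type*} [TopologicalSpace E] (ω : CadlagPath E) (σ : WithTop ℝ≥0)
    (ω' : CadlagPath E) : CadlagPath E :=
  match σ with
  | ⊤ => ω
  | (s : ℝ≥0) => spliceAt ω s ω'

/-- The value `X_σ(ω)` of the coordinate process at `σ`. At `σ = ∞`, where it only enters through
concatenations that ignore it, the value is irrelevant and set to `X_0(ω)`. -/
def evalAt {E : Type*} [TopologicalSpace E] (σ : WithTop ℝ≥0) (ω : CadlagPath E) : E :=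
  ω (σ.untopD 0)

/-- The raw filtration `𝔽⁰` generated by the coordinate process. -/
def rawFiltration (E : Type*) [TopologicalSpace E] [MeasurableSpace E] :
    Filtration ℝ≥0 (inferInstance : MeasurableSpace (CadlagPath E)) where
  seq t := ⨆ s : ℝ≥0, ⨆ _ : s ≤ t,
    MeasurableSpace.comap (fun ω : CadlagPath E => ω s) inferInstance
  mono' := fun _ _ hst => iSup_mono fun _ => iSup_le fun h => le_iSup_of_le (h.trans hst) le_rfl
  le' := fun _ => iSup_mono fun _ => iSup_le fun _ => le_rfl

/-- The right-continuous hull `𝔽` of the raw filtration. -/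
def pathFiltration (E : Type*) [TopologicalSpace E] [MeasurableSpace E] :
    Filtration ℝ≥0 (inferInstance : MeasurableSpace (CadlagPath E)) :=
  (rawFiltration E).rightCont

/-! ### Universally measurable kernels, selectors and concatenation of laws -/

/-- A map is universally measurable if the preimages of measurable sets belong to the completion
of the σ-algebra under every probability measure. -/
def UniversallyMeasurable {α β : Type*} [MeasurableSpace α] [MeasurableSpace β] (f : α → β) :
    Prop :=
  ∀ m : Measure α, IsProbabilityMeasure m → NullMeasurable f m

/-- A universally measurable (probability) kernel. -/
structure IsUniversallyMeasurableKernel {α Ω : Type*} [MeasurableSpace α] [MeasurableSpace Ω]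
    (ν : α → Measure Ω) : Prop where
  prob : ∀ x, IsProbabilityMeasure (ν x)
  meas : ∀ A : Set Ω, MeasurableSet A → UniversallyMeasurable (fun x => ν x A)

/-- Universally measurable selectors of a family `(𝓡^x)_x` of sets of laws. -/
structure IsSelector {α Ω : Type*} [MeasurableSpace α] [MeasurableSpace Ω]
    (𝓡 : α → Set (Measure Ω)) (ν : α → Measure Ω) : Prop where
  kernel : IsUniversallyMeasurableKernel ν
  mem : ∀ x, ν x ∈ 𝓡 x

/-- The law of `ω *_{τ(ω)} ω'` when `ω` has law `μ` and, given `ω`, `ω'` has law `k ω`. -/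
def pasteLaw {E : Type*} [TopologicalSpace E] [MeasurableSpace E] (μ : Measure (CadlagPath E))
    (τ : CadlagPath E → WithTop ℝ≥0) (k : CadlagPath E → Measure (CadlagPath E)) :
    Measure (CadlagPath E) :=
  μ.bind fun ω => (k ω).map (splice ω (τ ω))

/-- The concatenation `μ *_τ ν` of a law `μ` and a kernel `ν` at the random time `τ`. -/
def concatLaw {E : Type*} [TopologicalSpace E] [MeasurableSpace E] (μ : Measure (CadlagPath E))
    (τ : CadlagPath E → WithTop ℝ≥0) (ν : E → Measure (CadlagPath E)) : Measure (CadlagPath E) :=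
  pasteLaw μ τ fun ω => ν (evalAt (τ ω) ω)

/-- A family of sets of laws is closed under concatenation at the random times in `𝒯`. -/
def ClosedUnderConcatenation {E : Type*} [TopologicalSpace E] [MeasurableSpace E]
    (𝓡 : E → Set (Measure (CadlagPath E))) (𝒯 : Set (CadlagPath E → WithTop ℝ≥0)) : Prop :=
  ∀ x, ∀ μ ∈ 𝓡 x, ∀ τ ∈ 𝒯, ∀ ν, IsSelector 𝓡 ν → concatLaw μ τ ν ∈ 𝓡 x

/-! ### The market model -/

/-- The state space `[0, ∞) × ℝ^d × F` (time-to-go, asset prices, factors). -/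
abbrev State (d : ℕ) (F : Type*) := ℝ≥0 × EuclideanSpace ℝ (Fin d) × F

/-- Canonical strong Markov family, with respect to bounded `𝔽`-stopping times. -/
structure IsCanonicalStrongMarkov {E : Type*} [TopologicalSpace E] [MeasurableSpace E]
    (P : Kernel E (CadlagPath E)) : Prop where
  start : ∀ x, ∀ᵐ ω ∂(P x), ω 0 = x
  strongMarkov : ∀ (τ : CadlagPath E → WithTop ℝ≥0) (hτ : IsStoppingTime (pathFiltration E) τ),
    (∃ C : ℝ≥0, ∀ ω, τ ω ≤ C) →
    ∀ Y : CadlagPath E → ℝ, Measurable Y → (∃ C : ℝ, ∀ ω, |Y ω| ≤ C) →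
    ∀ x, (P x)[fun ω => Y (shift ((τ ω).untopD 0) ω) | hτ.measurableSpace]
      =ᵐ[P x] fun ω => ∫ ω', Y ω' ∂(P (evalAt (τ ω) ω))

section Market

variable {d : ℕ} {F : Type*} [TopologicalSpace F] [MeasurableSpace F]

/-- The asset-price process `S`. -/
def price (t : ℝ≥0) (ω : CadlagPath (State d F)) : EuclideanSpace ℝ (Fin d) := (ω t).2.1

/-- The finite-horizon assumption: the time-to-go decreases at unit speed, and states with no time
to go are absorbing. -/
structure FiniteHorizon (P : Kernel (State d F) (CadlagPath (State d F))) : Prop where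
  timeToGo : ∀ x, ∀ᵐ ω ∂(P x), ∀ t : ℝ≥0, t ≤ (ω 0).1 → (ω t).1 = (ω 0).1 - t
  absorbing : ∀ s η, P (0, s, η) = Measure.dirac (constPath (0, s, η))

/-- The set `ℳ^x` of probability measures equivalent to `P^x` under which `S` is a local martingale
with respect to the raw filtration. -/
def martingaleMeasures (P : Kernel (State d F) (CadlagPath (State d F))) (x : State d F) :
    Set (Measure (CadlagPath (State d F))) :=
  {Q | IsProbabilityMeasure Q ∧ Q ≪ P x ∧ P x ≪ Q ∧
    Locally (fun Y => Martingale Y (rawFiltration (State d F)) Q)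
      (rawFiltration (State d F)) price Q}

/-- No free lunch with vanishing risk, in its dual form. -/
def NFLVR (P : Kernel (State d F) (CadlagPath (State d F))) : Prop :=
  ∀ x, (martingaleMeasures P x).Nonempty

/-- The time `τ_n = inf {t ≥ 0 : |S_t| ≥ n}`. -/
def exitTime (n : ℕ) : CadlagPath (State d F) → WithTop ℝ≥0 :=
  hittingAfter price {s | (n : ℝ) ≤ ‖s‖} 0

/-- Uniform local boundedness from below: up to and including the time `τ_n`, all coordinates of `S`
are bounded from below by a constant `a_n` not depending on the starting point `x = (T, S, η)`
with `|S| < n`. (If `|S| ≥ n`, then `τ_n = 0` and the stopped process is the constant `S`.) -/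
def UniformlyLocallyBoundedBelow (P : Kernel (State d F) (CadlagPath (State d F))) : Prop :=
  ∀ n : ℕ, ∃ a : ℝ, ∀ x : State d F, ‖x.2.1‖ < n →
    ∀ᵐ ω ∂(P x), ∀ (t : ℝ≥0) (i : Fin d), a ≤ stoppedProcess price (exitTime n) t ω i

/-! ### The augmented family -/

/-- `ζ`, as a random element of `D_{[0, ∞)}`, is an RCLL version of the density process
`Z^Q_t = E^P[dQ/dP | 𝓕_t]`. -/
structure IsDensityProcess {E : Type*} [TopologicalSpace E] [MeasurableSpace E]
    (P Q : Measure (CadlagPath E)) (ζ : CadlagPath E → CadlagPath ℝ≥0) : Prop where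
  meas : Measurable ζ
  version : ∀ t : ℝ≥0, (fun ω => (ζ ω t : ℝ))
    =ᵐ[P] P[fun ω => (Q.rnDeriv P ω).toReal | pathFiltration E t]

/-- The path `t ↦ (ω t, z * ζ t)`. -/
def augment {E : Type*} [TopologicalSpace E] (z : ℝ≥0) (ω : CadlagPath E) (ζ : CadlagPath ℝ≥0) :
    CadlagPath (E × ℝ≥0) where
  toFun := fun t => (ω t, z * ζ t)
  rightCts := fun t => (ω.rightCts t).prodMk ((ζ.rightCts t).const_mul z)
  leftLim := fun t => by
    obtain ⟨l, hl⟩ := ω.leftLim t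
    obtain ⟨m, hm⟩ := ζ.leftLim t
    exact ⟨(l, z * m), hl.prodMk_nhds (hm.const_mul z)⟩

/-- `μ` is the law `P^{x,z;Q}` of `(X, z Z^Q)` under `P^x`. -/
def IsAugmentedLaw (P : Kernel (State d F) (CadlagPath (State d F))) (x : State d F) (z : ℝ≥0)
    (Q : Measure (CadlagPath (State d F))) (μ : Measure (CadlagPath (State d F × ℝ≥0))) : Prop :=
  ∃ ζ, IsDensityProcess (P x) Q ζ ∧ μ = (P x).map fun ω => augment z ω (ζ ω)

/-- The family of sets of laws `P^{x,z;Q}`, `Q ∈ ℳ^x`, indexed by `(x, z)`. -/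
def augmentedFamily (P : Kernel (State d F) (CadlagPath (State d F))) (p : State d F × ℝ≥0) :
    Set (Measure (CadlagPath (State d F × ℝ≥0))) :=
  {μ | ∃ Q ∈ martingaleMeasures P p.1, IsAugmentedLaw P p.1 p.2 Q μ}

end Market

end MarkovControl

end

open MarkovControl

/-! Density of the pasted measure. Weighting `P x` by the density of `Q` at time `t` gives the past
up to `t` the law it has under `Q` and leaves the evolution after `t` equal to `P`. Events of the
form "past up to `t` and future from `t`" generate the σ-algebra and form a π-system, so this
property characterises the density process (`isDensityProcess_of_setLIntegral`). If the law after
`τ` is changed to a kernel `κ`, the density must therefore be `ζ` before `τ` and, afterwards, `ζ` at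
`τ` times the density of `κ` read along the shifted path (`pasteDensity`).
`isDensityProcess_pasteLaw` verifies this separately on `t < τ` and `τ ≤ t`. Multiplied by `z`, the
factor `ζ` at `τ` becomes the weight coordinate of the augmented state at `τ`. The augmented path is
thus itself a concatenation, and the strong Markov property identifies its law with the concatenated
law (`concatLaw_map_augment`).

The pasted measure is a martingale measure. Pasting `P` into `P x` at `τ` gives `P x` back, and
absolute continuity passes through pasting fibre by fibre, so the pasted measure is equivalent to `P
x` (`pasteLaw_strongMarkov`, `absolutelyContinuous_pasteLaw`). For the local martingale property,
localising sequences belonging to different measures need not fit together. Instead a single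
sequence serves all measures and starting points: the level times, at which the running supremum of
`|S|` reaches `n`. The lower bound and Fatou's lemma make the price stopped there a true martingale
under every martingale measure (`martingale_stoppedPrice`). Along a concatenated path the stopped
price is that of the past plus an increment of that of the future (`stoppedPrice_splice`). These
increments have mean zero, and the lower bound, uniform in the starting point, supplies
integrability (`martingale_pasteLaw`).

Measurability. For `z ≠ 0` the measure `Q` is recovered from its augmented law by integrating the
weight coordinate; for `z = 0` the law does not depend on `Q`, and the choice made at `z = 1` is
used (`exists_selector_of_augmented`). Densities measurable in the parameter come from Radon–Nikodym
derivatives of kernels at rational times, assembled into paths by a measurable extension map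
(`exists_measurable_path_of_trace`). Universally measurable kernels are replaced by Borel ones off a
null set of the law of the state at `τ`. Since density processes are adapted only up to null sets, a
stopping time of the augmented path is replaced by an almost surely equal stopping time of the path
(`exists_isStoppingTime_ae_eq`), and pasts are enlarged by null sets (`nullExt`). -/

noncomputable section

namespace MarkovControl

-- Times live in `WithTop ℝ≥0`, which unfolds to the same type as `ℝ≥0∞`; this simp lemma would turn
-- finite times into extended nonnegative reals.
attribute [-simp] ENNReal.some_eq_coe'

/-! ### Discretisation of time from the right -/

/-- The smallest multiple of `1 / (k + 1)` that is strictly larger than `u`. -/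
def gridAbove (k : ℕ) (u : ℝ≥0) : ℝ≥0 := (⌊u * (k + 1)⌋₊ + 1) / (k + 1)

theorem lt_gridAbove (k : ℕ) (u : ℝ≥0) : u < gridAbove k u := by
  rw [gridAbove, lt_div_iff₀ (by positivity)]
  exact Nat.lt_floor_add_one _

theorem gridAbove_le (k : ℕ) (u : ℝ≥0) : gridAbove k u ≤ u + 1 / (k + 1) := by
  rw [gridAbove, add_div]
  gcongr
  rw [div_le_iff₀ (by positivity)]
  exact Nat.floor_le (by positivity)

theorem tendsto_gridAbove (u : ℝ≥0) :
    Tendsto (fun k => gridAbove k u) atTop (𝓝[≥] u) := by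
  refine tendsto_nhdsWithin_iff.2 ⟨?_, Eventually.of_forall fun k => (lt_gridAbove k u).le⟩
  refine tendsto_of_tendsto_of_tendsto_of_le_of_le tendsto_const_nhds ?_
    (fun k => (lt_gridAbove k u).le) fun k => gridAbove_le k u
  have h : Tendsto (fun k : ℕ => (1 : ℝ≥0) / ((k : ℝ≥0) + 1)) atTop (𝓝 0) :=
    tendsto_one_div_add_atTop_nhds_zero_nat
  simpa using h.const_add u

theorem exists_nnrat_eq_gridAbove (k : ℕ) (u : ℝ≥0) : ∃ q : ℚ≥0, gridAbove k u = (q : ℝ≥0) :=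
  ⟨(⌊u * (k + 1)⌋₊ + 1) / (k + 1), by simp [gridAbove]⟩

theorem countable_range_gridAbove (k : ℕ) : (range (gridAbove k)).Countable :=
  (countable_range fun n : ℕ => ((n : ℝ≥0) + 1) / ((k : ℝ≥0) + 1)).mono <| by
    rintro _ ⟨u, rfl⟩
    exact ⟨_, rfl⟩

/-- The grid point lies strictly above `u`, so the event is a strict inequality with a bound not
exceeding `t`. This is why discretising a stopping time of the right-continuous hull yields a
stopping time of the original filtration. -/
theorem gridAbove_le_iff_lt (k : ℕ) (u t : ℝ≥0) :
    gridAbove k u ≤ t ↔ u < ⌊t * (k + 1)⌋₊ / ((k : ℝ≥0) + 1) := by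
  have hk : (0 : ℝ≥0) < k + 1 := by positivity
  rw [gridAbove, div_le_iff₀ hk, lt_div_iff₀ hk, ← Nat.floor_lt (by positivity),
    ← Nat.cast_add_one, ← Nat.le_floor_iff (by positivity), Nat.succ_le_iff]

/-- A family of maps which are right-continuous in time is jointly measurable. -/
theorem measurable_uncurry_of_rightCts {Ω β : Type*} [MeasurableSpace Ω] [TopologicalSpace β]
    [TopologicalSpace.PseudoMetrizableSpace β] [MeasurableSpace β] [BorelSpace β]
    {f : ℝ≥0 → Ω → β} (hf : ∀ t, Measurable (f t))
    (hc : ∀ ω t, ContinuousWithinAt (fun s => f s ω) (Ici t) t) :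
    Measurable fun p : ℝ≥0 × Ω => f p.1 p.2 := by
  refine measurable_of_tendsto_metrizable
    (f := fun (k : ℕ) (p : ℝ≥0 × Ω) => f (gridAbove k p.1) p.2) (fun k => ?_) ?_
  · have h1 : Measurable fun q : ℕ × Ω => f (((q.1 : ℝ≥0) + 1) / ((k : ℝ≥0) + 1)) q.2 :=
      by
      refine measurable_from_prod_countable_right fun n => ?_
      exact hf (((n : ℝ≥0) + 1) / ((k : ℝ≥0) + 1))
    have h2 : Measurable fun p : ℝ≥0 × Ω => (⌊p.1 * (k + 1)⌋₊, p.2) :=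
      (Nat.measurable_floor.comp (measurable_fst.mul_const _)).prodMk measurable_snd
    have h3 := h1.comp h2
    simp only [Function.comp_def] at h3
    simpa only [gridAbove] using h3
  · exact tendsto_pi_nhds.2 fun p => (hc p.2 p.1).tendsto.comp (tendsto_gridAbove p.1)

/-! ### Measurability of operations on paths -/

section Paths

variable {E : Type*} [TopologicalSpace E]

@[ext]
theorem CadlagPath.ext {ω ω' : CadlagPath E} (h : ∀ t, ω t = ω' t) : ω = ω' := by
  cases ω; cases ω'
  congr
  exact funext h

theorem splice_apply (ω : CadlagPath E) (σ : WithTop ℝ≥0) (ω' : CadlagPath E) (t : ℝ≥0) :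
    splice ω σ ω' t = if (t : WithTop ℝ≥0) < σ then ω t else ω' (t - σ.untopD 0) := by
  cases σ with
  | top => simp [splice]
  | coe s => simp [splice, spliceAt]

/-- The path stopped at `σ`. -/
def stopPath (σ : WithTop ℝ≥0) (ω : CadlagPath E) : CadlagPath E :=
  splice ω σ (constPath (evalAt σ ω))

theorem stopPath_apply (σ : WithTop ℝ≥0) (ω : CadlagPath E) (t : ℝ≥0) :
    stopPath σ ω t = ω ((min (t : WithTop ℝ≥0) σ).untopD 0) := by
  rw [stopPath, splice_apply]
  split_ifs with h
  · simp [min_eq_left h.le]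
  · rw [min_eq_right (not_lt.1 h)]
    rfl

/-- A concatenation sees its first argument only through the stopped path, which belongs to the past
of the stopping time. Functionals of concatenated paths thereby become functions of past and future,
as the strong Markov property requires. -/
theorem splice_stopPath (ω : CadlagPath E) (σ : WithTop ℝ≥0) (ω' : CadlagPath E) :
    splice (stopPath σ ω) σ ω' = splice ω σ ω' := by
  ext t
  rw [splice_apply, splice_apply]
  split_ifs with h
  · simp [stopPath_apply, min_eq_left h.le]
  · rfl

theorem evalAt_stopPath (ω : CadlagPath E) (σ : WithTop ℝ≥0) :
    evalAt σ (stopPath σ ω) = evalAt σ ω := by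
  cases σ with
  | top => simp [evalAt, stopPath_apply]
  | coe s => simp [evalAt, stopPath_apply]

theorem splice_shift (ω : CadlagPath E) (s : ℝ≥0) : splice ω s (shift s ω) = ω := by
  ext t
  rw [splice_apply]
  split_ifs with h
  · rfl
  · have h' : s ≤ t := by simpa using h
    simp [shift, add_tsub_cancel_of_le h']

variable [MeasurableSpace E]

theorem measurable_coordinate (t : ℝ≥0) : Measurable fun ω : CadlagPath E => ω t :=
  measurable_iff_comap_le.2 (le_iSup (fun t : ℝ≥0 =>
    MeasurableSpace.comap (fun ω : CadlagPath E => ω t) inferInstance) t)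

theorem measurable_path_iff {α : Type*} {_ : MeasurableSpace α} {f : α → CadlagPath E} :
    Measurable f ↔ ∀ t, Measurable fun a => f a t := by
  refine ⟨fun h t => (measurable_coordinate t).comp h, fun h => ?_⟩
  rw [measurable_iff_comap_le]
  simp only [instMeasurableSpaceCadlagPath, MeasurableSpace.comap_iSup, iSup_le_iff,
    MeasurableSpace.comap_comp]
  exact fun t => (h t).comap_le

theorem measurable_coordinate_rawFiltration {s t : ℝ≥0} (h : s ≤ t) :
    Measurable[rawFiltration E t] fun ω : CadlagPath E => ω s :=
  measurable_iff_comap_le.2 (le_iSup₂_of_le (f := fun (s : ℝ≥0) (_ : s ≤ t) =>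
    MeasurableSpace.comap (fun ω : CadlagPath E => ω s) inferInstance) s h le_rfl)

theorem measurable_rawFiltration_iff {α : Type*} {_ : MeasurableSpace α} {f : α → CadlagPath E}
    {t : ℝ≥0} :
    Measurable[_, rawFiltration E t] f ↔ ∀ s ≤ t, Measurable fun a => f a s := by
  refine ⟨fun h s hs => (measurable_coordinate_rawFiltration hs).comp h, fun h => ?_⟩
  rw [measurable_iff_comap_le]
  change MeasurableSpace.comap f (⨆ s : ℝ≥0, ⨆ _ : s ≤ t,
    MeasurableSpace.comap (fun ω : CadlagPath E => ω s) inferInstance) ≤ _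
  simp only [MeasurableSpace.comap_iSup, iSup_le_iff, MeasurableSpace.comap_comp]
  exact fun s hs => (h s hs).comap_le

/-- The raw σ-algebra at `t` is pulled back along the restriction of paths to `[0, t]`, hence cannot
separate paths that agree there. -/
theorem mem_iff_of_eqOn_of_rawFiltration {t : ℝ≥0} {A : Set (CadlagPath E)}
    (hA : MeasurableSet[rawFiltration E t] A) {ω ω' : CadlagPath E} (h : ∀ s ≤ t, ω s = ω' s) :
    ω ∈ A ↔ ω' ∈ A := by
  have hgen : rawFiltration E t = MeasurableSpace.comap
      (fun (ω : CadlagPath E) (s : Iic t) => ω s) MeasurableSpace.pi := by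
    change (⨆ s : ℝ≥0, ⨆ _ : s ≤ t,
      MeasurableSpace.comap (fun ω : CadlagPath E => ω s) inferInstance) = _
    simp only [MeasurableSpace.pi, MeasurableSpace.comap_iSup, MeasurableSpace.comap_comp,
      iSup_subtype]
    rfl
  rw [hgen] at hA
  obtain ⟨B, -, rfl⟩ := hA
  have : (fun s : Iic t => ω s) = fun s : Iic t => ω' s := funext fun s => h s s.2
  simp only [mem_preimage, this]

theorem shift_measurable (s : ℝ≥0) : Measurable (shift s : CadlagPath E → CadlagPath E) :=
  measurable_path_iff.2 fun t => measurable_coordinate (s + t)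

theorem measurable_splice_rawFiltration (ω : CadlagPath E) (u t : ℝ≥0) :
    Measurable[rawFiltration E (t - u), rawFiltration E t]
      (fun ω' => splice ω (u : WithTop ℝ≥0) ω') := by
  refine measurable_rawFiltration_iff.2 fun s hs => ?_
  simp only [splice_apply, WithTop.coe_lt_coe, WithTop.untopD_coe]
  split_ifs with h
  · exact measurable_const
  · exact measurable_coordinate_rawFiltration (tsub_le_tsub_right hs u)

theorem iSup_rawFiltration :
    (⨆ n : ℕ, (rawFiltration E n : MeasurableSpace (CadlagPath E))) =
      (inferInstance : MeasurableSpace (CadlagPath E)) := by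
  refine le_antisymm (iSup_le fun n => (rawFiltration E).le n) (iSup_le fun t => ?_)
  obtain ⟨n, hn⟩ := exists_nat_ge t
  exact le_iSup_of_le n (measurable_coordinate_rawFiltration hn).comap_le

/-- Sets determined by the path up to `t` and sets determined by the path from `t` on generate
the σ-algebra. -/
theorem generateFrom_past_inter_future (t : ℝ≥0) :
    (inferInstance : MeasurableSpace (CadlagPath E)) = MeasurableSpace.generateFrom
      {C | ∃ A B, MeasurableSet[rawFiltration E t] A ∧ MeasurableSet B ∧
        C = A ∩ shift t ⁻¹' B} := by
  refine le_antisymm (iSup_le fun s => ?_) (MeasurableSpace.generateFrom_le ?_)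
  · rintro _ ⟨U, hU, rfl⟩
    rcases le_total s t with h | h
    · exact MeasurableSpace.measurableSet_generateFrom ⟨_, univ,
        measurable_coordinate_rawFiltration h hU, MeasurableSet.univ, by simp⟩
    · refine MeasurableSpace.measurableSet_generateFrom ⟨univ, _, MeasurableSet.univ,
        measurable_coordinate (s - t) hU, ?_⟩
      ext ω
      simp [shift, add_tsub_cancel_of_le h]
  · rintro _ ⟨A, B, hA, hB, rfl⟩
    exact ((rawFiltration E).le t A hA).inter (shift_measurable t hB)

theorem isPiSystem_past_inter_future (t : ℝ≥0) :
    IsPiSystem {C : Set (CadlagPath E) | ∃ A B, MeasurableSet[rawFiltration E t] A ∧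
      MeasurableSet B ∧ C = A ∩ shift t ⁻¹' B} := by
  rintro _ ⟨A, B, hA, hB, rfl⟩ _ ⟨A', B', hA', hB', rfl⟩ -
  exact ⟨A ∩ A', B ∩ B', hA.inter hA', hB.inter hB', by rw [preimage_inter, inter_inter_inter_comm]⟩

variable [TopologicalSpace.PseudoMetrizableSpace E] [BorelSpace E]

theorem measurable_eval : Measurable fun p : ℝ≥0 × CadlagPath E => p.2 p.1 :=
  measurable_uncurry_of_rightCts (f := fun t (ω : CadlagPath E) => ω t) measurable_coordinate
    fun ω t => ω.rightCts t

theorem continuousWithinAt_min {β : Type*} [TopologicalSpace β] {f : ℝ≥0 → β}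
    (hf : ∀ t, ContinuousWithinAt f (Ici t) t) (a t : ℝ≥0) :
    ContinuousWithinAt (fun s => f (min s a)) (Ici t) t := by
  refine (hf (min t a)).tendsto.comp (tendsto_nhdsWithin_iff.2 ⟨?_, ?_⟩)
  · exact ((continuous_id.min continuous_const).tendsto t).mono_left nhdsWithin_le_nhds
  · filter_upwards [self_mem_nhdsWithin] with s hs
    exact min_le_min_right a hs

/-- Progressive measurability: freezing time at `a` keeps the evaluation inside the raw σ-algebra of
time `a`. It makes the stopped price adapted. -/
theorem measurable_eval_min (a : ℝ≥0) :
    Measurable[Prod.instMeasurableSpace (m₂ := rawFiltration E a)]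
      fun p : ℝ≥0 × CadlagPath E => p.2 (min p.1 a) :=
  @measurable_uncurry_of_rightCts _ _ (rawFiltration E a) _ _ _ _
    (fun t (ω : CadlagPath E) => ω (min t a))
    (fun t => measurable_coordinate_rawFiltration (min_le_right t a))
    fun ω t => continuousWithinAt_min ω.rightCts a t

theorem _root_.Measurable.path_apply {α : Type*} {_ : MeasurableSpace α} {f : α → CadlagPath E}
    {s : α → ℝ≥0} (hf : Measurable f) (hs : Measurable s) : Measurable fun a => f a (s a) :=
  measurable_eval.comp (hs.prodMk hf)

theorem _root_.Measurable.evalAt {α : Type*} {_ : MeasurableSpace α} {f : α → CadlagPath E}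
    {s : α → WithTop ℝ≥0} (hf : Measurable f) (hs : Measurable s) :
    Measurable fun a => evalAt (s a) (f a) :=
  hf.path_apply (hs.untopD 0)

theorem _root_.Measurable.splice {α : Type*} {_ : MeasurableSpace α} {f g : α → CadlagPath E}
    {s : α → WithTop ℝ≥0} (hf : Measurable f) (hs : Measurable s) (hg : Measurable g) :
    Measurable fun a => splice (f a) (s a) (g a) := by
  refine measurable_path_iff.2 fun t => ?_
  simp only [splice_apply]
  exact Measurable.ite (measurableSet_lt measurable_const hs)
    ((measurable_coordinate t).comp hf) (hg.path_apply (measurable_const.sub (hs.untopD 0)))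

theorem _root_.Measurable.shift {α : Type*} {_ : MeasurableSpace α} {f : α → CadlagPath E}
    {s : α → ℝ≥0} (hf : Measurable f) (hs : Measurable s) :
    Measurable fun a => shift (s a) (f a) :=
  measurable_path_iff.2 fun t => hf.path_apply (hs.add_const t)

omit [TopologicalSpace.PseudoMetrizableSpace E] [BorelSpace E] in
theorem _root_.Measurable.augment {α : Type*} {_ : MeasurableSpace α} {f : α → CadlagPath E}
    {g : α → CadlagPath ℝ≥0} {z : α → ℝ≥0} (hz : Measurable z) (hf : Measurable f)
    (hg : Measurable g) : Measurable fun a => augment (z a) (f a) (g a) :=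
  measurable_path_iff.2 fun t => ((measurable_coordinate t).comp hf).prodMk
    (hz.mul ((measurable_coordinate t).comp hg))

/-- Multiplication of a path by a constant. -/
def scalePath (c : ℝ≥0) (y : CadlagPath ℝ≥0) : CadlagPath ℝ≥0 where
  toFun := fun t => c * y t
  rightCts := fun t => (y.rightCts t).const_mul c
  leftLim := fun t => by
    obtain ⟨l, hl⟩ := y.leftLim t
    exact ⟨_, hl.const_mul c⟩

theorem _root_.Measurable.scalePath {α : Type*} {_ : MeasurableSpace α}
    {g : α → CadlagPath ℝ≥0} {z : α → ℝ≥0} (hz : Measurable z)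
    (hg : Measurable g) : Measurable fun a => scalePath (z a) (g a) :=
  measurable_path_iff.2 fun t => hz.mul ((measurable_coordinate t).comp hg)

omit [TopologicalSpace.PseudoMetrizableSpace E] [BorelSpace E] [MeasurableSpace E] in
theorem CadlagPath.ext_nnrat [T2Space E] {ω ω' : CadlagPath E}
    (h : ∀ q : ℚ≥0, ω (q : ℝ≥0) = ω' (q : ℝ≥0)) : ω = ω' := by
  ext t
  have h1 := (ω.rightCts t).tendsto.comp (tendsto_gridAbove t)
  have h2 := (ω'.rightCts t).tendsto.comp (tendsto_gridAbove t)
  refine tendsto_nhds_unique h1 (h2.congr fun k => ?_)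
  obtain ⟨q, hq⟩ := exists_nnrat_eq_gridAbove k t
  simp only [Function.comp, hq, h]

theorem measurable_path_iff_nnrat {α : Type*} {_ : MeasurableSpace α} {f : α → CadlagPath E} :
    Measurable f ↔ ∀ q : ℚ≥0, Measurable fun a => f a (q : ℝ≥0) := by
  refine ⟨fun h q => measurable_path_iff.1 h q, fun h => measurable_path_iff.2 fun t => ?_⟩
  refine measurable_of_tendsto_metrizable (f := fun (k : ℕ) a => f a (gridAbove k t)) (fun k => ?_)
    (tendsto_pi_nhds.2 fun a => ((f a).rightCts t).tendsto.comp (tendsto_gridAbove t))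
  obtain ⟨q, hq⟩ := exists_nnrat_eq_gridAbove k t
  rw [hq]
  exact h q

/-- By right continuity the σ-algebra is pulled back from a countable product along evaluation at
rational times. Countable generation is needed for Borel versions of kernels and for their jointly
measurable derivatives. -/
theorem countablyGenerated_path [SecondCountableTopology E] :
    MeasurableSpace.CountablyGenerated (CadlagPath E) := by
  have h : (inferInstance : MeasurableSpace (CadlagPath E)) =
      MeasurableSpace.comap (fun (ω : CadlagPath E) (q : ℚ≥0) => ω (q : ℝ≥0))
        MeasurableSpace.pi := by
    refine le_antisymm ?_ ?_
    · have hid : @Measurable _ _ (MeasurableSpace.comap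
          (fun (ω : CadlagPath E) (q : ℚ≥0) => ω (q : ℝ≥0)) MeasurableSpace.pi) _
          (id : CadlagPath E → CadlagPath E) :=
        measurable_path_iff_nnrat.2 fun q => (measurable_pi_apply q).comp
          (comap_measurable fun (ω : CadlagPath E) (q : ℚ≥0) => ω (q : ℝ≥0))
      simpa using hid.comap_le
    · exact (measurable_pi_lambda _ fun q : ℚ≥0 => measurable_coordinate (q : ℝ≥0)).comap_le
  have := MeasurableSpace.CountablyGenerated.comap
    (fun (ω : CadlagPath E) (q : ℚ≥0) => ω (q : ℝ≥0))
  rwa [← h] at this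

end Paths

/-! ### Recovering a path from its values at rational times -/

theorem exists_nnrat_between {t u : ℝ≥0} (h : t < u) : ∃ q : ℚ≥0, t < q ∧ (q : ℝ≥0) < u := by
  have h1 : ∀ᶠ k in atTop, gridAbove k t < u :=
    (tendsto_nhdsWithin_iff.1 (tendsto_gridAbove t)).1.eventually (gt_mem_nhds h)
  obtain ⟨k, hk⟩ := h1.exists
  obtain ⟨q, hq⟩ := exists_nnrat_eq_gridAbove k t
  exact ⟨q, hq ▸ lt_gridAbove k t, hq ▸ hk⟩

/-- There are `K` consecutive pairs of rational times in `[a, b]` along each of which `f` moves by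
more than `ε`. -/
def HasOscillations (f : ℚ≥0 → ℝ≥0) (ε : ℝ) : ℕ → ℝ≥0 → ℝ≥0 → Prop
  | 0, _, _ => True
  | K + 1, a, b => ∃ q r : ℚ≥0, a ≤ q ∧ q < r ∧ (r : ℝ≥0) ≤ b ∧ ε < dist (f q) (f r) ∧
      HasOscillations f ε K r b

theorem HasOscillations.mono {f : ℚ≥0 → ℝ≥0} {ε : ℝ} {K : ℕ} {a a' b : ℝ≥0} (h : a' ≤ a)
    (hK : HasOscillations f ε K a b) : HasOscillations f ε K a' b := by
  cases K with
  | zero => trivial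
  | succ K =>
    obtain ⟨q, r, h1, h2⟩ := hK
    exact ⟨q, r, h.trans h1, h2⟩

theorem measurableSet_hasOscillations (ε : ℝ) (K : ℕ) (a b : ℝ≥0) :
    MeasurableSet {f : ℚ≥0 → ℝ≥0 | HasOscillations f ε K a b} := by
  induction K generalizing a with
  | zero => simp [HasOscillations]
  | succ K ih =>
    simp only [HasOscillations, ofPred_exists]
    refine MeasurableSet.iUnion fun q => MeasurableSet.iUnion fun r => ?_
    refine (MeasurableSet.const _).inter ((MeasurableSet.const _).inter
      ((MeasurableSet.const _).inter (MeasurableSet.inter ?_ (ih r))))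
    exact measurableSet_lt measurable_const
      ((measurable_pi_apply q).dist (measurable_pi_apply r))

/-- Let `A` be the set of left endpoints from which the oscillations up to `b` are bounded in
number. Right continuity puts the infimum of `A` into `A`, and the existence of a left limit there
would extend `A` further to the left unless that infimum is `0`. -/
theorem CadlagPath.exists_not_hasOscillations (y : CadlagPath ℝ≥0) {ε : ℝ} (hε : 0 < ε)
    (b : ℝ≥0) : ∃ K, ¬ HasOscillations (fun q : ℚ≥0 => y (q : ℝ≥0)) ε K 0 b := by
  -- The first pair cannot lie wholly before `t`, so it ends at or after `t` and all later pairs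
  -- start there: moving the endpoint from `t` to `a` costs at most one extra pair.
  have step : ∀ a t : ℝ≥0, (∀ u v : ℝ≥0, a ≤ u → u < v → v < t → dist (y u) (y v) ≤ ε) →
      (∃ K, ¬ HasOscillations (fun q : ℚ≥0 => y (q : ℝ≥0)) ε K t b) →
      ∃ K, ¬ HasOscillations (fun q : ℚ≥0 => y (q : ℝ≥0)) ε K a b := by
    rintro a t hosc ⟨K, hK⟩
    refine ⟨K + 1, ?_⟩
    rintro ⟨q, r, h1, h2, h3, h4, h5⟩
    rcases lt_or_ge (r : ℝ≥0) t with h | h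
    · exact absurd (hosc q r h1 (by exact_mod_cast h2) h) (not_le.2 h4)
    · exact hK (h5.mono h)
  set A := {a : ℝ≥0 | ∃ K, ¬ HasOscillations (fun q : ℚ≥0 => y (q : ℝ≥0)) ε K a b} with hA
  have hbA : b ∈ A := by
    refine ⟨1, ?_⟩
    rintro ⟨q, r, h1, h2, h3, -, -⟩
    have : (q : ℝ≥0) < r := by exact_mod_cast h2
    exact absurd (h1.trans_lt this) (not_lt.2 h3)
  set s := sInf A with hs
  have hsA : s ∈ A := by
    have hc := Metric.tendsto_nhds.1 (y.rightCts s).tendsto (ε / 2) (by positivity)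
    obtain ⟨u, hu, hsub⟩ := mem_nhdsGE_iff_exists_Ico_subset.1 hc
    obtain ⟨t, htA, htu⟩ := exists_lt_of_csInf_lt ⟨b, hbA⟩ (hs ▸ mem_Ioi.1 hu)
    refine step s t (fun v w hv hvw hwt => ?_) htA
    have h1 := hsub (show v ∈ Ico s u from ⟨hv, (hvw.trans hwt).trans htu⟩)
    have h2 := hsub (show w ∈ Ico s u from ⟨hv.trans hvw.le, hwt.trans htu⟩)
    simp only [mem_ofPred_eq] at h1 h2
    linarith [dist_triangle_right (y v) (y w) (y s)]
  rcases eq_or_ne s 0 with h0 | h0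
  · rw [h0] at hsA; exact hsA
  exfalso
  obtain ⟨l, hl⟩ := y.leftLim s
  have hc := Metric.tendsto_nhds.1 hl (ε / 2) (by positivity)
  obtain ⟨u, hu, hsub⟩ := (mem_nhdsLT_iff_exists_Ioo_subset' (pos_iff_ne_zero.2 h0)).1 hc
  obtain ⟨u', hu', hus⟩ := exists_between (mem_Iio.1 hu)
  have huA : u' ∈ A := by
    refine step u' s (fun v w hv hvw hwt => ?_) hsA
    have h1 := hsub (show v ∈ Ioo u s from ⟨hu'.trans_le hv, hvw.trans hwt⟩)
    have h2 := hsub (show w ∈ Ioo u s from ⟨hu'.trans_le (hv.trans hvw.le), hwt⟩)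
    simp only [mem_ofPred_eq] at h1 h2
    linarith [dist_triangle_right (y v) (y w) l]
  exact absurd (csInf_le (OrderBot.bddBelow A) huA) (not_le.2 hus)

/-- The functions on the rational times which are the restriction of a path. -/
def pathTraces : Set (ℚ≥0 → ℝ≥0) :=
  -- Bounded oscillation counts give one-sided limits at all real times; the second condition makes
  -- the right limit at a rational time equal to the given value. Both involve only countably many
  -- coordinates.
  {f | (∀ n b : ℕ, ∃ K, ¬ HasOscillations f (1 / ((n : ℝ) + 1)) K 0 b) ∧
    ∀ (q : ℚ≥0) (n : ℕ), ∃ m : ℕ, ∀ r : ℚ≥0, q < r → r < q + 1 / ((m : ℚ≥0) + 1) →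
      dist (f r) (f q) ≤ 1 / ((n : ℝ) + 1)}

theorem measurableSet_pathTraces : MeasurableSet pathTraces := by
  have h : pathTraces = (⋂ (n : ℕ) (b : ℕ), ⋃ K,
      {f | HasOscillations f (1 / ((n : ℝ) + 1)) K 0 b}ᶜ) ∩
      ⋂ (q : ℚ≥0) (n : ℕ), ⋃ m : ℕ, ⋂ (r : ℚ≥0) (_ : q < r) (_ : r < q + 1 / ((m : ℚ≥0) + 1)),
        {f | dist (f r) (f q) ≤ 1 / ((n : ℝ) + 1)} := by
    ext f
    simp [pathTraces]
  rw [h]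
  refine MeasurableSet.inter ?_ ?_
  · exact MeasurableSet.iInter fun n => MeasurableSet.iInter fun b => MeasurableSet.iUnion fun K =>
      (measurableSet_hasOscillations _ K 0 b).compl
  · refine MeasurableSet.iInter fun q => MeasurableSet.iInter fun n => MeasurableSet.iUnion fun m =>
      MeasurableSet.iInter fun r => MeasurableSet.iInter fun _ => MeasurableSet.iInter fun _ => ?_
    exact measurableSet_le ((measurable_pi_apply r).dist (measurable_pi_apply q)) measurable_const

theorem CadlagPath.mem_pathTraces (y : CadlagPath ℝ≥0) :
    (fun q : ℚ≥0 => y (q : ℝ≥0)) ∈ pathTraces := by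
  refine ⟨fun n b => y.exists_not_hasOscillations (by positivity) b, fun q n => ?_⟩
  have hc := Metric.tendsto_nhds.1 (y.rightCts q).tendsto (1 / ((n : ℝ) + 1)) (by positivity)
  obtain ⟨u, hu, hsub⟩ := mem_nhdsGE_iff_exists_Ico_subset.1 hc
  have h : Tendsto (fun k : ℕ => (q : ℝ≥0) + (1 : ℝ≥0) / ((k : ℝ≥0) + 1)) atTop
      (𝓝 ((q : ℝ≥0) + 0)) :=
    tendsto_one_div_add_atTop_nhds_zero_nat.const_add _
  rw [add_zero] at h
  obtain ⟨m, hm⟩ := (h.eventually (gt_mem_nhds (mem_Ioi.1 hu))).exists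
  refine ⟨m, fun r hr hr' => (hsub (a := (r : ℝ≥0)) ⟨?_, ?_⟩).le⟩
  · exact_mod_cast hr.le
  · refine lt_trans ?_ hm
    have : (r : ℝ≥0) < ((q + 1 / ((m : ℚ≥0) + 1) : ℚ≥0) : ℝ≥0) := NNRat.cast_lt.2 hr'
    simpa using this

/-! ### One-sided limits along rational times -/

section Extension

variable {f : ℚ≥0 → ℝ≥0}

/-- If the values along rationals decreasing to `t` were not Cauchy, oscillations of a fixed size
would occur arbitrarily close to `t`. Stacking each new pair to the left of the previous ones would
give arbitrarily many, against the bound. -/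
theorem exists_rightLimit (hf : f ∈ pathTraces) (t : ℝ≥0) :
    ∃ l, ∀ ε > 0, ∃ u > t, ∀ q : ℚ≥0, t < q → (q : ℝ≥0) < u → dist (f q) l ≤ ε := by
  set F := comap (fun q : ℚ≥0 => (q : ℝ≥0)) (𝓝[>] t) with hF
  have hmem : ∀ u > t, {q : ℚ≥0 | t < q ∧ (q : ℝ≥0) < u} ∈ F := fun u hu =>
    ⟨Ioo t u, Ioo_mem_nhdsGT hu, fun q hq => hq⟩
  have hbasis : ∀ s ∈ F, ∃ u > t, ∀ q : ℚ≥0, t < q → (q : ℝ≥0) < u → q ∈ s := by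
    rintro s ⟨v, hv, hvs⟩
    obtain ⟨u, hu, hsub⟩ := mem_nhdsGT_iff_exists_Ioo_subset.1 hv
    exact ⟨u, hu, fun q h1 h2 => hvs (hsub ⟨h1, h2⟩)⟩
  have hne : F.NeBot := by
    refine ⟨fun h => ?_⟩
    obtain ⟨u, hu, h'⟩ := hbasis ∅ (h ▸ mem_bot)
    obtain ⟨q, hq, hqu⟩ := exists_nnrat_between hu
    exact h' q hq hqu
  have hcauchy : Cauchy (map f F) := by
    refine Metric.cauchy_iff.2 ⟨hne.map f, fun ε hε => ?_⟩
    obtain ⟨n, hn⟩ := exists_nat_one_div_lt hε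
    obtain ⟨b, hb⟩ := exists_nat_gt t
    obtain ⟨K, hK⟩ := hf.1 n b
    by_contra! hcon
    have key : ∀ K, ∃ c > t, c ≤ b ∧ HasOscillations f (1 / ((n : ℝ) + 1)) K c b := by
      intro K
      induction K with
      | zero => exact ⟨b, hb, le_rfl, trivial⟩
      | succ K ih =>
        obtain ⟨c, hc, hcb, hK⟩ := ih
        obtain ⟨x, hx, y, hy, hxy⟩ := hcon (f '' {q : ℚ≥0 | t < q ∧ (q : ℝ≥0) < c})
          (image_mem_map (hmem c hc))
        obtain ⟨q, hq, rfl⟩ := hx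
        obtain ⟨r, hr, rfl⟩ := hy
        have hlt := hn.trans_le hxy
        rcases lt_trichotomy q r with h | h | h
        · exact ⟨q, hq.1, hq.2.le.trans hcb, q, r, le_rfl, h, hr.2.le.trans hcb, hlt,
            hK.mono hr.2.le⟩
        · rw [h, dist_self] at hxy; linarith
        · exact ⟨r, hr.1, hr.2.le.trans hcb, r, q, le_rfl, h, hq.2.le.trans hcb,
            dist_comm (f q) (f r) ▸ hlt, hK.mono hq.2.le⟩
    obtain ⟨c, -, -, hc⟩ := key K
    exact hK (hc.mono zero_le)
  obtain ⟨l, hl⟩ := CompleteSpace.complete hcauchy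
  refine ⟨l, fun ε hε => ?_⟩
  obtain ⟨u, hu, h⟩ := hbasis _ (hl (Metric.closedBall_mem_nhds l hε))
  exact ⟨u, hu, fun q h1 h2 => h q h1 h2⟩

theorem exists_leftLimit (hf : f ∈ pathTraces) {t : ℝ≥0} (ht : 0 < t) :
    ∃ l, ∀ ε > 0, ∃ u < t, ∀ q : ℚ≥0, u < q → (q : ℝ≥0) < t → dist (f q) l ≤ ε := by
  set F := comap (fun q : ℚ≥0 => (q : ℝ≥0)) (𝓝[<] t) with hF
  have hmem : ∀ u < t, {q : ℚ≥0 | u < q ∧ (q : ℝ≥0) < t} ∈ F := fun u hu =>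
    ⟨Ioo u t, Ioo_mem_nhdsLT hu, fun q hq => hq⟩
  have hbasis : ∀ s ∈ F, ∃ u < t, ∀ q : ℚ≥0, u < q → (q : ℝ≥0) < t → q ∈ s := by
    rintro s ⟨v, hv, hvs⟩
    obtain ⟨u, hu, hsub⟩ := (mem_nhdsLT_iff_exists_Ioo_subset' ht).1 hv
    exact ⟨u, hu, fun q h1 h2 => hvs (hsub ⟨h1, h2⟩)⟩
  have hne : F.NeBot := by
    refine ⟨fun h => ?_⟩
    obtain ⟨u, hu, h'⟩ := hbasis ∅ (h ▸ mem_bot)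
    obtain ⟨q, hq, hqu⟩ := exists_nnrat_between hu
    exact h' q hq hqu
  have hcauchy : Cauchy (map f F) := by
    refine Metric.cauchy_iff.2 ⟨hne.map f, fun ε hε => ?_⟩
    obtain ⟨n, hn⟩ := exists_nat_one_div_lt hε
    obtain ⟨b, hb⟩ := exists_nat_gt t
    obtain ⟨K, hK⟩ := hf.1 n b
    by_contra! hcon
    -- From the left of `t` the pairs are stacked forwards: the later endpoint of a pair is still
    -- below `t` and serves as the new left endpoint.
    have key : ∀ K, ∀ a < t, HasOscillations f (1 / ((n : ℝ) + 1)) K a b := by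
      intro K
      induction K with
      | zero => exact fun _ _ => trivial
      | succ K ih =>
        intro a ha
        obtain ⟨x, hx, y, hy, hxy⟩ := hcon (f '' {q : ℚ≥0 | a < q ∧ (q : ℝ≥0) < t})
          (image_mem_map (hmem a ha))
        obtain ⟨q, hq, rfl⟩ := hx
        obtain ⟨r, hr, rfl⟩ := hy
        have hlt := hn.trans_le hxy
        rcases lt_trichotomy q r with h | h | h
        · exact ⟨q, r, hq.1.le, h, (hr.2.trans hb).le, hlt, ih _ hr.2⟩
        · rw [h, dist_self] at hxy; linarith
        · exact ⟨r, q, hr.1.le, h, (hq.2.trans hb).le, dist_comm (f q) (f r) ▸ hlt, ih _ hq.2⟩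
    exact hK (key K 0 ht)
  obtain ⟨l, hl⟩ := CompleteSpace.complete hcauchy
  refine ⟨l, fun ε hε => ?_⟩
  obtain ⟨u, hu, h⟩ := hbasis _ (hl (Metric.closedBall_mem_nhds l hε))
  exact ⟨u, hu, fun q h1 h2 => h q h1 h2⟩

theorem dist_rightLimit_le {t u : ℝ≥0} {l x : ℝ≥0} {ε : ℝ} (htu : t < u)
    (hl : ∀ ε > 0, ∃ u > t, ∀ q : ℚ≥0, t < q → (q : ℝ≥0) < u → dist (f q) l ≤ ε)
    (hx : ∀ q : ℚ≥0, t < q → (q : ℝ≥0) < u → dist (f q) x ≤ ε) : dist l x ≤ ε := by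
  refine le_of_forall_pos_le_add fun δ hδ => ?_
  obtain ⟨v, hv, h⟩ := hl δ hδ
  obtain ⟨q, hq1, hq2⟩ : ∃ q : ℚ≥0, t < q ∧ (q : ℝ≥0) < min u v :=
    exists_nnrat_between (lt_min htu hv)
  have h1 := h q hq1 (hq2.trans_le (min_le_right _ _))
  have h2 := hx q hq1 (hq2.trans_le (min_le_left _ _))
  linarith [dist_triangle_left l x (f q)]

/-- The path with the given values at rational times. -/
def pathOfTrace (f : ℚ≥0 → ℝ≥0) (hf : f ∈ pathTraces) : CadlagPath ℝ≥0 where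
  toFun := fun t => (exists_rightLimit hf t).choose
  rightCts := fun t => by
    refine Metric.tendsto_nhds.2 fun ε hε => ?_
    obtain ⟨u, hu, h⟩ := (exists_rightLimit hf t).choose_spec (ε / 2) (by positivity)
    filter_upwards [Ico_mem_nhdsGE hu] with s hs
    rcases eq_or_lt_of_le hs.1 with rfl | hts
    · simpa using hε
    · refine lt_of_le_of_lt (dist_rightLimit_le hs.2 (exists_rightLimit hf s).choose_spec
        fun q h1 h2 => h q (hts.trans h1) h2) (by linarith)
  leftLim := fun t => by
    rcases eq_or_ne t 0 with rfl | ht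
    · exact ⟨0, by simp⟩
    obtain ⟨l, hl⟩ := exists_leftLimit hf (pos_iff_ne_zero.2 ht)
    refine ⟨l, Metric.tendsto_nhds.2 fun ε hε => ?_⟩
    obtain ⟨u, hu, h⟩ := hl (ε / 2) (by positivity)
    filter_upwards [Ioo_mem_nhdsLT hu] with s hs
    exact lt_of_le_of_lt (dist_rightLimit_le hs.2 (exists_rightLimit hf s).choose_spec
        fun q h1 h2 => h q (hs.1.trans h1) h2) (by linarith)

theorem pathOfTrace_apply (hf : f ∈ pathTraces) (q : ℚ≥0) :
    pathOfTrace f hf (q : ℝ≥0) = f q := by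
  refine eq_of_forall_dist_le fun ε hε => ?_
  obtain ⟨n, hn⟩ := exists_nat_one_div_lt hε
  obtain ⟨m, hm⟩ := hf.2 q n
  refine (dist_rightLimit_le (u := (q : ℝ≥0) + 1 / ((m : ℝ≥0) + 1)) (lt_add_of_pos_right _
    (by positivity)) (exists_rightLimit hf q).choose_spec fun r h1 h2 =>
    hm r (NNRat.cast_lt.1 h1) (NNRat.cast_lt (K := ℝ≥0).1 (by simpa using h2))).trans hn.le

end Extension

/-- A measurable left inverse of the restriction to rational times. It turns a countable family of
densities, each fixed only up to null sets, into a path; families that are not traces are sent to a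
constant path. -/
theorem exists_measurable_path_of_trace : ∃ g : (ℚ≥0 → ℝ≥0) → CadlagPath ℝ≥0, Measurable g ∧
    ∀ y : CadlagPath ℝ≥0, g (fun q => y (q : ℝ≥0)) = y := by
  classical
  refine ⟨fun f => if hf : f ∈ pathTraces then pathOfTrace f hf else constPath 0, ?_, fun y => ?_⟩
  · refine measurable_path_iff_nnrat.2 fun q => ?_
    have : (fun f : ℚ≥0 → ℝ≥0 => (if hf : f ∈ pathTraces then pathOfTrace f hf
        else constPath 0 : CadlagPath ℝ≥0) (q : ℝ≥0)) = pathTraces.indicator fun f => f q := by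
      ext1 f
      by_cases hf : f ∈ pathTraces
      · simp [hf, pathOfTrace_apply]
      · simp [hf, constPath]
    rw [this]
    exact (measurable_pi_apply q).indicator measurableSet_pathTraces
  · simp only [dif_pos y.mem_pathTraces]
    exact CadlagPath.ext_nnrat fun q => pathOfTrace_apply _ q

/-! ### Measurability up to null sets and stopping times -/

section Completion

variable {Ω : Type*} {m : MeasurableSpace Ω} {μ : Measure Ω}

/-- The σ-algebra of the sets that agree `μ`-almost surely with a set in `m₀`. -/
abbrev nullExt (μ : Measure Ω) (m₀ : MeasurableSpace Ω) : MeasurableSpace Ω :=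
  eventuallyMeasurableSpace m₀ (ae μ)

theorem nullExt_mono {m₁ m₂ : MeasurableSpace Ω} (h : m₁ ≤ m₂) : nullExt μ m₁ ≤ nullExt μ m₂ :=
  fun _ ⟨t, ht, hst⟩ => ⟨t, h t ht, hst⟩

/-- The limit superior of representatives `C k` of `B` works: it depends only on the tail `k ≥ j`,
hence lies in `H j` for every `j`. -/
theorem measurableSet_nullExt_iInf {H : ℕ → MeasurableSpace Ω} (hH : Antitone H) {B : Set Ω}
    (hB : ∀ k, MeasurableSet[nullExt μ (H k)] B) : MeasurableSet[nullExt μ (⨅ k, H k)] B := by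
  choose C hC hBC using hB
  refine ⟨⋂ n, ⋃ k ≥ n, C k, ?_, ?_⟩
  · rw [MeasurableSpace.measurableSet_iInf]
    intro j
    have : (⋂ n, ⋃ k ≥ n, C k) = ⋂ n : {n // j ≤ n}, ⋃ k ≥ (n : ℕ), C k := by
      ext ω
      simp only [mem_iInter, mem_iUnion, Subtype.forall]
      refine ⟨fun h n _ => h n, fun h n => ?_⟩
      obtain ⟨k, hk, hω⟩ := h (max n j) (le_max_right _ _)
      exact ⟨k, (le_max_left _ _).trans hk, hω⟩
    rw [this]
    exact MeasurableSet.iInter fun n => MeasurableSet.iUnion fun k => MeasurableSet.iUnion fun hk =>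
      hH (n.2.trans hk) _ (hC k)
  · have : ∀ᵐ ω ∂μ, ∀ k, ω ∈ B ↔ ω ∈ C k := ae_all_iff.2 fun k => (hBC k).mem_iff
    refine eventuallyEq_set.2 ?_
    filter_upwards [this] with ω hω
    simp only [mem_iInter, mem_iUnion, ← hω]
    exact ⟨fun h n => ⟨n, le_rfl, h⟩, fun h => (h 0).choose_spec.2⟩

variable {F G : Filtration ℝ≥0 m}

/-- The time that is `τ` on `A` and infinite elsewhere. -/
def restrictTime (A : Set Ω) (τ : Ω → WithTop ℝ≥0) (ω : Ω) : WithTop ℝ≥0 :=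
  open Classical in if ω ∈ A then τ ω else ⊤

theorem setOf_restrictTime_le (A : Set Ω) (τ : Ω → WithTop ℝ≥0) (t : ℝ≥0) :
    {ω | restrictTime A τ ω ≤ t} = A ∩ {ω | τ ω ≤ t} := by
  ext ω
  by_cases h : ω ∈ A <;> simp [restrictTime, h]

theorem setOf_restrictTime_lt (A : Set Ω) (τ : Ω → WithTop ℝ≥0) (t : ℝ≥0) :
    {ω | restrictTime A τ ω < t} = A ∩ {ω | τ ω < t} := by
  ext ω
  by_cases h : ω ∈ A <;> simp [restrictTime, h]

/-- This encodes a set of the past of `τ` as a stopping time, so that facts about stopping times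
carry over to the σ-algebras of their pasts. -/
theorem isStoppingTime_restrictTime {τ : Ω → WithTop ℝ≥0} (hτ : IsStoppingTime F τ) {A : Set Ω}
    (hA : MeasurableSet[hτ.measurableSpace] A) : IsStoppingTime F (restrictTime A τ) := fun t => by
  rw [setOf_restrictTime_le]
  exact hA.2 t

theorem rightCont_le_of_lt {s t : ℝ≥0} (h : s < t) : G.rightCont s ≤ G t := by
  rw [Filtration.rightCont_eq]
  exact iInf₂_le t h

theorem measurableSet_lt_of_rightCont {τ : Ω → WithTop ℝ≥0}
    (hτ : IsStoppingTime G.rightCont τ) (t : ℝ≥0) : MeasurableSet[G t] {ω | τ ω < t} := by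
  have : {ω | τ ω < t} = ⋃ q : {q : ℚ≥0 // (q : ℝ≥0) < t}, {ω | τ ω ≤ ((q : ℚ≥0) : ℝ≥0)} := by
    ext ω
    simp only [mem_ofPred_eq, mem_iUnion, Subtype.exists, exists_prop]
    constructor
    · intro h
      lift τ ω to ℝ≥0 using h.ne_top with s
      obtain ⟨q, hq, hqt⟩ := exists_nnrat_between (WithTop.coe_lt_coe.1 h)
      exact ⟨q, hqt, WithTop.coe_le_coe.2 hq.le⟩
    · rintro ⟨q, hq, h⟩
      exact h.trans_lt (WithTop.coe_lt_coe.2 hq)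
  rw [this]
  exact MeasurableSet.iUnion fun q => rightCont_le_of_lt q.2 _ (hτ _)

/-- A time is the infimum of the rationals `q` with `τ < q`. Replacing each of these countably many
events by a representative in `F q` changes the infimum only on a null set, and right continuity
allows the stopping property to be checked on strict inequalities. -/
theorem exists_isStoppingTime_ae_eq [F.IsRightContinuous] {τ : Ω → WithTop ℝ≥0}
    (hτ : ∀ t : ℝ≥0, MeasurableSet[nullExt μ (F t)] {ω | τ ω < t}) :
    ∃ τ', IsStoppingTime F τ' ∧ τ' =ᵐ[μ] τ := by
  choose B hB hτB using fun q : ℚ≥0 => hτ (q : ℝ≥0)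
  refine ⟨fun ω => ⨅ (q : ℚ≥0) (_ : ω ∈ B q), ((q : ℝ≥0) : WithTop ℝ≥0),
    isStoppingTime_of_measurableSet_lt_of_isRightContinuous fun t => ?_, ?_⟩
  · have : {ω | ⨅ (q : ℚ≥0) (_ : ω ∈ B q), ((q : ℝ≥0) : WithTop ℝ≥0) < t} =
        ⋃ q : {q : ℚ≥0 // (q : ℝ≥0) < t}, B q := by
      ext ω
      simp only [mem_ofPred_eq, iInf_lt_iff, mem_iUnion, Subtype.exists, exists_prop,
        WithTop.coe_lt_coe]
      exact exists_congr fun q => and_comm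
    rw [this]
    exact MeasurableSet.iUnion fun q => F.mono q.2.le _ (hB q)
  · have : ∀ᵐ ω ∂μ, ∀ q : ℚ≥0, τ ω < (q : ℝ≥0) ↔ ω ∈ B q :=
      ae_all_iff.2 fun q => (hτB q).mem_iff
    filter_upwards [this] with ω hω
    refine le_antisymm (le_of_forall_gt fun s hs => ?_) (le_iInf₂ fun q hq => ((hω q).2 hq).le)
    simp only [iInf_lt_iff, ← hω, exists_prop]
    lift τ ω to ℝ≥0 using hs.ne_top with a
    rcases eq_or_ne s ⊤ with rfl | hs'
    · obtain ⟨q, hq, -⟩ := exists_nnrat_between (lt_add_one a)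
      exact ⟨q, WithTop.coe_lt_coe.2 hq, WithTop.coe_lt_top _⟩
    · lift s to ℝ≥0 using hs'
      obtain ⟨q, hq, hqs⟩ := exists_nnrat_between (WithTop.coe_lt_coe.1 hs)
      exact ⟨q, WithTop.coe_lt_coe.2 hq, WithTop.coe_lt_coe.2 hqs⟩

/-- The discretisation of a random time from the right. -/
def discreteTime (k : ℕ) (τ : Ω → WithTop ℝ≥0) (ω : Ω) : WithTop ℝ≥0 := (τ ω).map (gridAbove k)

theorem isStoppingTime_discreteTime {τ : Ω → WithTop ℝ≥0} (hτ : IsStoppingTime G.rightCont τ)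
    (k : ℕ) : IsStoppingTime G (discreteTime k τ) := fun t => by
  have : {ω | discreteTime k τ ω ≤ t} =
      {ω | τ ω < ((⌊t * (k + 1)⌋₊ / ((k : ℝ≥0) + 1) : ℝ≥0) : WithTop ℝ≥0)} := by
    ext ω
    simp only [mem_ofPred_eq, discreteTime]
    cases τ ω with
    | top => simp
    | coe s => rw [WithTop.map_coe, WithTop.coe_le_coe, WithTop.coe_lt_coe, gridAbove_le_iff_lt]
  rw [this]
  refine G.mono ?_ _ (measurableSet_lt_of_rightCont hτ _)
  rw [div_le_iff₀ (by positivity)]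
  exact Nat.floor_le (by positivity)

theorem measurableSet_discreteTime {τ : Ω → WithTop ℝ≥0} (hτ : IsStoppingTime G.rightCont τ)
    (k : ℕ) {A : Set Ω} (hA : MeasurableSet[hτ.measurableSpace] A) :
    MeasurableSet[(isStoppingTime_discreteTime hτ k).measurableSpace] A := by
  refine ⟨?_, fun t => ?_⟩
  · refine (iSup_le fun t => ?_ : (⨆ t, G.rightCont t) ≤ ⨆ t, G t) A hA.1
    exact (rightCont_le_of_lt (lt_add_one t)).trans (le_iSup (fun t => G t) (t + 1))
  · have h := isStoppingTime_discreteTime (isStoppingTime_restrictTime hτ hA) k t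
    have : {ω | discreteTime k (restrictTime A τ) ω ≤ t} = A ∩ {ω | discreteTime k τ ω ≤ t} := by
      ext ω
      by_cases h : ω ∈ A <;> simp [restrictTime, discreteTime, h]
    rwa [this] at h

theorem countable_range_discreteTime (k : ℕ) (τ : Ω → WithTop ℝ≥0) :
    (range (discreteTime k τ)).Countable := by
  refine (((countable_range_gridAbove k).image (WithTop.some)).union
    (countable_singleton ⊤)).mono ?_
  rintro _ ⟨ω, rfl⟩
  rw [discreteTime]
  cases τ ω with
  | top => right; simp
  | coe s => left; exact ⟨_, ⟨s, rfl⟩, rfl⟩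

theorem isStoppingTime_map_add {τ : Ω → WithTop ℝ≥0} (hτ : IsStoppingTime F τ) (a : ℝ≥0) :
    IsStoppingTime F fun ω => τ ω + a := fun t => by
  rcases le_or_gt a t with h | h
  · have : {ω | τ ω + a ≤ t} = {ω | τ ω ≤ ((t - a : ℝ≥0) : WithTop ℝ≥0)} := by
      ext ω
      simp only [mem_ofPred_eq]
      cases τ ω with
      | top => simp
      | coe s => rw [← WithTop.coe_add, WithTop.coe_le_coe, WithTop.coe_le_coe, le_tsub_iff_right h]
    rw [this]
    exact F.mono tsub_le_self _ (hτ _)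
  · have : {ω | τ ω + a ≤ t} = ∅ := by
      ext ω
      simp only [mem_ofPred_eq, mem_empty_iff_false, iff_false, not_le]
      cases τ ω with
      | top => simp
      | coe s =>
        rw [← WithTop.coe_add, WithTop.coe_lt_coe]
        exact h.trans_le le_add_self
    rw [this]
    exact @MeasurableSet.empty _ (F t)

/-- Right continuity at a random time. For `B` in the past of every `τ + 1 / (j + 1)`, the set `B ∩
{τ < t}` is the union of the sets `B ∩ {τ + 1 / (j + 1) ≤ t}`, so `τ` restricted to `B` is a
stopping time. -/
theorem iInf_measurableSpace_add_le [F.IsRightContinuous] {τ : Ω → WithTop ℝ≥0}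
    (hτ : IsStoppingTime F τ) :
    (⨅ j : ℕ, (isStoppingTime_map_add hτ (1 / ((j : ℝ≥0) + 1))).measurableSpace) ≤
      hτ.measurableSpace := by
  intro B hB
  rw [MeasurableSpace.measurableSet_iInf] at hB
  have h : IsStoppingTime F (restrictTime B τ) := by
    refine isStoppingTime_of_measurableSet_lt_of_isRightContinuous fun t => ?_
    have : {ω | restrictTime B τ ω < t} =
        ⋃ j : ℕ, B ∩ {ω | τ ω + ((1 / ((j : ℝ≥0) + 1) : ℝ≥0) : WithTop ℝ≥0) ≤ t} := by
      rw [setOf_restrictTime_lt, ← inter_iUnion]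
      congr 1
      ext ω
      simp only [mem_ofPred_eq, mem_iUnion]
      cases τ ω with
      | top => simp
      | coe s =>
        simp only [← WithTop.coe_add, WithTop.coe_le_coe, WithTop.coe_lt_coe]
        constructor
        · intro hs
          have h : Tendsto (fun k : ℕ => s + (1 : ℝ≥0) / ((k : ℝ≥0) + 1)) atTop (𝓝 (s + 0)) :=
            tendsto_one_div_add_atTop_nhds_zero_nat.const_add _
          rw [add_zero] at h
          obtain ⟨j, hj⟩ := (h.eventually (gt_mem_nhds hs)).exists
          exact ⟨j, hj.le⟩
        · rintro ⟨j, hj⟩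
          exact lt_of_lt_of_le (lt_add_of_pos_right _ (by positivity)) hj
    rw [this]
    exact MeasurableSet.iUnion fun j => (hB j).2 t
  refine ⟨(hB 0).1, fun t => ?_⟩
  rw [← setOf_restrictTime_le]
  exact h t

theorem measurable_nullExt_discreteTime {β : Type*} [MeasurableSpace β] {Y : ℝ≥0 → Ω → β}
    (hY : ∀ t, Measurable[nullExt μ (F t)] (Y t)) {σ : Ω → WithTop ℝ≥0}
    (hσ : IsStoppingTime F σ) (hc : (range σ).Countable) (t : ℝ≥0) :
    Measurable[nullExt μ hσ.measurableSpace]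
      fun ω => Y ((min (t : WithTop ℝ≥0) (σ ω)).untopD 0) ω := by
  intro C hC
  have : (fun ω => Y ((min (t : WithTop ℝ≥0) (σ ω)).untopD 0) ω) ⁻¹' C =
      ⋃ r ∈ range σ, Y ((min (t : WithTop ℝ≥0) r).untopD 0) ⁻¹' C ∩ {ω | σ ω = r} := by
    ext ω
    simp only [mem_preimage, mem_iUnion, mem_inter_iff, mem_ofPred_eq, exists_prop]
    exact ⟨fun h => ⟨_, mem_range_self ω, h, rfl⟩, fun ⟨r, _, h, hr⟩ => hr ▸ h⟩
  rw [this]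
  refine MeasurableSet.biUnion hc fun r _ => ?_
  cases r with
  | top =>
    obtain ⟨B, hB, hYB⟩ := hY ((min (t : WithTop ℝ≥0) ⊤).untopD 0) hC
    refine ⟨B ∩ {ω | σ ω = ⊤}, ⟨?_, fun i => ?_⟩, hYB.inter .rfl⟩
    · refine MeasurableSet.inter (le_iSup (fun t => F t) _ _ hB) ?_
      exact hσ.measurableSpace_le' _ (hσ.measurable (measurableSet_singleton ⊤))
    · have : B ∩ {ω | σ ω = ⊤} ∩ {ω | σ ω ≤ i} = ∅ := by
        ext ω
        simp only [mem_inter_iff, mem_ofPred_eq, mem_empty_iff_false, iff_false, not_and, not_le]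
        rintro ⟨-, h⟩
        rw [h]
        exact WithTop.coe_lt_top i
      rw [this]
      exact @MeasurableSet.empty _ (F i)
  | coe r =>
    rw [← WithTop.coe_min, WithTop.untopD_coe]
    obtain ⟨B, hB, hYB⟩ := hY (min t r) hC
    refine ⟨B ∩ {ω | σ ω = r}, ?_, hYB.inter .rfl⟩
    rw [hσ.measurableSet_inter_eq_iff]
    exact (F.mono (min_le_right t r) _ hB).inter (hσ.measurableSet_eq r)

/-- A right-continuous process adapted up to null sets, evaluated at `t ∧ τ`, is measurable up to
null sets with respect to the past of `τ`. -/
theorem measurable_nullExt_stopped [F.IsRightContinuous] {β : Type*} [TopologicalSpace β]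
    [TopologicalSpace.PseudoMetrizableSpace β] [MeasurableSpace β] [BorelSpace β]
    {Y : ℝ≥0 → Ω → β} (hY : ∀ t, Measurable[nullExt μ (F t)] (Y t))
    (hYc : ∀ ω t, ContinuousWithinAt (fun s => Y s ω) (Ici t) t) {τ : Ω → WithTop ℝ≥0}
    (hτ : IsStoppingTime F τ) (t : ℝ≥0) :
    Measurable[nullExt μ hτ.measurableSpace]
      fun ω => Y ((min (t : WithTop ℝ≥0) (τ ω)).untopD 0) ω := by
  have hτ' : IsStoppingTime F.rightCont τ := by rwa [Filtration.IsRightContinuous.eq]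
  -- Discretised times exceed `τ`, so their pasts are too large. Grids from index `j` on stay below
  -- `τ + 1 / (j + 1)`; hence the limit is measurable for every `H j`, and these σ-algebras decrease
  -- into the past of `τ`.
  set H : ℕ → MeasurableSpace Ω := fun j =>
    (isStoppingTime_map_add hτ (1 / ((j : ℝ≥0) + 1))).measurableSpace with hH
  have hanti : Antitone H := fun i j hij => IsStoppingTime.measurableSpace_mono _ _ fun ω => by
    refine add_le_add_right (WithTop.coe_le_coe.2 ?_) (τ ω)
    have : (i : ℝ≥0) ≤ j := by exact_mod_cast hij
    gcongr
  have hstep : ∀ j k, Measurable[nullExt μ (H j)] fun ω =>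
      Y ((min (t : WithTop ℝ≥0) (discreteTime (k + j) τ ω)).untopD 0) ω := by
    intro j k
    refine (measurable_nullExt_discreteTime hY (isStoppingTime_discreteTime hτ' (k + j))
      (countable_range_discreteTime _ _) t).mono (nullExt_mono
      (IsStoppingTime.measurableSpace_mono _ _ fun ω => ?_)) le_rfl
    simp only [discreteTime]
    cases τ ω with
    | top => simp
    | coe s =>
      rw [WithTop.map_coe, ← WithTop.coe_add, WithTop.coe_le_coe]
      refine (gridAbove_le _ _).trans ?_
      have : (j : ℝ≥0) ≤ ((k + j : ℕ) : ℝ≥0) := by exact_mod_cast le_add_self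
      gcongr
  have hlim : ∀ j, Measurable[nullExt μ (H j)]
      fun ω => Y ((min (t : WithTop ℝ≥0) (τ ω)).untopD 0) ω := by
    intro j
    refine @measurable_of_tendsto_metrizable _ _ (nullExt μ (H j)) _ _ _ _ _ _ (hstep j) ?_
    refine tendsto_pi_nhds.2 fun ω => ?_
    simp only [discreteTime]
    cases τ ω with
    | top => simpa using tendsto_const_nhds
    | coe s =>
      simp only [WithTop.map_coe, ← WithTop.coe_min, WithTop.untopD_coe]
      refine (hYc ω (min t s)).tendsto.comp ?_
      have h := (tendsto_gridAbove s).comp (tendsto_add_atTop_nat j)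
      rw [tendsto_nhdsWithin_iff] at h ⊢
      exact ⟨(continuous_const.min continuous_id).continuousAt.tendsto.comp h.1,
        h.2.mono fun k hk => min_le_min_left t hk⟩
  intro C hC
  exact nullExt_mono (iInf_measurableSpace_add_le hτ) _
    (measurableSet_nullExt_iInf hanti fun j => hlim j hC)

end Completion

/-! ### Optional sampling for right-continuous martingales -/

section OptionalSampling

variable {Ω : Type*} {m : MeasurableSpace Ω} {μ : Measure Ω} [IsFiniteMeasure μ]
  {G : Filtration ℝ≥0 m}

/-- At the discretised times, which take countably many values, the process is a conditional
expectation of `N T`. Such a family is uniformly integrable, so right continuity upgrades almost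
sure convergence to convergence in `L¹`. The right-continuous version `Y` is kept apart from `N`
because a density process equals the conditional expectations only almost surely at each time. -/
theorem optional_sampling {N Y : ℝ≥0 → Ω → ℝ} (hN : Martingale N G μ)
    (hYc : ∀ ω t, ContinuousWithinAt (fun s => Y s ω) (Ici t) t) (hYN : ∀ t, Y t =ᵐ[μ] N t)
    {ρ : Ω → WithTop ℝ≥0} (hρ : IsStoppingTime G.rightCont ρ) {t T : ℝ≥0}
    (hρt : ∀ ω, ρ ω ≤ t) (htT : t < T) :
    Integrable (fun ω => Y ((ρ ω).untopD 0) ω) μ ∧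
      ∀ A, MeasurableSet[hρ.measurableSpace] A →
        ∫ ω in A, Y ((ρ ω).untopD 0) ω ∂μ = ∫ ω in A, N T ω ∂μ := by
  -- The grid overshoots `ρ`; discarding the first `K` grids keeps the discretised times below `T`,
  -- which is the purpose of the gap `t < T`.
  obtain ⟨K, hK⟩ : ∃ K : ℕ, t + 1 / ((K : ℝ≥0) + 1) < T := by
    have h : Tendsto (fun k : ℕ => t + (1 : ℝ≥0) / ((k : ℝ≥0) + 1)) atTop (𝓝 (t + 0)) :=
      tendsto_one_div_add_atTop_nhds_zero_nat.const_add _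
    rw [add_zero] at h
    exact (h.eventually (gt_mem_nhds htT)).exists
  have hst : ∀ k, IsStoppingTime G (discreteTime (k + K) ρ) := fun k =>
    isStoppingTime_discreteTime hρ (k + K)
  have hle : ∀ k ω, discreteTime (k + K) ρ ω ≤ T := by
    intro k ω
    have h := hρt ω
    simp only [discreteTime]
    lift ρ ω to ℝ≥0 using (h.trans_lt (WithTop.coe_lt_top t)).ne with s
    rw [WithTop.map_coe, WithTop.coe_le_coe]
    rw [WithTop.coe_le_coe] at h
    refine (gridAbove_le _ _).trans (le_trans ?_ hK.le)
    have : (K : ℝ≥0) ≤ ((k + K : ℕ) : ℝ≥0) := by exact_mod_cast le_add_self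
    gcongr
  set f : ℕ → Ω → ℝ := fun k => μ[N T | (hst k).measurableSpace] with hf
  have hfY : ∀ k, (fun ω => Y (((discreteTime (k + K) ρ) ω).untopD 0) ω) =ᵐ[μ] f k := by
    intro k
    have h1 := hN.stoppedValue_ae_eq_condExp_of_le_const_of_countable_range (hst k) (hle k)
      (countable_range_discreteTime _ _)
    have h2 : ∀ᵐ ω ∂μ, ∀ r ∈ range (discreteTime (k + K) ρ),
        Y (r.untopD 0) ω = N (r.untopD 0) ω :=
      (ae_ball_iff (countable_range_discreteTime (k + K) ρ)).2 fun r _ => hYN _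
    filter_upwards [h1, h2] with ω hω1 hω2
    rw [hω2 _ (mem_range_self ω)]
    refine Eq.trans ?_ hω1
    rw [stoppedValue]
    have h := hle k ω
    lift discreteTime (k + K) ρ ω to ℝ≥0 using (h.trans_lt (WithTop.coe_lt_top T)).ne with s
    simp
  have hlim : ∀ ω, Tendsto (fun k => Y (((discreteTime (k + K) ρ) ω).untopD 0) ω) atTop
      (𝓝 (Y ((ρ ω).untopD 0) ω)) := by
    intro ω
    have h := hρt ω
    simp only [discreteTime]
    lift ρ ω to ℝ≥0 using (h.trans_lt (WithTop.coe_lt_top t)).ne with s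
    simp only [WithTop.map_coe, WithTop.untopD_coe]
    exact (hYc ω s).tendsto.comp ((tendsto_gridAbove s).comp (tendsto_add_atTop_nat K))
  have hlim' : ∀ᵐ ω ∂μ, Tendsto (fun k => f k ω) atTop (𝓝 (Y ((ρ ω).untopD 0) ω)) := by
    filter_upwards [ae_all_iff.2 hfY] with ω hω
    simpa only [hω] using hlim ω
  have hfm : ∀ k, AEStronglyMeasurable (f k) μ := fun k => integrable_condExp.aestronglyMeasurable
  have hgm : AEStronglyMeasurable (fun ω => Y ((ρ ω).untopD 0) ω) μ :=
    aestronglyMeasurable_of_tendsto_ae atTop hfm hlim'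
  have hui : UniformIntegrable f 1 μ := (hN.integrable T).uniformIntegrable_condExp
    fun k => (hst k).measurableSpace_le
  have hg : MemLp (fun ω => Y ((ρ ω).untopD 0) ω) 1 μ := by
    obtain ⟨C, hC⟩ := hui.2.2
    refine ⟨hgm, lt_of_le_of_lt (Lp.eLpNorm_lim_le_liminf_eLpNorm (f := f) hfm _ hlim')
      (lt_of_le_of_lt ?_ (ENNReal.coe_lt_top (r := C)))⟩
    exact (liminf_le_liminf (Eventually.of_forall hC)).trans (by simp)
  have hL1 := tendsto_Lp_finite_of_tendsto_ae le_rfl ENNReal.one_ne_top hfm hg hui.2.1 hlim'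
  refine ⟨memLp_one_iff_integrable.1 hg, fun A hA => ?_⟩
  have h1 := tendsto_setIntegral_of_L1' _ hgm
    (Eventually.of_forall fun k => integrable_condExp) hL1 A
  have h2 : ∀ k, ∫ ω in A, f k ω ∂μ = ∫ ω in A, N T ω ∂μ := fun k =>
    setIntegral_condExp (hst k).measurableSpace_le (hN.integrable T)
      (measurableSet_discreteTime hρ (k + K) hA)
  exact tendsto_nhds_unique h1 (tendsto_const_nhds.congr fun k => (h2 k).symm)

variable {N : ℝ≥0 → Ω → ℝ} (hN : Martingale N G μ)
  (hNc : ∀ ω t, ContinuousWithinAt (fun s => N s ω) (Ici t) t)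
  {τ : Ω → WithTop ℝ≥0} (hτ : IsStoppingTime G.rightCont τ)

include hN hNc hτ

theorem integrable_stopped (t : ℝ≥0) :
    Integrable (fun ω => N ((min (t : WithTop ℝ≥0) (τ ω)).untopD 0) ω) μ :=
  (optional_sampling hN hNc (fun _ => .rfl) ((isStoppingTime_const _ t).min hτ)
    (fun _ => min_le_left _ _) (lt_add_one t)).1

/-- The set `A ∩ {s < τ}` lies in the pasts of both `t ∧ τ` and the constant time `s`, so optional
sampling computes both integrals from the same later value of `N`. -/
theorem setIntegral_stopped_inter {s t : ℝ≥0} (hst : s ≤ t) {A : Set Ω}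
    (hA : MeasurableSet[G s] A) :
    ∫ ω in A ∩ {ω | s < τ ω}, N ((min (t : WithTop ℝ≥0) (τ ω)).untopD 0) ω ∂μ =
      ∫ ω in A ∩ {ω | s < τ ω}, N s ω ∂μ := by
  have hB : MeasurableSet[G.rightCont s] (A ∩ {ω | s < τ ω}) :=
    (G.le_rightCont s _ hA).inter (hτ.measurableSet_gt s)
  have hτt := (isStoppingTime_const G.rightCont t).min hτ
  have h1 := (optional_sampling hN hNc (fun _ => .rfl) hτt (fun _ => min_le_left _ _)
    (lt_add_one t)).2 (A ∩ {ω | s < τ ω}) ?_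
  · have h2 := (optional_sampling hN hNc (fun _ => .rfl) (isStoppingTime_const G.rightCont s)
      (fun _ => le_rfl) (hst.trans_lt (lt_add_one t))).2 (A ∩ {ω | s < τ ω}) (by
        rwa [IsStoppingTime.measurableSpace_const])
    exact h1.trans h2.symm
  · refine ⟨le_iSup (fun t => G.rightCont t) s _ hB, fun i => ?_⟩
    rcases le_or_gt s i with h | h
    · exact (G.rightCont.mono h _ hB).inter (hτt i)
    · have : A ∩ {ω | s < τ ω} ∩ {ω | min (t : WithTop ℝ≥0) (τ ω) ≤ i} = ∅ := by
        ext ω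
        simp only [mem_inter_iff, mem_ofPred_eq, mem_empty_iff_false, iff_false, not_and, not_le,
          lt_min_iff, WithTop.coe_lt_coe]
        exact fun h' => ⟨h.trans_le hst, (WithTop.coe_lt_coe.2 h).trans h'.2⟩
      rw [this]
      exact @MeasurableSet.empty _ (G.rightCont i)

/-- On `{τ ≤ s}` the two stopped values coincide, and the rest is the preceding lemma. Stopping at a
time of the right-continuous hull thus preserves the martingale identity over sets of the smaller
filtration. -/
theorem setIntegral_stopped {s t : ℝ≥0} (hst : s ≤ t) {A : Set Ω} (hA : MeasurableSet[G s] A) :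
    ∫ ω in A, N ((min (t : WithTop ℝ≥0) (τ ω)).untopD 0) ω ∂μ =
      ∫ ω in A, N ((min (s : WithTop ℝ≥0) (τ ω)).untopD 0) ω ∂μ := by
  have hm : MeasurableSet {ω | (s : WithTop ℝ≥0) < τ ω} :=
    G.rightCont.le s _ (hτ.measurableSet_gt s)
  have hA' : MeasurableSet A := G.le s _ hA
  rw [← integral_inter_add_sdiff hm (integrable_stopped hN hNc hτ t).integrableOn,
    ← integral_inter_add_sdiff hm (integrable_stopped hN hNc hτ s).integrableOn,
    setIntegral_stopped_inter hN hNc hτ hst hA]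
  congr 1
  · refine setIntegral_congr_fun (hA'.inter hm) fun ω hω => ?_
    have : (s : WithTop ℝ≥0) < τ ω := hω.2
    simp [min_eq_left this.le]
  · refine setIntegral_congr_fun (hA'.diff hm) fun ω hω => ?_
    have : τ ω ≤ s := not_lt.1 hω.2
    simp only [min_eq_right this, min_eq_right (this.trans (WithTop.coe_le_coe.2 hst))]

end OptionalSampling

section Markov

variable {E : Type*} [TopologicalSpace E] [MeasurableSpace E]

instance : (pathFiltration E).IsRightContinuous := by
  unfold pathFiltration
  infer_instance

theorem rawFiltration_le_pathFiltration (t : ℝ≥0) : rawFiltration E t ≤ pathFiltration E t :=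
  (rawFiltration E).le_rightCont t

/-! ### The strong Markov property -/

theorem setOf_ne_top_eq_iUnion {Ω : Type*} (τ : Ω → WithTop ℝ≥0) :
    {ω | τ ω ≠ ⊤} = ⋃ n : ℕ, {ω | τ ω ≤ ((n : ℝ≥0) : WithTop ℝ≥0)} := by
  ext ω
  simp only [mem_ofPred_eq, mem_iUnion]
  constructor
  · intro h
    lift τ ω to ℝ≥0 using h with s
    obtain ⟨n, hn⟩ := exists_nat_ge s
    exact ⟨n, WithTop.coe_le_coe.2 hn⟩
  · rintro ⟨n, hn⟩
    exact (hn.trans_lt (WithTop.coe_lt_top _)).ne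

theorem directed_setOf_le {Ω : Type*} (τ : Ω → WithTop ℝ≥0) (A : Set Ω) :
    Directed (· ⊆ ·) fun n : ℕ => A ∩ {ω | τ ω ≤ ((n : ℝ≥0) : WithTop ℝ≥0)} :=
  Monotone.directed_le fun _ _ hnk => inter_subset_inter_right A fun _ hω =>
    le_trans (mem_ofPred_eq ▸ hω) (WithTop.coe_le_coe.2 (Nat.cast_le.2 hnk))

theorem setLIntegral_inter_ne_top {Ω : Type*} {m : MeasurableSpace Ω} (μ : Measure Ω)
    (f : Ω → ℝ≥0∞) (τ : Ω → WithTop ℝ≥0) (A : Set Ω) :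
    ∫⁻ ω in A ∩ {ω | τ ω ≠ ⊤}, f ω ∂μ =
      ⨆ n : ℕ, ∫⁻ ω in A ∩ {ω | τ ω ≤ ((n : ℝ≥0) : WithTop ℝ≥0)}, f ω ∂μ := by
  rw [setOf_ne_top_eq_iUnion, inter_iUnion,
    setLIntegral_iUnion_of_directed _ (directed_setOf_le τ A)]

theorem measurableSet_inter_le_min {Ω : Type*} {m : MeasurableSpace Ω} {F : Filtration ℝ≥0 m}
    {τ : Ω → WithTop ℝ≥0} (hτ : IsStoppingTime F τ) {C : Set Ω}
    (hC : MeasurableSet[hτ.measurableSpace] C) (n : ℝ≥0) :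
    MeasurableSet[((isStoppingTime_const F n).min hτ).measurableSpace] (C ∩ {ω | τ ω ≤ n}) := by
  refine ⟨le_iSup (fun t => F t) n _ (hC.2 n), fun i => ?_⟩
  have h : C ∩ {ω | τ ω ≤ n} ∩ {ω | min (n : WithTop ℝ≥0) (τ ω) ≤ i} =
      (C ∩ {ω | τ ω ≤ (min n i : ℝ≥0)}) := by
    ext ω
    simp only [mem_inter_iff, mem_ofPred_eq, min_le_iff, WithTop.coe_min, le_min_iff, and_assoc]
    refine and_congr_right fun _ => and_congr_right fun h => ?_
    exact ⟨fun h' => h'.elim (fun h'' => h.trans h'') id, Or.inr⟩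
  rw [h]
  exact F.mono (min_le_right n i) _ (hC.2 _)

variable [TopologicalSpace.PseudoMetrizableSpace E] [BorelSpace E]
  {P : Kernel E (CadlagPath E)} [IsMarkovKernel P] (hP : IsCanonicalStrongMarkov P)
  {τ : CadlagPath E → WithTop ℝ≥0} (hτ : IsStoppingTime (pathFiltration E) τ)

include hP

/-- The strong Markov hypothesis covers bounded times only. It is applied to `τ ∧ n` on `C ∩ {τ ≤
n}`, a set in the past of `τ ∧ n` on which both times agree, and `n` tends to infinity by monotone
convergence. -/
theorem measure_inter_shift_preimage (x : E) {C B : Set (CadlagPath E)}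
    (hC : MeasurableSet[hτ.measurableSpace] C) (hB : MeasurableSet B) :
    ∫⁻ ω in C ∩ {ω | τ ω ≠ ⊤}, B.indicator 1 (shift ((τ ω).untopD 0) ω) ∂P x =
      ∫⁻ ω in C ∩ {ω | τ ω ≠ ⊤}, P (evalAt (τ ω) ω) B ∂P x := by
  rw [setLIntegral_inter_ne_top, setLIntegral_inter_ne_top]
  congr 1
  ext n
  have hσ := (isStoppingTime_const (pathFiltration E) (n : ℝ≥0)).min hτ
  have hCn := measurableSet_inter_le_min hτ hC n
  have hmτ : Measurable τ := hτ.measurable'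
  have hCm : MeasurableSet (C ∩ {ω | τ ω ≤ ((n : ℝ≥0) : WithTop ℝ≥0)}) :=
    hσ.measurableSpace_le _ hCn
  have hmσ : Measurable fun ω => min ((n : ℝ≥0) : WithTop ℝ≥0) (τ ω) := hσ.measurable'
  have hsh : Measurable fun ω : CadlagPath E => shift ((τ ω).untopD 0) ω :=
    measurable_id.shift (hmτ.untopD 0)
  have hshσ : Measurable fun ω : CadlagPath E =>
      shift ((min ((n : ℝ≥0) : WithTop ℝ≥0) (τ ω)).untopD 0) ω :=
    measurable_id.shift (hmσ.untopD 0)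
  have hYm : Measurable (B.indicator (1 : CadlagPath E → ℝ)) := measurable_one.indicator hB
  have hYb : ∀ ω, |B.indicator (1 : CadlagPath E → ℝ) ω| ≤ 1 := fun ω => by
    by_cases h : ω ∈ B <;> simp [h]
  have hM := hP.strongMarkov (fun ω => min ((n : ℝ≥0) : WithTop ℝ≥0) (τ ω)) hσ
    ⟨n, fun ω => min_le_left _ _⟩ (B.indicator 1) hYm ⟨1, hYb⟩ x
  have hint : Integrable (fun ω => B.indicator (1 : CadlagPath E → ℝ)
      (shift ((min ((n : ℝ≥0) : WithTop ℝ≥0) (τ ω)).untopD 0) ω)) (P x) :=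
    Integrable.of_bound (hYm.comp hshσ).aestronglyMeasurable 1
      (Eventually.of_forall fun ω => hYb _)
  have h1 := setIntegral_condExp hσ.measurableSpace_le hint hCn
  rw [setIntegral_congr_ae hCm (hM.mono fun ω h _ => h)] at h1
  have h2 : ∀ p, ∫ ω', B.indicator (1 : CadlagPath E → ℝ) ω' ∂P p = (P p).real B := fun p => by
    rw [integral_indicator_one hB]
  simp only [h2] at h1
  have hint2 : Integrable (fun ω => (P (evalAt (min ((n : ℝ≥0) : WithTop ℝ≥0) (τ ω)) ω)).real B)
      (P x) := by
    refine Integrable.of_bound ?_ 1 (Eventually.of_forall fun ω => ?_)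
    · exact ((P.measurable_coe hB).comp (measurable_id.evalAt hmσ)).ennreal_toReal
        |>.aestronglyMeasurable
    · rw [Real.norm_of_nonneg measureReal_nonneg]
      exact measureReal_le_one
  have h3 := congrArg ENNReal.ofReal h1
  rw [ofReal_integral_eq_lintegral_ofReal hint2.integrableOn
      (Eventually.of_forall fun ω => measureReal_nonneg),
    ofReal_integral_eq_lintegral_ofReal hint.integrableOn
      (Eventually.of_forall fun ω => indicator_nonneg (by simp) _)] at h3
  rw [setLIntegral_congr_fun (g := fun ω => ENNReal.ofReal (B.indicator (1 : CadlagPath E → ℝ)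
      (shift ((min ((n : ℝ≥0) : WithTop ℝ≥0) (τ ω)).untopD 0) ω))) hCm, ← h3]
  · refine setLIntegral_congr_fun hCm fun ω hω => ?_
    have : τ ω ≤ ((n : ℝ≥0) : WithTop ℝ≥0) := hω.2
    simp only [min_eq_right this]
    exact ofReal_measureReal (measure_ne_top _ _)
  · intro ω hω
    have : τ ω ≤ ((n : ℝ≥0) : WithTop ℝ≥0) := hω.2
    simp only [min_eq_right this]
    by_cases h : shift ((τ ω).untopD 0) ω ∈ B <;> simp [h]

omit hP in
theorem nullMeasurable_of_nullExt {Ω A : Type*} {m₀ m : MeasurableSpace Ω} [MeasurableSpace A]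
    {μ : Measure Ω} (h : m₀ ≤ m) {U : Ω → A} (hU : Measurable[nullExt μ m₀] U) :
    NullMeasurable U μ := fun _ hS =>
  let ⟨t, ht, hst⟩ := hU hS
  ⟨t, h t ht, hst⟩

/-- The strong Markov property: conditionally on the past of `τ`, the path after `τ` has law
`P^{X_τ}`. -/
theorem lintegral_strongMarkov (x : E) {A : Type*} [MeasurableSpace A]
    [MeasurableSpace.CountablyGenerated A] {U : CadlagPath E → A}
    (hU : Measurable[nullExt (P x) hτ.measurableSpace] U) {Ψ : A × CadlagPath E → ℝ≥0∞}
    (hΨ : Measurable Ψ) :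
    ∫⁻ ω in {ω | τ ω ≠ ⊤}, Ψ (U ω, shift ((τ ω).untopD 0) ω) ∂P x =
      ∫⁻ ω in {ω | τ ω ≠ ⊤}, ∫⁻ ω', Ψ (U ω, ω') ∂P (evalAt (τ ω) ω) ∂P x := by
  have hmτ : Measurable τ := hτ.measurable'
  have htop : MeasurableSet {ω | τ ω ≠ ⊤} := hτ.measurableSet_eq_top.compl
  obtain ⟨V, hV, hUV⟩ := (nullMeasurable_of_nullExt hτ.measurableSpace_le hU).aemeasurable
  have hUVr := ae_restrict_of_ae (s := {ω | τ ω ≠ ⊤}) hUV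
  have hsh : Measurable fun ω : CadlagPath E => shift ((τ ω).untopD 0) ω :=
    measurable_id.shift (hmτ.untopD 0)
  have hev : Measurable fun ω : CadlagPath E => evalAt (τ ω) ω := measurable_id.evalAt hmτ
  set μ := (P x).restrict {ω | τ ω ≠ ⊤} with hμ
  -- The joint law of past and future need only be compared on rectangles. There the past event
  -- agrees almost surely with a set in the past of `τ`, so the set version applies.
  have key : μ.map (fun ω => (V ω, shift ((τ ω).untopD 0) ω)) =
      (μ ⊗ₘ P.comap _ hev).map (Prod.map V id) := by
    refine Measure.ext_prod fun {S B} hS hB => ?_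
    rw [Measure.map_apply (hV.prodMk hsh) (hS.prod hB),
      Measure.map_apply (hV.prodMap measurable_id) (hS.prod hB)]
    have h1 : Prod.map V id ⁻¹' S ×ˢ B = (V ⁻¹' S) ×ˢ B := rfl
    have h2 : (fun ω => (V ω, shift ((τ ω).untopD 0) ω)) ⁻¹' S ×ˢ B =
      (fun ω => shift ((τ ω).untopD 0) ω) ⁻¹' B ∩ V ⁻¹' S := by ext; simp [and_comm]
    rw [h1, Measure.compProd_apply_prod (hV hS) hB, h2]
    obtain ⟨C, hC, hUC⟩ := hU hS
    have hVC : (V ⁻¹' S : Set (CadlagPath E)) =ᵐ[P x] C := by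
      refine EventuallyEq.trans ?_ hUC
      refine eventuallyEq_set.2 ?_
      filter_upwards [hUV] with ω hω
      simp only [mem_preimage, hω]
    have hCm := hτ.measurableSpace_le _ hC
    have hr : ∀ f : CadlagPath E → ℝ≥0∞, ∫⁻ ω in V ⁻¹' S, f ω ∂μ =
        ∫⁻ ω in C ∩ {ω | τ ω ≠ ⊤}, f ω ∂P x := by
      intro f
      rw [Measure.restrict_restrict (hV hS)]
      exact setLIntegral_congr (hVC.inter .rfl)
    rw [hr]
    refine Eq.trans ?_ (measure_inter_shift_preimage hP hτ x hC hB)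
    rw [← hr, ← Measure.restrict_apply (hsh hB)]
    have : (fun ω : CadlagPath E => B.indicator (1 : CadlagPath E → ℝ≥0∞)
        (shift ((τ ω).untopD 0) ω)) =
        ((fun ω => shift ((τ ω).untopD 0) ω) ⁻¹' B).indicator 1 := by
      ext ω; rfl
    rw [this, lintegral_indicator_one (hsh hB)]
  have h1 := congrArg (fun ν => ∫⁻ p, Ψ p ∂ν) key
  beta_reduce at h1
  rw [lintegral_map hΨ (hV.prodMk hsh), lintegral_map hΨ (hV.prodMap measurable_id),
    Measure.lintegral_compProd (f := fun a => Ψ (Prod.map V id a))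
      (hΨ.comp (hV.prodMap measurable_id))] at h1
  refine Eq.trans ?_ (h1.trans ?_)
  · refine lintegral_congr_ae ?_
    filter_upwards [hUVr] with ω hω
    rw [hω]
  · refine lintegral_congr_ae ?_
    filter_upwards [hUVr] with ω hω
    simp only [Kernel.comap_apply, Prod.map, hω, id]

/-- The Markov property at a fixed time. -/
theorem lintegral_markov (x : E) (t : ℝ≥0) {h : CadlagPath E → ℝ≥0∞}
    (hh : Measurable[nullExt (P x) (pathFiltration E t)] h) {B : Set (CadlagPath E)}
    (hB : MeasurableSet B) :
    ∫⁻ ω in shift t ⁻¹' B, h ω ∂P x = ∫⁻ ω, h ω * P (ω t) B ∂P x := by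
  have h1 := lintegral_strongMarkov hP (isStoppingTime_const (pathFiltration E) t) x
    (U := h) (by rwa [IsStoppingTime.measurableSpace_const])
    (Ψ := fun p => p.1 * B.indicator 1 p.2)
    (measurable_fst.mul ((measurable_one.indicator hB).comp measurable_snd))
  simp only [ne_eq, WithTop.coe_ne_top, not_false_eq_true, ofPred_true, Measure.restrict_univ,
    WithTop.untopD_coe, evalAt] at h1
  rw [← lintegral_indicator (shift_measurable t hB)]
  refine Eq.trans ?_ (h1.trans (lintegral_congr fun ω => ?_))
  · refine lintegral_congr fun ω => ?_
    by_cases hω : shift t ω ∈ B <;> simp [hω, indicator]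
  · rw [lintegral_const_mul _ (measurable_one.indicator hB), lintegral_indicator_one hB]

end Markov

/-! ### Density processes -/

section Density

variable {E : Type*} [TopologicalSpace E] [MeasurableSpace E]

theorem setLIntegral_condExp_rnDeriv {Ω : Type*} {m₀ m : MeasurableSpace Ω} (hm : m₀ ≤ m)
    {μ Q : Measure Ω} [IsProbabilityMeasure μ] [IsProbabilityMeasure Q] (hQ : Q ≪ μ)
    {A : Set Ω} (hA : MeasurableSet[m₀] A) :
    ∫⁻ ω in A, ENNReal.ofReal ((μ[fun ω => (Q.rnDeriv μ ω).toReal | m₀]) ω) ∂μ = Q A := by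
  have h0 : 0 ≤ᵐ[μ] μ[fun ω => (Q.rnDeriv μ ω).toReal | m₀] :=
    condExp_nonneg (Eventually.of_forall fun ω => ENNReal.toReal_nonneg)
  rw [← ofReal_integral_eq_lintegral_ofReal integrable_condExp.integrableOn
    (ae_restrict_of_ae h0), setIntegral_condExp hm Measure.integrable_toReal_rnDeriv hA,
    Measure.setIntegral_toReal_rnDeriv hQ, ofReal_measureReal]

theorem lintegral_condExp_rnDeriv_mul {Ω : Type*} {m₀ m : MeasurableSpace Ω} (hm : m₀ ≤ m)
    {μ Q : Measure Ω} [IsProbabilityMeasure μ] [IsProbabilityMeasure Q] (hQ : Q ≪ μ)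
    {h : Ω → ℝ≥0∞} (hh : Measurable[m₀] h) :
    ∫⁻ ω, ENNReal.ofReal ((μ[fun ω => (Q.rnDeriv μ ω).toReal | m₀]) ω) * h ω ∂μ =
      ∫⁻ ω, h ω ∂Q := by
  have hc : Measurable fun ω => ENNReal.ofReal ((μ[fun ω => (Q.rnDeriv μ ω).toReal | m₀]) ω) :=
    (stronglyMeasurable_condExp.measurable.mono hm le_rfl).ennreal_ofReal
  have h1 : (μ.withDensity fun ω =>
      ENNReal.ofReal ((μ[fun ω => (Q.rnDeriv μ ω).toReal | m₀]) ω)).trim hm = Q.trim hm := by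
    refine @Measure.ext _ m₀ _ _ fun A hA => ?_
    rw [trim_measurableSet_eq hm hA, trim_measurableSet_eq hm hA, withDensity_apply _ (hm _ hA),
      setLIntegral_condExp_rnDeriv hm hQ hA]
  rw [← lintegral_trim hm hh, ← h1, lintegral_trim hm hh,
    lintegral_withDensity_eq_lintegral_mul _ hc (hh.mono hm le_rfl)]
  rfl

variable [TopologicalSpace.PseudoMetrizableSpace E] [BorelSpace E]
  {P : Kernel E (CadlagPath E)} [IsMarkovKernel P] (hP : IsCanonicalStrongMarkov P)
  {x : E} {Q : Measure (CadlagPath E)} [IsProbabilityMeasure Q] (hQ : Q ≪ P x)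

omit [TopologicalSpace.PseudoMetrizableSpace E] [BorelSpace E] [IsMarkovKernel P]
  [IsProbabilityMeasure Q] in
theorem IsDensityProcess.coe_ae_eq {ζ : CadlagPath E → CadlagPath ℝ≥0}
    (hζ : IsDensityProcess (P x) Q ζ) (t : ℝ≥0) :
    (fun ω => (ζ ω t : ℝ≥0∞)) =ᵐ[P x] fun ω =>
      ENNReal.ofReal (((P x)[fun ω => (Q.rnDeriv (P x) ω).toReal | pathFiltration E t]) ω) := by
  filter_upwards [hζ.version t] with ω hω
  rw [← hω, ENNReal.ofReal_coe_nnreal]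

include hP hQ

/-- The density at `t` is measurable for the past, so the Markov property integrates out the future
first, still under `P`; what remains is a function of the past, on which the density acts as `Q`. -/
theorem lintegral_condExp_rnDeriv_markov (t : ℝ≥0) {A B : Set (CadlagPath E)}
    (hA : MeasurableSet[pathFiltration E t] A) (hB : MeasurableSet B) :
    ∫⁻ ω in A ∩ shift t ⁻¹' B, ENNReal.ofReal
      (((P x)[fun ω => (Q.rnDeriv (P x) ω).toReal | pathFiltration E t]) ω) ∂P x =
      ∫⁻ ω in A, P (ω t) B ∂Q := by
  have hm := (pathFiltration E).le t
  set c := (P x)[fun ω => (Q.rnDeriv (P x) ω).toReal | pathFiltration E t] with hc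
  have hcm : Measurable[pathFiltration E t] fun ω => ENNReal.ofReal (c ω) :=
    stronglyMeasurable_condExp.measurable.ennreal_ofReal
  have hBt : Measurable[pathFiltration E t] fun ω : CadlagPath E => P (ω t) B :=
    (P.measurable_coe hB).comp ((measurable_coordinate_rawFiltration le_rfl).mono
      (rawFiltration_le_pathFiltration t) le_rfl)
  have h1 := lintegral_markov hP x t (h := A.indicator fun ω => ENNReal.ofReal (c ω))
    ((hcm.indicator hA).mono le_eventuallyMeasurableSpace le_rfl) hB
  rw [lintegral_indicator (hm _ hA), Measure.restrict_restrict (hm _ hA)] at h1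
  rw [h1, ← lintegral_indicator (hm _ hA),
    ← lintegral_condExp_rnDeriv_mul hm hQ (hBt.indicator hA)]
  refine lintegral_congr fun ω => ?_
  by_cases h : ω ∈ A <;> simp [h, hc]

/-- The density process integrates events of the past and of the future like the changed
measure, with unchanged transitions after `t`. -/
theorem IsDensityProcess.setLIntegral {ζ : CadlagPath E → CadlagPath ℝ≥0}
    (hζ : IsDensityProcess (P x) Q ζ) (t : ℝ≥0) {A B : Set (CadlagPath E)}
    (hA : MeasurableSet[pathFiltration E t] A) (hB : MeasurableSet B) :
    ∫⁻ ω in A ∩ shift t ⁻¹' B, (ζ ω t : ℝ≥0∞) ∂P x = ∫⁻ ω in A, P (ω t) B ∂Q := by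
  rw [← lintegral_condExp_rnDeriv_markov hP hQ t hA hB]
  exact lintegral_congr_ae (ae_restrict_of_ae (hζ.coe_ae_eq t))

/-- The test sets form a π-system generating the whole σ-algebra, so the identities determine `ζ ω
t` almost surely. Adaptedness of `ζ` is a consequence up to null sets and need not be checked
beforehand. -/
theorem isDensityProcess_of_setLIntegral {ζ : CadlagPath E → CadlagPath ℝ≥0} (hζm : Measurable ζ)
    (h : ∀ (t : ℝ≥0) (A B : Set (CadlagPath E)), MeasurableSet[rawFiltration E t] A →
      MeasurableSet B →
      ∫⁻ ω in A ∩ shift t ⁻¹' B, (ζ ω t : ℝ≥0∞) ∂P x = ∫⁻ ω in A, P (ω t) B ∂Q) :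
    IsDensityProcess (P x) Q ζ := by
  refine ⟨hζm, fun t => ?_⟩
  set c := (P x)[fun ω => (Q.rnDeriv (P x) ω).toReal | pathFiltration E t] with hc
  have hcm : Measurable fun ω => ENNReal.ofReal (c ω) :=
    (stronglyMeasurable_condExp.measurable.mono ((pathFiltration E).le t) le_rfl).ennreal_ofReal
  have hzm : Measurable fun ω => (ζ ω t : ℝ≥0∞) :=
    ((measurable_coordinate t).comp hζm).coe_nnreal_ennreal
  have hone : ∀ A B : Set (CadlagPath E), MeasurableSet[rawFiltration E t] A → MeasurableSet B →
      ∫⁻ ω in A ∩ shift t ⁻¹' B, ENNReal.ofReal (c ω) ∂P x =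
        ∫⁻ ω in A ∩ shift t ⁻¹' B, (ζ ω t : ℝ≥0∞) ∂P x := fun A B hA hB => by
    rw [h t A B hA hB, lintegral_condExp_rnDeriv_markov hP hQ t
      (rawFiltration_le_pathFiltration t A hA) hB]
  have huniv : ∫⁻ ω, ENNReal.ofReal (c ω) ∂P x = 1 := by
    rw [← setLIntegral_univ, setLIntegral_condExp_rnDeriv ((pathFiltration E).le t) hQ
      MeasurableSet.univ, measure_univ]
  have heq : (P x).withDensity (fun ω => ENNReal.ofReal (c ω)) =
      (P x).withDensity fun ω => (ζ ω t : ℝ≥0∞) := by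
    have : IsFiniteMeasure ((P x).withDensity fun ω => ENNReal.ofReal (c ω)) :=
      isFiniteMeasure_withDensity (by rw [huniv]; exact ENNReal.one_ne_top)
    refine ext_of_generate_finite _ (generateFrom_past_inter_future t)
      (isPiSystem_past_inter_future t) ?_ ?_
    · rintro _ ⟨A, B, hA, hB, rfl⟩
      have hAB := ((rawFiltration E).le t A hA).inter (shift_measurable t hB)
      rw [withDensity_apply _ hAB, withDensity_apply _ hAB, hone A B hA hB]
    · have := hone univ univ MeasurableSet.univ MeasurableSet.univ
      rw [withDensity_apply _ .univ, withDensity_apply _ .univ]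
      simpa using this
  have hae := (withDensity_eq_iff hcm.aemeasurable hzm.aemeasurable
    (by rw [huniv]; exact ENNReal.one_ne_top)).1 heq
  have h0 : 0 ≤ᵐ[P x] c := condExp_nonneg (Eventually.of_forall fun ω => ENNReal.toReal_nonneg)
  filter_upwards [hae, h0] with ω hω h0ω
  have := congrArg ENNReal.toReal hω
  rw [ENNReal.toReal_ofReal h0ω] at this
  simpa using this.symm

omit [TopologicalSpace.PseudoMetrizableSpace E] [BorelSpace E] hP in
theorem IsDensityProcess.measure_eq {ζ : CadlagPath E → CadlagPath ℝ≥0}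
    (hζ : IsDensityProcess (P x) Q ζ) (t : ℝ≥0) {A : Set (CadlagPath E)}
    (hA : MeasurableSet[pathFiltration E t] A) :
    ∫⁻ ω in A, (ζ ω t : ℝ≥0∞) ∂P x = Q A := by
  rw [← setLIntegral_condExp_rnDeriv ((pathFiltration E).le t) hQ hA]
  exact lintegral_congr_ae (ae_restrict_of_ae (hζ.coe_ae_eq t))

variable {τ : CadlagPath E → WithTop ℝ≥0} (hτ : IsStoppingTime (pathFiltration E) τ)

-- Optional sampling of the density process at `τ ∧ n`, followed by monotone convergence. The event
-- `τ = ⊤` is left out because the process has no terminal value there.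
omit [TopologicalSpace.PseudoMetrizableSpace E] [BorelSpace E] hP in
theorem IsDensityProcess.measure_inter_ne_top {ζ : CadlagPath E → CadlagPath ℝ≥0}
    (hζ : IsDensityProcess (P x) Q ζ) {C : Set (CadlagPath E)}
    (hC : MeasurableSet[hτ.measurableSpace] C) :
    ∫⁻ ω in C ∩ {ω | τ ω ≠ ⊤}, ((evalAt (τ ω) (ζ ω) : ℝ≥0) : ℝ≥0∞) ∂P x = Q (C ∩ {ω | τ ω ≠ ⊤}) := by
  have hone : Q (C ∩ {ω | τ ω ≠ ⊤}) = ∫⁻ ω in C ∩ {ω | τ ω ≠ ⊤}, 1 ∂Q := by simp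
  rw [hone, setLIntegral_inter_ne_top, setLIntegral_inter_ne_top]
  congr 1
  ext n
  rw [setLIntegral_one]
  have hσ := (isStoppingTime_const (pathFiltration E) (n : ℝ≥0)).min hτ
  have hCn := measurableSet_inter_le_min hτ hC n
  have hCm : MeasurableSet (C ∩ {ω | τ ω ≤ ((n : ℝ≥0) : WithTop ℝ≥0)}) :=
    hσ.measurableSpace_le _ hCn
  have hσ' : IsStoppingTime (pathFiltration E).rightCont
      fun ω => min ((n : ℝ≥0) : WithTop ℝ≥0) (τ ω) := by
    rwa [Filtration.IsRightContinuous.eq]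
  obtain ⟨hint, hos⟩ := optional_sampling (Y := fun t ω => (ζ ω t : ℝ))
    (martingale_condExp (fun ω => (Q.rnDeriv (P x) ω).toReal) (pathFiltration E) (P x))
    (fun ω t => NNReal.continuous_coe.continuousAt.comp_continuousWithinAt ((ζ ω).rightCts t))
    hζ.version hσ' (fun ω => min_le_left _ _) (lt_add_one (n : ℝ≥0))
  have hA : MeasurableSet[hσ'.measurableSpace] (C ∩ {ω | τ ω ≤ ((n : ℝ≥0) : WithTop ℝ≥0)}) := by
    convert hCn using 2
    exact Filtration.IsRightContinuous.eq
  have h1 := hos _ hA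
  rw [setIntegral_condExp ((pathFiltration E).le _) Measure.integrable_toReal_rnDeriv
    ((pathFiltration E).mono (lt_add_one (n : ℝ≥0)).le _ (hC.2 n)), Measure.setIntegral_toReal_rnDeriv hQ] at h1
  have h2 := congrArg ENNReal.ofReal h1
  rw [ofReal_measureReal, ofReal_integral_eq_lintegral_ofReal hint.integrableOn
    (Eventually.of_forall fun ω => NNReal.coe_nonneg _)] at h2
  rw [← h2]
  refine setLIntegral_congr_fun hCm fun ω hω => ?_
  have : τ ω ≤ ((n : ℝ≥0) : WithTop ℝ≥0) := hω.2
  simp only [min_eq_right this, ENNReal.ofReal_coe_nnreal, evalAt]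

omit [TopologicalSpace.PseudoMetrizableSpace E] [BorelSpace E] hP in
/-- On the past of `τ` the changed measure has density `ζ_τ`. -/
theorem IsDensityProcess.lintegral_stopped {ζ : CadlagPath E → CadlagPath ℝ≥0}
    (hζ : IsDensityProcess (P x) Q ζ) {A : Type*} [MeasurableSpace A]
    [MeasurableSpace.CountablyGenerated A] {U : CadlagPath E → A}
    (hU : Measurable[nullExt (P x) hτ.measurableSpace] U) {f : A → ℝ≥0∞} (hf : Measurable f) :
    ∫⁻ ω in {ω | τ ω ≠ ⊤}, f (U ω) ∂Q =
      ∫⁻ ω in {ω | τ ω ≠ ⊤}, f (U ω) * (evalAt (τ ω) (ζ ω) : ℝ≥0) ∂P x := by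
  have hmτ : Measurable τ := hτ.measurable'
  have htop : MeasurableSet {ω | τ ω ≠ ⊤} := hτ.measurableSet_eq_top.compl
  obtain ⟨V, hV, hUV⟩ := (nullMeasurable_of_nullExt hτ.measurableSpace_le hU).aemeasurable
  have hzm : Measurable fun ω => ((evalAt (τ ω) (ζ ω) : ℝ≥0) : ℝ≥0∞) :=
    (hζ.meas.evalAt hmτ).coe_nnreal_ennreal
  have key : (Q.restrict {ω | τ ω ≠ ⊤}).map V =
      (((P x).restrict {ω | τ ω ≠ ⊤}).withDensity
        fun ω => ((evalAt (τ ω) (ζ ω) : ℝ≥0) : ℝ≥0∞)).map V := by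
    ext S hS
    rw [Measure.map_apply hV hS, Measure.map_apply hV hS, withDensity_apply _ (hV hS),
      Measure.restrict_apply (hV hS), Measure.restrict_restrict (hV hS)]
    obtain ⟨C, hC, hUC⟩ := hU hS
    have hVC : (V ⁻¹' S : Set (CadlagPath E)) =ᵐ[P x] C := by
      refine EventuallyEq.trans ?_ hUC
      refine eventuallyEq_set.2 ?_
      filter_upwards [hUV] with ω hω
      simp only [mem_preimage, hω]
    have hi : (V ⁻¹' S ∩ {ω | τ ω ≠ ⊤} : Set (CadlagPath E)) =ᵐ[P x]
        (C ∩ {ω | τ ω ≠ ⊤} : Set (CadlagPath E)) := hVC.inter .rfl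
    rw [setLIntegral_congr hi, hζ.measure_inter_ne_top hQ hτ hC]
    exact measure_congr (hQ.ae_eq hi)
  have h1 := congrArg (fun ν => ∫⁻ p, f p ∂ν) key
  beta_reduce at h1
  rw [lintegral_map hf hV, lintegral_map hf hV,
    lintegral_withDensity_eq_lintegral_mul _ hzm (g := fun ω => f (V ω)) (hf.comp hV)] at h1
  refine Eq.trans ?_ (h1.trans ?_)
  · refine lintegral_congr_ae (ae_restrict_of_ae ?_)
    filter_upwards [hQ.ae_eq hUV] with ω hω
    rw [hω]
  · refine lintegral_congr_ae (ae_restrict_of_ae ?_)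
    filter_upwards [hUV] with ω hω
    rw [hω, mul_comm]
    rfl

end Density

/-! ### Universally measurable kernels -/

section UniversallyMeasurable

variable {α β Ω : Type*} [MeasurableSpace α] [MeasurableSpace β] [MeasurableSpace Ω]

theorem exists_countable_isPiSystem (Ω : Type*) [m : MeasurableSpace Ω]
    [MeasurableSpace.CountablyGenerated Ω] :
    ∃ S : Set (Set Ω), S.Countable ∧ IsPiSystem S ∧ m = MeasurableSpace.generateFrom S := by
  set S₀ := MeasurableSpace.countableGeneratingSet Ω
  have hS₀ : S₀.Countable := MeasurableSpace.countable_countableGeneratingSet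
  refine ⟨sInter '' {t | t.Finite ∧ t ⊆ S₀}, (countable_ofPred_finite_subset hS₀).image _, ?_, ?_⟩
  · rintro _ ⟨t, ⟨ht, ht'⟩, rfl⟩ _ ⟨u, ⟨hu, hu'⟩, rfl⟩ -
    exact ⟨t ∪ u, ⟨ht.union hu, union_subset ht' hu'⟩, sInter_union t u⟩
  · refine le_antisymm ?_ (MeasurableSpace.generateFrom_le ?_)
    · conv_lhs => rw [← MeasurableSpace.generateFrom_countableGeneratingSet (α := Ω)]
      exact MeasurableSpace.generateFrom_mono fun s hs =>
        ⟨{s}, ⟨finite_singleton s, singleton_subset_iff.2 hs⟩, sInter_singleton s⟩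
    · rintro _ ⟨t, ⟨ht, ht'⟩, rfl⟩
      exact MeasurableSet.sInter ht.countable fun s hs =>
        MeasurableSpace.measurableSet_countableGeneratingSet (ht' hs)

/-- A universally measurable kernel agrees almost everywhere with a measurable one. -/
theorem IsUniversallyMeasurableKernel.exists_kernel [MeasurableSpace.CountablyGenerated Ω]
    {ν : α → Measure Ω} (hν : IsUniversallyMeasurableKernel ν) (m : Measure α)
    [IsProbabilityMeasure m] :
    ∃ K : Kernel α Ω, IsMarkovKernel K ∧ ∀ᵐ p ∂m, K p = ν p := by
  obtain ⟨S, hSc, hSpi, hS⟩ := exists_countable_isPiSystem Ω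
  have hSm : ∀ s ∈ S, MeasurableSet s := fun s hs =>
    hS ▸ MeasurableSpace.measurableSet_generateFrom hs
  have hae : ∀ s ∈ S, AEMeasurable (fun p => ν p s) m := fun s hs =>
    (hν.meas s (hSm s hs) m inferInstance).aemeasurable
  choose! f hf hfν using hae
  have hbad : m {p | ¬ ∀ s ∈ S, ν p s = f s p} = 0 := by
    rw [← ae_iff, ae_ball_iff hSc]
    exact hfν
  -- On this measurable set of full measure `ν` itself is kept, and off it a fixed value of `ν`.
  -- Measurability then has to be checked only on the π-system, where `ν` equals Borel functions.
  set G := (toMeasurable m {p | ¬ ∀ s ∈ S, ν p s = f s p})ᶜ with hG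
  have hGm : MeasurableSet G := (measurableSet_toMeasurable _ _).compl
  have hG0 : m Gᶜ = 0 := by rw [hG, compl_compl, measure_toMeasurable, hbad]
  have hGS : ∀ p ∈ G, ∀ s ∈ S, ν p s = f s p := fun p hp => by
    by_contra h
    exact hp (subset_toMeasurable _ _ h)
  have hne : Nonempty α := m.nonempty_of_neZero
  obtain ⟨p₀⟩ := hne
  classical
  set K : α → Measure Ω := fun p => if p ∈ G then ν p else ν p₀ with hK
  have hKprob : ∀ p, IsProbabilityMeasure (K p) := fun p => by
    by_cases hp : p ∈ G <;> simp only [hK, hp, if_true, if_false] <;> exact hν.prob _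
  have hKm : Measurable K := by
    refine Measurable.measure_of_isPiSystem_of_isProbabilityMeasure hS hSpi fun s hs => ?_
    have : (fun p => K p s) = fun p => if p ∈ G then f s p else ν p₀ s := by
      ext p
      by_cases hp : p ∈ G
      · simp only [hK, hp, if_true, hGS p hp s hs]
      · simp only [hK, hp, if_false]
    rw [this]
    exact Measurable.ite hGm (hf s hs) measurable_const
  refine ⟨⟨K, hKm⟩, ⟨hKprob⟩, ?_⟩
  filter_upwards [compl_mem_ae_iff.2 hG0] with p hp
  rw [compl_compl] at hp
  change K p = ν p
  simp only [hK, hp, if_true]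

theorem UniversallyMeasurable.comp_measurable {γ : Type*} [MeasurableSpace γ] {f : β → γ}
    (hf : UniversallyMeasurable f) {n : α → β} (hn : Measurable n) :
    UniversallyMeasurable (f ∘ n) := fun m _ =>
  (hf (m.map n) (Measure.isProbabilityMeasure_map hn.aemeasurable)).comp_quasiMeasurePreserving
    ⟨hn, Measure.AbsolutelyContinuous.rfl⟩

theorem IsUniversallyMeasurableKernel.comp_measurable {ν : β → Measure Ω}
    (hν : IsUniversallyMeasurableKernel ν) {n : α → β} (hn : Measurable n) :
    IsUniversallyMeasurableKernel (ν ∘ n) :=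
  ⟨fun _ => hν.prob _, fun A hA => (hν.meas A hA).comp_measurable hn⟩

theorem IsUniversallyMeasurableKernel.lintegral [MeasurableSpace.CountablyGenerated Ω]
    {ν : α → Measure Ω} (hν : IsUniversallyMeasurableKernel ν) {f : Ω → ℝ≥0∞}
    (hf : Measurable f) : UniversallyMeasurable fun p => ∫⁻ ω, f ω ∂ν p := fun m _ => by
  obtain ⟨K, -, hK⟩ := hν.exists_kernel m
  have h1 : Measurable fun p => ∫⁻ ω, f ω ∂K p := hf.lintegral_kernel
  refine AEMeasurable.nullMeasurable ⟨_, h1, ?_⟩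
  filter_upwards [hK] with p hp
  rw [hp]

theorem isUniversallyMeasurableKernel_of_isPiSystem {κ : α → Measure Ω}
    (hκ : ∀ p, IsProbabilityMeasure (κ p)) {S : Set (Set Ω)}
    (hgen : ‹MeasurableSpace Ω› = MeasurableSpace.generateFrom S) (hpi : IsPiSystem S)
    (h : ∀ A ∈ S, UniversallyMeasurable fun p => κ p A) : IsUniversallyMeasurableKernel κ := by
  refine ⟨hκ, fun A hA m _ => ?_⟩
  refine AEMeasurable.nullMeasurable ?_
  induction A, hA using MeasurableSpace.induction_on_inter hgen hpi with
  | empty => simp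
  | basic A hA => exact (h A hA m inferInstance).aemeasurable
  | compl A hA ih =>
    simp only [prob_compl_eq_one_sub hA]
    exact ih.const_sub 1
  | iUnion f hd hm ih =>
    simp only [measure_iUnion hd hm]
    exact AEMeasurable.tsum ih

end UniversallyMeasurable

theorem isPiSystem_iUnion_rawFiltration {E : Type*} [TopologicalSpace E] [MeasurableSpace E] :
    IsPiSystem (⋃ k : ℕ, {A | MeasurableSet[rawFiltration E k] A}) := by
  intro A hA B hB _
  obtain ⟨j, hj⟩ := mem_iUnion.1 hA
  obtain ⟨k, hk⟩ := mem_iUnion.1 hB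
  refine mem_iUnion.2 ⟨max j k, ?_⟩
  exact ((rawFiltration E).mono (by exact_mod_cast le_max_left j k) _ hj).inter
    ((rawFiltration E).mono (by exact_mod_cast le_max_right j k) _ hk)

/-! ### Selectors of the augmented family -/

/-- The first component of a path in a product. -/
def CadlagPath.fst {E G : Type*} [TopologicalSpace E] [TopologicalSpace G]
    (ω : CadlagPath (E × G)) : CadlagPath E where
  toFun := fun t => (ω t).1
  rightCts := fun t => continuous_fst.continuousAt.comp_continuousWithinAt (ω.rightCts t)
  leftLim := fun t => by
    obtain ⟨l, hl⟩ := ω.leftLim t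
    exact ⟨l.1, (continuous_fst.tendsto l).comp hl⟩

theorem CadlagPath.measurable_fst {E G : Type*} [TopologicalSpace E] [TopologicalSpace G]
    [MeasurableSpace E] [MeasurableSpace G] :
    Measurable (CadlagPath.fst : CadlagPath (E × G) → CadlagPath E) :=
  measurable_path_iff.2 fun t => Measurable.fst (measurable_coordinate t)

/-- Replace the weight `0` by the weight `1`. -/
def normalizeWeight {E : Type*} (p : E × ℝ≥0) : E × ℝ≥0 := (p.1, if p.2 = 0 then 1 else p.2)

theorem measurable_normalizeWeight {E : Type*} [MeasurableSpace E] :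
    Measurable (normalizeWeight : E × ℝ≥0 → E × ℝ≥0) :=
  measurable_fst.prodMk (Measurable.ite (measurable_snd (measurableSet_singleton 0))
    measurable_const measurable_snd)

theorem normalizeWeight_snd_ne_zero {E : Type*} (p : E × ℝ≥0) : (normalizeWeight p).2 ≠ 0 := by
  unfold normalizeWeight
  dsimp only
  split_ifs with h
  · exact one_ne_zero
  · exact h

section Selector

variable {E : Type*} [TopologicalSpace E] [MeasurableSpace E]
  [TopologicalSpace.PseudoMetrizableSpace E] [BorelSpace E] [SecondCountableTopology E]

theorem countablyGenerated_augmentedPath :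
    MeasurableSpace.CountablyGenerated (CadlagPath (E × ℝ≥0)) :=
  countablyGenerated_path

variable {P : Kernel E (CadlagPath E)} [IsMarkovKernel P]
  {ν : E × ℝ≥0 → Measure (CadlagPath (E × ℝ≥0))} {κ : E × ℝ≥0 → Measure (CadlagPath E)}
  {ζ : E × ℝ≥0 → CadlagPath E → CadlagPath ℝ≥0} {w : E × ℝ≥0 → ℝ≥0}

/-- The measures can be recovered in a universally measurable way from the augmented laws. -/
theorem isUniversallyMeasurableKernel_of_augment (hν : IsUniversallyMeasurableKernel ν)
    (hw : Measurable w) (hw0 : ∀ p, w p ≠ 0) (hκ : ∀ p, IsProbabilityMeasure (κ p))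
    (hκP : ∀ p, κ p ≪ P p.1) (hζ : ∀ p, IsDensityProcess (P p.1) (κ p) (ζ p))
    (hνζ : ∀ p, ν p = (P p.1).map fun ω => augment (w p) ω (ζ p ω)) :
    IsUniversallyMeasurableKernel κ := by
  have := countablyGenerated_augmentedPath (E := E)
  refine isUniversallyMeasurableKernel_of_isPiSystem hκ ?_ isPiSystem_iUnion_rawFiltration ?_
  · exact iSup_rawFiltration.symm.trans (MeasurableSpace.generateFrom_iUnion_measurableSet
      fun k : ℕ => (rawFiltration E k : MeasurableSpace (CadlagPath E))).symm
  intro A hA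
  obtain ⟨k, hk⟩ := mem_iUnion.1 hA
  have hk : MeasurableSet[rawFiltration E k] A := hk
  have hAm := (rawFiltration E).le k A hk
  set f : CadlagPath (E × ℝ≥0) → ℝ≥0∞ :=
    (CadlagPath.fst ⁻¹' A).indicator fun y => ((y k).2 : ℝ≥0∞) with hf
  have hfm : Measurable f := Measurable.indicator
    (Measurable.coe_nnreal_ennreal (Measurable.snd (measurable_coordinate (k : ℝ≥0))))
    (CadlagPath.measurable_fst hAm)
  -- For `A` in the past of `k`, its mass under `κ p` is the integral of the density at `k` over
  -- `A`, and under `ν p` the second coordinate at time `k` is `w p` times that density.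
  have heq : (fun p => κ p A) = fun p => ((w p : ℝ≥0)⁻¹ : ℝ≥0) * ∫⁻ y, f y ∂ν p := by
    ext p
    have hm : Measurable fun ω => augment (w p) ω (ζ p ω) :=
      Measurable.augment measurable_const measurable_id (hζ p).meas
    rw [hνζ p, lintegral_map hfm hm]
    have : ∀ ω, f (augment (w p) ω (ζ p ω)) =
        A.indicator (fun ω => (w p : ℝ≥0∞) * ζ p ω k) ω := fun ω => by
      by_cases hω : ω ∈ A
      · rw [indicator_of_mem hω, hf, indicator_of_mem (by exact hω)]
        exact ENNReal.coe_mul _ _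
      · rw [indicator_of_notMem hω, hf, indicator_of_notMem (by exact hω)]
    simp only [this]
    have hprob := hκ p
    have hζk : Measurable fun ω => (ζ p ω k : ℝ≥0∞) :=
      ((measurable_coordinate (k : ℝ≥0)).comp (hζ p).meas).coe_nnreal_ennreal
    rw [lintegral_indicator hAm, lintegral_const_mul _ hζk,
      (hζ p).measure_eq (hκP p) k (rawFiltration_le_pathFiltration _ _ hk), ← mul_assoc,
      ← ENNReal.coe_mul, inv_mul_cancel₀ (hw0 p), ENNReal.coe_one, one_mul]
  rw [heq]
  intro m hm
  exact AEMeasurable.nullMeasurable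
    (hw.inv.coe_nnreal_ennreal.aemeasurable.mul ((hν.lintegral hfm) m hm).aemeasurable)

/-- Versions of the density processes which depend measurably on the parameter. -/
theorem exists_measurable_density (hν : IsUniversallyMeasurableKernel ν)
    (hw : Measurable w) (hw0 : ∀ p, w p ≠ 0) (hζ : ∀ p, Measurable (ζ p))
    (hνζ : ∀ p, ν p = (P p.1).map fun ω => augment (w p) ω (ζ p ω))
    (m : Measure (E × ℝ≥0)) [IsProbabilityMeasure m] :
    ∃ Z : (E × ℝ≥0) × CadlagPath E → CadlagPath ℝ≥0, Measurable Z ∧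
      ∀ᵐ p ∂m, ∀ᵐ ω ∂P p.1, Z (p, ω) = ζ p ω := by
  have := countablyGenerated_augmentedPath (E := E)
  have := countablyGenerated_path (E := E)
  obtain ⟨g, hg, hgy⟩ := exists_measurable_path_of_trace
  obtain ⟨K, hK, hKν⟩ := hν.exists_kernel m
  set η : Kernel (E × ℝ≥0) (CadlagPath E) := P.comap Prod.fst measurable_fst with hη
  -- The bounded injective transform `1 / (1 + y)` of the weight keeps the weighted kernels finite.
  -- Under `ν p` the weight is a function of the underlying path, so projecting to that path loses
  -- nothing and the derivative with respect to `P` is the transformed weight.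
  set φ : ℚ≥0 → E × ℝ≥0 → CadlagPath (E × ℝ≥0) → ℝ≥0∞ := fun r _ y =>
    (1 + ((y (r : ℝ≥0)).2 : ℝ≥0∞))⁻¹ with hφ
  have hφy : ∀ r p, Measurable (φ r p) := fun r p => Measurable.inv (Measurable.const_add
    (Measurable.coe_nnreal_ennreal (Measurable.snd (measurable_coordinate (r : ℝ≥0)))) _)
  have hφm : ∀ r, Measurable (Function.uncurry (φ r)) := fun r =>
    (hφy r (Classical.choice m.nonempty_of_neZero)).comp measurable_snd
  have hfin : ∀ r, IsFiniteKernel (K.withDensity (φ r)) := fun r =>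
    Kernel.isFiniteKernel_withDensity_of_bounded K ENNReal.one_ne_top fun p y =>
      ENNReal.inv_le_one.2 le_self_add
  set L : ℚ≥0 → Kernel (E × ℝ≥0) (CadlagPath E) := fun r =>
    (K.withDensity (φ r)).map CadlagPath.fst with hL
  have hLfin : ∀ r, IsFiniteKernel (L r) := fun r => by
    have := hfin r
    simp only [hL]
    infer_instance
  -- Inverting the transform gives the weight at the rational time `r`; dividing by `w` gives the
  -- density, and `g` assembles a path.
  set Z : (E × ℝ≥0) × CadlagPath E → CadlagPath ℝ≥0 := fun q => g fun r =>
    (w q.1)⁻¹ * (((L r).rnDeriv η q.1 q.2)⁻¹ - 1).toNNReal with hZ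
  refine ⟨Z, hg.comp (measurable_pi_lambda _ fun r => ?_), ?_⟩
  · exact (hw.inv.comp measurable_fst).mul
      (((Kernel.measurable_rnDeriv (L r) η).inv.sub_const 1).ennreal_toNNReal)
  filter_upwards [hKν] with p hp
  have hm : Measurable fun ω => augment (w p) ω (ζ p ω) :=
    Measurable.augment measurable_const measurable_id (hζ p)
  have hψ : ∀ r : ℚ≥0, Measurable fun ω => (1 + ((w p * ζ p ω (r : ℝ≥0) : ℝ≥0) : ℝ≥0∞))⁻¹ :=
    fun r => Measurable.inv (Measurable.const_add (Measurable.coe_nnreal_ennreal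
      (Measurable.const_mul ((measurable_coordinate (r : ℝ≥0)).comp (hζ p)) _)) _)
  have hLr : ∀ r : ℚ≥0, L r p = (P p.1).withDensity
      fun ω => (1 + ((w p * ζ p ω (r : ℝ≥0) : ℝ≥0) : ℝ≥0∞))⁻¹ := fun r => by
    ext A hA
    simp only [hL]
    rw [Kernel.map_apply' _ CadlagPath.measurable_fst _ hA, Kernel.withDensity_apply _ (hφm r),
      withDensity_apply _ (CadlagPath.measurable_fst hA), withDensity_apply _ hA, hp, hνζ p,
      setLIntegral_map (CadlagPath.measurable_fst hA) (hφy r p) hm]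
    rfl
  have hall : ∀ᵐ ω ∂P p.1, ∀ r : ℚ≥0, (L r).rnDeriv η p ω =
      (1 + ((w p * ζ p ω (r : ℝ≥0) : ℝ≥0) : ℝ≥0∞))⁻¹ := by
    refine ae_all_iff.2 fun r => ?_
    have h1 : (L r).rnDeriv η p =ᵐ[P p.1] (L r p).rnDeriv (P p.1) :=
      Kernel.rnDeriv_eq_rnDeriv_measure (κ := L r) (η := η) (a := p)
    have h2 := Measure.rnDeriv_withDensity (P p.1) (hψ r)
    rw [← hLr r] at h2
    exact h1.trans h2
  filter_upwards [hall] with ω hω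
  simp only [hZ, hω, inv_inv]
  rw [← hgy (ζ p ω)]
  congr 1
  ext r
  rw [ENNReal.add_sub_cancel_left ENNReal.one_ne_top, ENNReal.toNNReal_coe,
    inv_mul_cancel_left₀ (hw0 p), hgy]

end Selector

/-- At weight `0` the augmented law carries no information on `Q`, so an arbitrary choice there
could fail to be measurable. Every `Q` represents it, however, and the one chosen at weight `1` is
used, which reduces everything to nonzero weights. -/
theorem exists_selector_of_augmented {d : ℕ} {F : Type*} [TopologicalSpace F] [MeasurableSpace F]
    [TopologicalSpace.PseudoMetrizableSpace F] [BorelSpace F] [SecondCountableTopology F]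
    {P : Kernel (State d F) (CadlagPath (State d F))} [IsMarkovKernel P]
    {ν : State d F × ℝ≥0 → Measure (CadlagPath (State d F × ℝ≥0))}
    (hν : IsSelector (augmentedFamily P) ν) :
    ∃ (κ : State d F × ℝ≥0 → Measure (CadlagPath (State d F)))
      (ζ : State d F × ℝ≥0 → CadlagPath (State d F) → CadlagPath ℝ≥0),
      IsSelector (fun p => martingaleMeasures P p.1) κ ∧
      (∀ p, IsDensityProcess (P p.1) (κ p) (ζ p)) ∧
      (∀ p, ν p = (P p.1).map fun ω => augment p.2 ω (ζ p ω)) ∧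
      ∀ m : Measure (State d F × ℝ≥0), IsProbabilityMeasure m →
        ∃ Z : (State d F × ℝ≥0) × CadlagPath (State d F) → CadlagPath ℝ≥0, Measurable Z ∧
          ∀ᵐ p ∂m, ∀ᵐ ω ∂P p.1, Z (p, ω) = ζ p ω := by
  have hmem := hν.mem
  choose Q hQ ζ hζ hνζ using hmem
  set n := (normalizeWeight : State d F × ℝ≥0 → State d F × ℝ≥0) with hn
  have hnm : Measurable n := measurable_normalizeWeight
  have hζ' : ∀ p, IsDensityProcess (P p.1) (Q (n p)) (ζ (n p)) := fun p => hζ (n p)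
  have hνζ' : ∀ p, (ν ∘ n) p = (P p.1).map fun ω => augment (n p).2 ω (ζ (n p) ω) :=
    fun p => hνζ (n p)
  have hνn := hν.kernel.comp_measurable hnm
  refine ⟨fun p => Q (n p), fun p => ζ (n p), ⟨?_, fun p => hQ (n p)⟩, hζ', fun p => ?_,
    fun m _ => exists_measurable_density hνn hnm.snd normalizeWeight_snd_ne_zero
      (fun p => (hζ' p).meas) hνζ' m⟩
  · exact isUniversallyMeasurableKernel_of_augment hνn hnm.snd normalizeWeight_snd_ne_zero
      (fun p => (hQ (n p)).1) (fun p => (hQ (n p)).2.1) hζ' hνζ'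
  · by_cases h : p.2 = 0
    · rw [hνζ p]
      congr 1
      ext1 ω
      refine CadlagPath.ext fun t => ?_
      change (ω t, p.2 * ζ p ω t) = (ω t, p.2 * ζ (n p) ω t)
      rw [h, zero_mul, zero_mul]
    · have : n p = p := by
        simp only [hn, normalizeWeight, h, if_false]
      beta_reduce
      rw [this]
      exact hνζ p

/-! ### The price process stopped at a level -/

section Level

variable {d : ℕ} {F : Type*} [TopologicalSpace F]

theorem rightCts_price (ω : CadlagPath (State d F)) (t : ℝ≥0) :
    ContinuousWithinAt (fun s => price s ω) (Ici t) t :=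
  (continuous_fst.comp continuous_snd).continuousAt.comp_continuousWithinAt (ω.rightCts t)

theorem exists_price_bound (ω : CadlagPath (State d F)) (t : ℝ≥0) :
    ∃ C : ℝ≥0, ∀ s ≤ t, ‖price s ω‖₊ ≤ C := by
  have h : ∃ C : ℝ≥0, ∀ s ∈ Icc 0 t, ‖price s ω‖₊ ≤ C := by
    refine isCompact_Icc.induction_on (p := fun A => ∃ C : ℝ≥0, ∀ s ∈ A, ‖price s ω‖₊ ≤ C)
      ⟨0, by simp⟩ (fun A B hAB ⟨C, hC⟩ => ⟨C, fun s hs => hC s (hAB hs)⟩)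
      (fun A B ⟨C, hC⟩ ⟨D, hD⟩ => ⟨max C D, fun s hs => hs.elim
        (fun h => (hC s h).trans (le_max_left _ _)) fun h => (hD s h).trans (le_max_right _ _)⟩) ?_
    intro s _
    obtain ⟨l, hl⟩ := ω.leftLim s
    have h1 : ∀ᶠ u in 𝓝[<] s, ‖price u ω‖₊ < ‖l.2.1‖₊ + 1 :=
      ((continuous_fst.comp continuous_snd).nnnorm.tendsto l |>.comp hl).eventually_lt_const
        (lt_add_one _)
    have h2 : ∀ᶠ u in 𝓝[≥] s, ‖price u ω‖₊ < ‖price s ω‖₊ + 1 :=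
      (rightCts_price ω s).nnnorm.tendsto.eventually_lt_const (lt_add_one _)
    have h3 : {u | ‖price u ω‖₊ ≤ max (‖l.2.1‖₊ + 1) (‖price s ω‖₊ + 1)} ∈ 𝓝 s := by
      rw [← nhdsLT_sup_nhdsGE]
      exact ⟨h1.mono fun u hu => hu.le.trans (le_max_left _ _),
        h2.mono fun u hu => hu.le.trans (le_max_right _ _)⟩
    exact ⟨_, mem_nhdsWithin_of_mem_nhds h3, _, fun u hu => hu⟩
  obtain ⟨C, hC⟩ := h
  exact ⟨C, fun s hs => hC s ⟨zero_le, hs⟩⟩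

/-- The running supremum of the norm of the price process. -/
def runningSup (t : ℝ≥0) (ω : CadlagPath (State d F)) : ℝ≥0∞ := ⨆ s : Iic t, ‖price s ω‖ₑ

theorem enorm_price_le_runningSup {s t : ℝ≥0} (h : s ≤ t) (ω : CadlagPath (State d F)) :
    ‖price s ω‖ₑ ≤ runningSup t ω :=
  le_iSup (fun s : Iic t => ‖price s ω‖ₑ) ⟨s, h⟩

theorem runningSup_le_iff {t : ℝ≥0} {ω : CadlagPath (State d F)} {c : ℝ≥0∞} :
    runningSup t ω ≤ c ↔ ∀ s ≤ t, ‖price s ω‖ₑ ≤ c := by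
  simp [runningSup, iSup_le_iff]

theorem runningSup_mono (ω : CadlagPath (State d F)) : Monotone fun t => runningSup t ω :=
  fun _ _ hst => runningSup_le_iff.2 fun _ hu => enorm_price_le_runningSup (hu.trans hst) ω

theorem le_runningSup_of_forall_gt {t : ℝ≥0} {ω : CadlagPath (State d F)} {c : ℝ≥0∞}
    (h : ∀ s, t < s → c ≤ runningSup s ω) : c ≤ runningSup t ω := by
  by_contra hc
  obtain ⟨b, hb, hbc⟩ := exists_between (not_le.1 hc)
  have h1 : ∀ᶠ u in 𝓝[≥] t, ‖price u ω‖ₑ < b :=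
    (rightCts_price ω t).enorm.tendsto.eventually_lt_const
      ((enorm_price_le_runningSup le_rfl ω).trans_lt hb)
  obtain ⟨u, hu, hub⟩ := (mem_nhdsGE_iff_exists_Ico_subset).1 h1
  obtain ⟨v, htv, hvu⟩ := exists_between (show t < u from hu)
  refine absurd (h v htv) (not_le.2 (lt_of_le_of_lt ?_ hbc))
  refine runningSup_le_iff.2 fun s hs => ?_
  rcases le_or_gt s t with hst | hst
  · exact (enorm_price_le_runningSup hst ω).trans hb.le
  · exact (hub ⟨hst.le, hs.trans_lt hvu⟩ : ‖price s ω‖ₑ < b).le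

open scoped Classical in
/-- The first time at which the running supremum of the norm of the price process reaches `n`. -/
def levelTime (n : ℕ) (ω : CadlagPath (State d F)) : WithTop ℝ≥0 :=
  if ∃ t, (n : ℝ≥0∞) ≤ runningSup t ω then
    ((sInf {t | (n : ℝ≥0∞) ≤ runningSup t ω} : ℝ≥0) : WithTop ℝ≥0) else ⊤

/-- The running supremum is right-continuous, so the infimum is attained. The event is thus decided
by the path up to `t`, which makes the level time a stopping time of the raw filtration even when
the level is only approached from the left. -/
theorem levelTime_le_iff {n : ℕ} {ω : CadlagPath (State d F)} {t : ℝ≥0} :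
    levelTime n ω ≤ t ↔ (n : ℝ≥0∞) ≤ runningSup t ω := by
  unfold levelTime
  split_ifs with h
  · rw [WithTop.coe_le_coe]
    refine ⟨fun hle => le_runningSup_of_forall_gt fun s hs => ?_, fun hle =>
      csInf_le (OrderBot.bddBelow _) hle⟩
    obtain ⟨u, hu, hus⟩ := exists_lt_of_csInf_lt h (hle.trans_lt hs)
    exact le_trans hu (runningSup_mono ω hus.le)
  · simp only [top_le_iff, WithTop.coe_ne_top, false_iff]
    exact fun hle => h ⟨t, hle⟩

theorem lt_levelTime_iff {n : ℕ} {ω : CadlagPath (State d F)} {t : ℝ≥0} :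
    t < levelTime n ω ↔ runningSup t ω < n := by
  rw [← not_le, levelTime_le_iff, not_le]

theorem norm_price_lt {n : ℕ} {ω : CadlagPath (State d F)} {t : ℝ≥0} (h : t < levelTime n ω) :
    ‖price t ω‖ < n := by
  have h1 := (enorm_price_le_runningSup le_rfl ω).trans_lt (lt_levelTime_iff.1 h)
  rw [enorm_eq_nnnorm, ← ENNReal.coe_natCast, ENNReal.coe_lt_coe] at h1
  exact_mod_cast h1

theorem zero_lt_levelTime_iff {n : ℕ} {ω : CadlagPath (State d F)} :
    0 < levelTime n ω ↔ ‖(ω 0).2.1‖ < n := by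
  refine ⟨fun h => norm_price_lt (t := 0) h, fun h => ?_⟩
  refine (lt_levelTime_iff (t := 0)).2 (lt_of_le_of_lt ((runningSup_le_iff (c := ‖price 0 ω‖ₑ)).2
    fun s hs => ?_) ?_)
  · rw [nonpos_iff_eq_zero.1 hs]
  · rw [enorm_eq_nnnorm, ← ENNReal.coe_natCast, ENNReal.coe_lt_coe]
    exact_mod_cast h

theorem levelTime_le_exitTime (n : ℕ) (ω : CadlagPath (State d F)) :
    levelTime n ω ≤ exitTime n ω := by
  unfold exitTime
  rw [hittingAfter_def]
  beta_reduce
  split_ifs with h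
  · have hne : {i : ℝ≥0 | 0 ≤ i ∧ price i ω ∈ {s | (n : ℝ) ≤ ‖s‖}}.Nonempty := h
    refine levelTime_le_iff.2 (le_runningSup_of_forall_gt fun s hs => ?_)
    obtain ⟨u, ⟨-, hu⟩, hus⟩ := exists_lt_of_csInf_lt hne hs
    refine le_trans ?_ (enorm_price_le_runningSup hus.le ω)
    rw [enorm_eq_nnnorm, ← ENNReal.coe_natCast, ENNReal.coe_le_coe]
    exact_mod_cast hu
  · exact le_top

theorem le_of_forall_coe_le {a b : WithTop ℝ≥0} (h : ∀ t : ℝ≥0, b ≤ t → a ≤ t) : a ≤ b := by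
  induction b with
  | top => exact le_top
  | coe b => exact h b le_rfl

theorem monotone_levelTime (ω : CadlagPath (State d F)) : Monotone fun n => levelTime n ω :=
  fun _ _ hnk => le_of_forall_coe_le fun _ ht =>
    levelTime_le_iff.2 ((Nat.cast_le.2 hnk).trans (levelTime_le_iff.1 ht))

theorem tendsto_levelTime (ω : CadlagPath (State d F)) :
    Tendsto (fun n => levelTime n ω) atTop (𝓝 ⊤) := by
  rw [WithTop.tendsto_nhds_top_iff]
  intro t
  obtain ⟨C, hC⟩ := exists_price_bound ω t
  obtain ⟨k, hk⟩ := exists_nat_gt C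
  filter_upwards [eventually_ge_atTop k] with n hn
  refine lt_levelTime_iff.2 (lt_of_le_of_lt ((runningSup_le_iff (c := C)).2 fun s hs => ?_) ?_)
  · rw [enorm_eq_nnnorm]
    exact_mod_cast hC s hs
  · rw [← ENNReal.coe_natCast, ENNReal.coe_lt_coe]
    exact hk.trans_le (Nat.cast_le.2 hn)

/-- The components of the price process stopped at the level `n`. -/
def stoppedPrice (n : ℕ) (i : Fin d) (t : ℝ≥0) (ω : CadlagPath (State d F)) : ℝ :=
  price ((min (t : WithTop ℝ≥0) (levelTime n ω)).untopD 0) ω i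

theorem stoppedPrice_eq_stopPath (n : ℕ) (i : Fin d) (t : ℝ≥0) (ω : CadlagPath (State d F)) :
    stoppedPrice n i t ω = (stopPath (levelTime n ω) ω t).2.1 i := by
  rw [stopPath_apply]
  rfl

theorem stoppedPrice_zero (n : ℕ) (i : Fin d) (ω : CadlagPath (State d F)) :
    stoppedPrice n i 0 ω = (ω 0).2.1 i := by
  unfold stoppedPrice
  rw [min_eq_left (by simp)]
  rfl

theorem continuous_coord (i : Fin d) :
    Continuous fun x : State d F => x.2.1 i :=
  (EuclideanSpace.proj (𝕜 := ℝ) i).continuous.comp (continuous_fst.comp continuous_snd)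

theorem rightCts_stoppedPrice (n : ℕ) (i : Fin d) (ω : CadlagPath (State d F)) (t : ℝ≥0) :
    ContinuousWithinAt (fun s => stoppedPrice n i s ω) (Ici t) t := by
  simp only [stoppedPrice_eq_stopPath]
  exact (continuous_coord i).continuousAt.comp_continuousWithinAt
    ((stopPath (levelTime n ω) ω).rightCts t)

/-- Times before `t` are approximated from the right by rationals below `t`. The endpoint is added
separately, since approximating it would look beyond `t` and destroy adaptedness. -/
theorem runningSup_eq (t : ℝ≥0) (ω : CadlagPath (State d F)) :
    runningSup t ω = (⨆ q : ℚ≥0, if (q : ℝ≥0) ≤ t then ‖price q ω‖ₑ else 0) ⊔ ‖price t ω‖ₑ := by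
  refine le_antisymm (runningSup_le_iff.2 fun s hs => ?_) (sup_le (iSup_le fun q => ?_)
    (enorm_price_le_runningSup le_rfl ω))
  · rcases hs.eq_or_lt with rfl | hs
    · exact le_sup_right
    · refine le_sup_of_le_left ?_
      refine le_of_tendsto ((rightCts_price ω s).enorm.tendsto.comp (tendsto_gridAbove s)) ?_
      have h1 := ((tendsto_gridAbove s).mono_right nhdsWithin_le_nhds).eventually_lt_const hs
      filter_upwards [h1] with k hk
      obtain ⟨q, hq⟩ := exists_nnrat_eq_gridAbove k s
      rw [hq] at hk
      refine le_trans ?_ (le_iSup _ q)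
      rw [if_pos hk.le]
      simp only [Function.comp, hq]
      exact le_rfl
  · split_ifs with h
    · exact enorm_price_le_runningSup h ω
    · exact zero_le

variable [MeasurableSpace F]

theorem measurable_price {s t : ℝ≥0} (h : s ≤ t) :
    Measurable[rawFiltration (State d F) t] (price s : CadlagPath (State d F) → _) :=
  (measurable_fst.comp measurable_snd).comp (measurable_coordinate_rawFiltration h)

theorem measurable_runningSup (t : ℝ≥0) :
    Measurable[rawFiltration (State d F) t] (runningSup t : CadlagPath (State d F) → ℝ≥0∞) := by
  have h : (runningSup t : CadlagPath (State d F) → ℝ≥0∞) = fun ω =>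
      (⨆ q : ℚ≥0, if (q : ℝ≥0) ≤ t then ‖price q ω‖ₑ else 0) ⊔ ‖price t ω‖ₑ :=
    funext (runningSup_eq t)
  rw [h]
  refine Measurable.sup ?_ (measurable_enorm.comp (measurable_price le_rfl))
  refine Measurable.iSup fun q => ?_
  split_ifs with hq
  · exact measurable_enorm.comp (measurable_price hq)
  · exact measurable_const

theorem isStoppingTime_levelTime (n : ℕ) :
    IsStoppingTime (rawFiltration (State d F)) (levelTime n) := fun t => by
  simp only [levelTime_le_iff]
  exact measurable_runningSup t measurableSet_Ici

variable [SecondCountableTopology F] [BorelSpace F] [TopologicalSpace.PseudoMetrizableSpace F]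

theorem measurable_stoppedPrice (n : ℕ) (i : Fin d) (t : ℝ≥0) :
    Measurable[rawFiltration (State d F) t]
      (stoppedPrice n i t : CadlagPath (State d F) → ℝ) := by
  have h1 : Measurable[rawFiltration (State d F) t] fun ω : CadlagPath (State d F) =>
      (min (levelTime n ω) (t : WithTop ℝ≥0)).untopD 0 :=
    (((isStoppingTime_levelTime n).min_const t).measurable_of_le
      fun _ => min_le_right _ _).untopD 0
  have h2 := (measurable_eval_min (E := State d F) t).comp
    (h1.prodMk (@measurable_id _ (rawFiltration (State d F) t)))
  have h3 : (stoppedPrice n i t : CadlagPath (State d F) → ℝ) = fun ω =>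
      (ω (min ((min (levelTime n ω) (t : WithTop ℝ≥0)).untopD 0) t)).2.1 i := by
    ext ω
    have : (min (levelTime n ω) (t : WithTop ℝ≥0)).untopD 0 ≤ t :=
      WithTop.untopD_le (min_le_right _ _)
    rw [min_eq_left this, min_comm]
    rfl
  rw [h3]
  exact (continuous_coord i).measurable.comp h2

end Level

/-! ### Local martingales and level times -/

section General

variable {Ω : Type*} {m : MeasurableSpace Ω} {μ : Measure Ω} {G : Filtration ℝ≥0 m}

theorem Martingale.continuousLinearMap_comp {V W : Type*} [NormedAddCommGroup V] [NormedSpace ℝ V]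
    [CompleteSpace V] [NormedAddCommGroup W] [NormedSpace ℝ W] [CompleteSpace W]
    {f : ℝ≥0 → Ω → V} (hf : Martingale f G μ) (T : V →L[ℝ] W) :
    Martingale (fun t ω => T (f t ω)) G μ := by
  refine ⟨fun t => T.continuous.comp_stronglyMeasurable (hf.1 t), fun s t hst => ?_⟩
  refine (T.comp_condExp_comm (hf.integrable t)).symm.trans ?_
  filter_upwards [hf.2 s t hst] with ω hω
  rw [Function.comp_apply, hω]

theorem martingale_of_setIntegral_eq [IsFiniteMeasure μ] {V : Type*} [NormedAddCommGroup V]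
    [NormedSpace ℝ V] [CompleteSpace V] {f : ℝ≥0 → Ω → V} (hf : StronglyAdapted G f)
    (hint : ∀ t, Integrable (f t) μ)
    (h : ∀ s t, s ≤ t → ∀ A, MeasurableSet[G s] A → ∫ ω in A, f s ω ∂μ = ∫ ω in A, f t ω ∂μ) :
    Martingale f G μ :=
  ⟨hf, fun s t hst => (ae_eq_condExp_of_forall_setIntegral_eq (G.le s) (hint t)
    (fun _ _ _ => (hint s).integrableOn) (fun A hA _ => h s t hst A hA)
    (hf s).aestronglyMeasurable).symm⟩

theorem coe_untopD_min (t : ℝ≥0) (σ : WithTop ℝ≥0) :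
    (((min (t : WithTop ℝ≥0) σ).untopD 0 : ℝ≥0) : WithTop ℝ≥0) = min (t : WithTop ℝ≥0) σ := by
  have h : min (t : WithTop ℝ≥0) σ ≠ ⊤ := ((min_le_left _ _).trans_lt (WithTop.coe_lt_top t)).ne
  lift min (t : WithTop ℝ≥0) σ to ℝ≥0 using h with u
  rfl

theorem untopA_min (t : ℝ≥0) (σ : WithTop ℝ≥0) :
    (min (t : WithTop ℝ≥0) σ).untopA = (min (t : WithTop ℝ≥0) σ).untopD 0 := by
  rw [← coe_untopD_min]
  rfl

end General

section LocalMartingale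

variable {d : ℕ} {F : Type*} [TopologicalSpace F] [MeasurableSpace F]
  {P : Kernel (State d F) (CadlagPath (State d F))}

theorem UniformlyLocallyBoundedBelow.exists_le_price (hBelow : UniformlyLocallyBoundedBelow P)
    (n : ℕ) : ∃ a : ℝ, ∀ x : State d F, ‖x.2.1‖ < n → ∀ᵐ ω ∂P x, ∀ s : ℝ≥0,
      s ≤ levelTime n ω → ∀ i, a ≤ price s ω i := by
  obtain ⟨a, ha⟩ := hBelow n
  refine ⟨a, fun x hx => ?_⟩
  filter_upwards [ha x hx] with ω hω s hs i
  have h := hω s i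
  unfold stoppedProcess at h
  rwa [min_eq_left (hs.trans (levelTime_le_exitTime n ω))] at h

variable [SecondCountableTopology F] [BorelSpace F] [TopologicalSpace.PseudoMetrizableSpace F]

/-- Under an equivalent local martingale measure, the components of the price process stopped at
a level are martingales. -/
theorem martingale_stoppedPrice (hBelow : UniformlyLocallyBoundedBelow P) {x : State d F}
    (hstart : ∀ᵐ ω ∂P x, ω 0 = x) {Q : Measure (CadlagPath (State d F))}
    (hQ : Q ∈ martingaleMeasures P x) {n : ℕ} (hn : ‖x.2.1‖ < n) (i : Fin d) :
    Martingale (stoppedPrice n i) (rawFiltration (State d F)) Q := by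
  obtain ⟨hprob, hQP, -, σ, hσ, hK⟩ := hQ
  obtain ⟨a, ha⟩ := hBelow.exists_le_price n
  have ha := hQP.ae_le (ha x hn)
  have hstart := hQP.ae_le hstart
  set G := rawFiltration (State d F) with hG
  -- `σ` is the localising sequence given for `Q`; by the definition of localisation the process is
  -- set to zero where `σ k` is `0`.
  set N : ℕ → ℝ≥0 → CadlagPath (State d F) → ℝ := fun k t ω =>
    stoppedProcess (fun j => {ω | ⊥ < σ k ω}.indicator (price j)) (σ k) t ω i with hN
  have hNmart : ∀ k, Martingale (N k) G Q := fun k =>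
    Martingale.continuousLinearMap_comp (hK k) (EuclideanSpace.proj (𝕜 := ℝ) i)
  have hNeq : ∀ k t ω, N k t ω =
      if ⊥ < σ k ω then (stopPath (σ k ω) ω t).2.1 i else 0 := by
    intro k t ω
    simp only [hN, stoppedProcess, untopA_min, stopPath_apply]
    split_ifs with h
    · rw [indicator_of_mem (by exact h)]
      rfl
    · rw [indicator_of_notMem (by exact h)]
      rfl
  have hNc : ∀ k ω t, ContinuousWithinAt (fun s => N k s ω) (Ici t) t := by
    intro k ω t
    simp only [hNeq]
    split_ifs with h
    · exact (continuous_coord i).continuousAt.comp_continuousWithinAt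
        ((stopPath (σ k ω) ω).rightCts t)
    · exact continuousWithinAt_const
  have hρ : IsStoppingTime G.rightCont (levelTime n) := fun t =>
    G.le_rightCont t _ (isStoppingTime_levelTime n t)
  set V : ℕ → ℝ≥0 → CadlagPath (State d F) → ℝ := fun k t ω =>
    N k ((min (t : WithTop ℝ≥0) (levelTime n ω)).untopD 0) ω with hV
  have hVint : ∀ k t, Integrable (V k t) Q := fun k t =>
    integrable_stopped (hNmart k) (hNc k) hρ t
  have hVset : ∀ k s t, s ≤ t → ∀ A, MeasurableSet[G s] A →
      ∫ ω in A, V k t ω ∂Q = ∫ ω in A, V k s ω ∂Q := fun k s t hst A hA =>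
    setIntegral_stopped (hNmart k) (hNc k) hρ hst hA
  have hVeq : ∀ k t ω, V k t ω = if ⊥ < σ k ω then
      price ((min (((min (t : WithTop ℝ≥0) (levelTime n ω)).untopD 0 : ℝ≥0) : WithTop ℝ≥0)
        (σ k ω)).untopD 0) ω i else 0 := by
    intro k t ω
    simp only [hV, hNeq, stopPath_apply]
    rfl
  have hlow : ∀ k t, ∀ᵐ ω ∂Q, min a 0 ≤ V k t ω := by
    intro k t
    filter_upwards [ha] with ω hω
    rw [hVeq]
    split_ifs with h
    · refine (min_le_left _ _).trans (hω _ ?_ i)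
      rw [coe_untopD_min, coe_untopD_min]
      exact (min_le_left _ _).trans (min_le_right _ _)
    · exact min_le_right _ _
  -- Either `σ k` is not the first of the three times, and `V` is the stopped price (or zero by
  -- localisation), or `σ k` comes strictly before the level time, where the price has norm below
  -- `n`. So the limit itself dominates the sequence, once it is known to be integrable.
  have hbound : ∀ k t ω, ‖V k t ω‖ ≤ n + ‖stoppedPrice n i t ω‖ := by
    intro k t ω
    rw [hVeq]
    split_ifs with h
    · rcases le_or_gt (min (t : WithTop ℝ≥0) (levelTime n ω)) (σ k ω) with h1 | h1
      · rw [coe_untopD_min, min_eq_left h1]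
        exact le_add_of_nonneg_left (Nat.cast_nonneg n)
      · refine le_add_of_le_of_nonneg ?_ (norm_nonneg _)
        have h2 : (((min (((min (t : WithTop ℝ≥0) (levelTime n ω)).untopD 0 : ℝ≥0) : WithTop ℝ≥0)
            (σ k ω)).untopD 0 : ℝ≥0) : WithTop ℝ≥0) < levelTime n ω := by
          rw [coe_untopD_min, coe_untopD_min, min_eq_right h1.le]
          exact h1.trans_le (min_le_right _ _)
        exact (PiLp.norm_apply_le _ i).trans (norm_price_lt h2).le
    · rw [norm_zero]
      positivity
  have hlim : ∀ t, ∀ᵐ ω ∂Q, Tendsto (fun k => V k t ω) atTop (𝓝 (stoppedPrice n i t ω)) := by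
    intro t
    filter_upwards [hσ.tendsto_top] with ω hω
    refine tendsto_const_nhds.congr' ?_
    filter_upwards [(WithTop.tendsto_nhds_top_iff _).1 hω t] with k hk
    rw [hVeq, if_pos (bot_le.trans_lt hk), coe_untopD_min,
      min_eq_left ((min_le_left _ _).trans hk.le)]
    rfl
  have hMm : ∀ t, StronglyMeasurable[G t] (stoppedPrice n i t : CadlagPath (State d F) → ℝ) :=
    fun t => (measurable_stoppedPrice n i t).stronglyMeasurable
  have hMm' : ∀ t, StronglyMeasurable (stoppedPrice n i t : CadlagPath (State d F) → ℝ) :=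
    fun t => (hMm t).mono (G.le t)
  have hVle : ∀ k t, ∫ ω, V k t ω ∂Q ≤ n := by
    intro k t
    rw [← setIntegral_univ, hVset k 0 t zero_le univ MeasurableSet.univ, setIntegral_univ]
    refine (integral_mono_ae (hVint k 0) (integrable_const (n : ℝ)) ?_).trans_eq (by simp)
    filter_upwards [hstart] with ω hω
    refine (le_abs_self _).trans ?_
    rw [hVeq]
    split_ifs with h
    · have : (min (((min ((0 : ℝ≥0) : WithTop ℝ≥0) (levelTime n ω)).untopD 0 : ℝ≥0) :
          WithTop ℝ≥0)
          (σ k ω)).untopD 0 = 0 := by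
        refine nonpos_iff_eq_zero.1 (WithTop.untopD_le ?_)
        rw [coe_untopD_min]
        exact (min_le_left _ _).trans (min_le_left _ _)
      rw [this]
      rw [← Real.norm_eq_abs]
      refine (PiLp.norm_apply_le _ i).trans ?_
      unfold price
      rw [hω]
      exact hn.le
    · simp
  -- The price may jump upwards without bound at the level time, so integrability is not automatic.
  -- It follows from Fatou's lemma, the common lower bound `min a 0` and the bound `n` on the
  -- expectations of `V`.
  have hMint : ∀ t, Integrable (stoppedPrice n i t) Q := by
    intro t
    have h1 : Integrable (fun ω => stoppedPrice n i t ω - min a 0) Q := by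
      refine ⟨((hMm' t).sub stronglyMeasurable_const).aestronglyMeasurable, ?_⟩
      have h2 : ∫⁻ ω, ‖stoppedPrice n i t ω - min a 0‖ₑ ∂Q =
          ∫⁻ ω, liminf (fun k => ‖V k t ω - min a 0‖ₑ) atTop ∂Q := by
        refine lintegral_congr_ae ?_
        filter_upwards [hlim t] with ω hω
        exact (hω.sub_const _).enorm.liminf_eq.symm
      change ∫⁻ ω, ‖stoppedPrice n i t ω - min a 0‖ₑ ∂Q < ∞
      rw [h2]
      refine lt_of_le_of_lt (lintegral_liminf_le' fun k =>
        ((hVint k t).sub (integrable_const _)).aestronglyMeasurable.enorm) ?_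
      refine lt_of_le_of_lt (b := ENNReal.ofReal (n - min a 0)) ?_ ENNReal.ofReal_lt_top
      refine liminf_le_of_frequently_le' (Frequently.of_forall fun k => ?_)
      have h2 : ∫⁻ ω, ‖V k t ω - min a 0‖ₑ ∂Q = ∫⁻ ω, ENNReal.ofReal (V k t ω - min a 0) ∂Q := by
        refine lintegral_congr_ae ?_
        filter_upwards [hlow k t] with ω hω
        exact Real.enorm_of_nonneg (sub_nonneg.2 hω)
      rw [h2, ← ofReal_integral_eq_lintegral_ofReal
        (f := fun ω => V k t ω - min a 0) ((hVint k t).sub (integrable_const _))]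
      · refine ENNReal.ofReal_le_ofReal ?_
        rw [integral_sub (hVint k t) (integrable_const _)]
        simpa using hVle k t
      · filter_upwards [hlow k t] with ω hω
        exact sub_nonneg.2 hω
    exact (h1.add (integrable_const (min a 0))).congr
      (Eventually.of_forall fun ω => sub_add_cancel _ _)
  refine martingale_of_setIntegral_eq hMm hMint fun s t hst A hA => ?_
  have hL : ∀ u, Tendsto (fun k => ∫ ω in A, V k u ω ∂Q) atTop
      (𝓝 (∫ ω in A, stoppedPrice n i u ω ∂Q)) := fun u =>
    tendsto_integral_of_dominated_convergence (fun ω => n + ‖stoppedPrice n i u ω‖)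
      (fun k => (hVint k u).aestronglyMeasurable.restrict)
      ((integrable_const _).add (hMint u).norm).integrableOn
      (fun k => Eventually.of_forall (hbound k u)) (ae_restrict_of_ae (hlim u))
  exact tendsto_nhds_unique (hL s) ((hL t).congr fun k => hVset k s t hst A hA)

/-- Conversely, if the components of the price process stopped at all levels above the initial one
are martingales, then the price process is a local martingale. -/
theorem locally_martingale_of_stoppedPrice {Q : Measure (CadlagPath (State d F))}
    [IsProbabilityMeasure Q] {x : State d F} (hstart : ∀ᵐ ω ∂Q, ω 0 = x)
    (h : ∀ n : ℕ, ‖x.2.1‖ < n → ∀ i : Fin d,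
      Martingale (stoppedPrice n i) (rawFiltration (State d F)) Q) :
    Locally (fun Y => Martingale Y (rawFiltration (State d F)) Q)
      (rawFiltration (State d F)) price Q := by
  refine ⟨levelTime, ⟨⟨isStoppingTime_levelTime, Eventually.of_forall tendsto_levelTime⟩,
    Eventually.of_forall monotone_levelTime⟩, fun n => ?_⟩
  set Y := stoppedProcess (fun j => {ω : CadlagPath (State d F) | ⊥ < levelTime n ω}.indicator
    (price j)) (levelTime n) with hY
  have hYeq : ∀ t ω i, Y t ω i =
      {ω : CadlagPath (State d F) | ⊥ < levelTime n ω}.indicator (stoppedPrice n i t) ω := by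
    intro t ω i
    simp only [hY, stoppedProcess, untopA_min]
    by_cases hω : ω ∈ {ω : CadlagPath (State d F) | ⊥ < levelTime n ω}
    · rw [indicator_of_mem hω, indicator_of_mem hω]
      rfl
    · rw [indicator_of_notMem hω, indicator_of_notMem hω]
      rfl
  have hpos : ∀ t, MeasurableSet[rawFiltration (State d F) t]
      {ω : CadlagPath (State d F) | ⊥ < levelTime n ω} := fun t =>
    (rawFiltration (State d F)).mono zero_le _ ((isStoppingTime_levelTime n).measurableSet_gt 0)
  have hYm : StronglyAdapted (rawFiltration (State d F)) Y := by
    intro t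
    refine Measurable.stronglyMeasurable ?_
    refine (WithLp.measurable_toLp 2 (Fin d → ℝ)).comp
      (@measurable_pi_lambda _ _ _ (rawFiltration (State d F) t) _ (fun ω i => Y t ω i) fun i => ?_)
    have : (fun ω => Y t ω i) = _ := funext fun ω => hYeq t ω i
    change Measurable[rawFiltration (State d F) t] fun ω => Y t ω i
    rw [this]
    exact (measurable_stoppedPrice n i t).indicator (hpos t)
  have hcase : ∀ i, (∀ t, Integrable (fun ω => Y t ω i) Q) ∧
      ∀ s t, s ≤ t → ∀ A, MeasurableSet[rawFiltration (State d F) s] A →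
        ∫ ω in A, Y s ω i ∂Q = ∫ ω in A, Y t ω i ∂Q := by
    intro i
    -- If the initial price is below the level, the level time is positive and the indicator is `1`;
    -- otherwise the level time is `0` and the localised process vanishes.
    by_cases hx : ‖x.2.1‖ < n
    · have hae : ∀ t, (fun ω => Y t ω i) =ᵐ[Q] stoppedPrice n i t := fun t => by
        filter_upwards [hstart] with ω hω
        rw [hYeq, indicator_of_mem]
        exact zero_lt_levelTime_iff.2 (by rwa [hω])
      have hM := h n hx i
      refine ⟨fun t => (hM.integrable t).congr (hae t).symm, fun s t hst A hA => ?_⟩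
      rw [setIntegral_congr_ae ((rawFiltration _).le s A hA) ((hae s).mono fun _ h _ => h),
        setIntegral_congr_ae ((rawFiltration _).le s A hA) ((hae t).mono fun _ h _ => h)]
      exact hM.setIntegral_eq hst hA
    · have hae : ∀ t, (fun ω => Y t ω i) =ᵐ[Q] fun _ => 0 := fun t => by
        filter_upwards [hstart] with ω hω
        rw [hYeq, indicator_of_notMem]
        exact fun h' => hx (by rw [← hω]; exact zero_lt_levelTime_iff.1 h')
      refine ⟨fun t => (integrable_zero _ _ _).congr (hae t).symm, fun s t hst A hA => ?_⟩
      rw [setIntegral_congr_ae ((rawFiltration _).le s A hA) ((hae s).mono fun _ h _ => h),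
        setIntegral_congr_ae ((rawFiltration _).le s A hA) ((hae t).mono fun _ h _ => h)]
  have hYint : ∀ t, Integrable (Y t) Q := fun t => Integrable.of_eval_piLp fun i => (hcase i).1 t
  refine martingale_of_setIntegral_eq hYm hYint fun s t hst A hA => ?_
  ext i
  have hcomm : ∀ u, (∫ ω in A, Y u ω ∂Q) i = ∫ ω in A, Y u ω i ∂Q := fun u =>
    ((EuclideanSpace.proj (𝕜 := ℝ) i).integral_comp_comm (hYint u).integrableOn).symm
  rw [hcomm, hcomm]
  exact (hcase i).2 s t hst A hA

end LocalMartingale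

/-! ### Pasting of laws -/

section Bind

variable {Ω Ω' D : Type*} [MeasurableSpace Ω] [MeasurableSpace Ω'] [MeasurableSpace D]
  {μ : Measure Ω} {L : Kernel Ω Ω'} [IsSFiniteKernel L] {g : Ω × Ω' → D}

theorem measurable_map_kernel (hg : Measurable g) :
    Measurable fun ω => (L ω).map fun ω' => g (ω, ω') := by
  refine Measure.measurable_of_measurable_coe _ fun A hA => ?_
  have h : ∀ ω, ((L ω).map fun ω' => g (ω, ω')) A = L ω (Prod.mk ω ⁻¹' (g ⁻¹' A)) := fun ω => by
    exact Measure.map_apply (hg.comp measurable_prodMk_left) hA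
  simp only [h]
  exact Kernel.measurable_kernel_prodMk_left (hg hA)

theorem lintegral_bind_map (hg : Measurable g) {G : D → ℝ≥0∞} (hG : Measurable G) :
    ∫⁻ y, G y ∂(μ.bind fun ω => (L ω).map fun ω' => g (ω, ω')) =
      ∫⁻ ω, ∫⁻ ω', G (g (ω, ω')) ∂L ω ∂μ := by
  rw [Measure.lintegral_bind (measurable_map_kernel hg).aemeasurable hG.aemeasurable]
  exact lintegral_congr fun ω => lintegral_map hG (hg.comp measurable_prodMk_left)

end Bind

section Paste

variable {E : Type*} [TopologicalSpace E] [MeasurableSpace E]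
  [TopologicalSpace.PseudoMetrizableSpace E] [BorelSpace E]

theorem measurable_splice_pair {τ : CadlagPath E → WithTop ℝ≥0} (hτ : Measurable τ) :
    Measurable fun q : CadlagPath E × CadlagPath E => splice q.1 (τ q.1) q.2 :=
  measurable_fst.splice (hτ.comp measurable_fst) measurable_snd

theorem lintegral_pasteLaw {μ : Measure (CadlagPath E)}
    {L : Kernel (CadlagPath E) (CadlagPath E)} [IsSFiniteKernel L]
    {τ : CadlagPath E → WithTop ℝ≥0} (hτ : Measurable τ) {G : CadlagPath E → ℝ≥0∞}
    (hG : Measurable G) :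
    ∫⁻ y, G y ∂pasteLaw μ τ L = ∫⁻ ω, ∫⁻ ω', G (splice ω (τ ω) ω') ∂L ω ∂μ :=
  lintegral_bind_map (measurable_splice_pair hτ) hG

theorem isProbabilityMeasure_pasteLaw {μ : Measure (CadlagPath E)} [IsProbabilityMeasure μ]
    {L : Kernel (CadlagPath E) (CadlagPath E)} [IsMarkovKernel L]
    {τ : CadlagPath E → WithTop ℝ≥0} (hτ : Measurable τ) :
    IsProbabilityMeasure (pasteLaw μ τ L) := by
  refine ⟨?_⟩
  have h := lintegral_pasteLaw (μ := μ) (L := L) hτ (measurable_const (a := (1 : ℝ≥0∞)))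
  simpa using h

omit [TopologicalSpace.PseudoMetrizableSpace E] [BorelSpace E] in
theorem pasteLaw_congr {μ : Measure (CadlagPath E)} {τ τ' : CadlagPath E → WithTop ℝ≥0}
    {k k' : CadlagPath E → Measure (CadlagPath E)} (hτ : τ =ᵐ[μ] τ') (hk : k =ᵐ[μ] k') :
    pasteLaw μ τ k = pasteLaw μ τ' k' := by
  refine Measure.bind_congr_right ?_
  filter_upwards [hτ, hk] with ω h1 h2
  rw [h1, h2]

/-- A set is null for a pasted law exactly when its fibre is null for the law of the future, for
almost every past. Domination of pasts and of futures therefore combine. -/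
theorem absolutelyContinuous_pasteLaw {μ μ' : Measure (CadlagPath E)} (hμ : μ ≪ μ')
    {L L' : Kernel (CadlagPath E) (CadlagPath E)} [IsSFiniteKernel L] [IsSFiniteKernel L']
    (hL : ∀ᵐ ω ∂μ, L ω ≪ L' ω) {τ : CadlagPath E → WithTop ℝ≥0} (hτ : Measurable τ) :
    pasteLaw μ τ L ≪ pasteLaw μ' τ L' := by
  refine Measure.AbsolutelyContinuous.mk fun A hA h0 => ?_
  have hG : Measurable (A.indicator (1 : CadlagPath E → ℝ≥0∞)) := measurable_one.indicator hA
  have hGp : Measurable fun q : CadlagPath E × CadlagPath E =>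
      A.indicator (1 : CadlagPath E → ℝ≥0∞) (splice q.1 (τ q.1) q.2) :=
    hG.comp (measurable_splice_pair hτ)
  rw [← lintegral_indicator_one hA, lintegral_pasteLaw hτ hG,
    lintegral_eq_zero_iff hGp.lintegral_kernel_prod_right'] at h0 ⊢
  filter_upwards [hμ.ae_le h0, hL] with ω h1 h2
  have hGω : Measurable fun ω' => A.indicator (1 : CadlagPath E → ℝ≥0∞) (splice ω (τ ω) ω') :=
    hGp.comp measurable_prodMk_left
  have h1 : ∫⁻ ω', A.indicator (1 : CadlagPath E → ℝ≥0∞) (splice ω (τ ω) ω') ∂L' ω = 0 := h1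
  change ∫⁻ ω', A.indicator (1 : CadlagPath E → ℝ≥0∞) (splice ω (τ ω) ω') ∂L ω = 0
  rw [lintegral_eq_zero_iff hGω] at h1 ⊢
  exact h2.ae_le h1

variable {P : Kernel E (CadlagPath E)} [IsMarkovKernel P] (hP : IsCanonicalStrongMarkov P)
  {τ : CadlagPath E → WithTop ℝ≥0} (hτ : IsStoppingTime (pathFiltration E) τ)

include hP in
/-- The strong Markov property for functionals of the past and the future of `τ`. -/
theorem lintegral_strongMarkov_of_eq (x : E) {A : Type*} [MeasurableSpace A]
    [MeasurableSpace.CountablyGenerated A] {U : CadlagPath E → A}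
    (hU : Measurable[nullExt (P x) hτ.measurableSpace] U) {Ψ : A × CadlagPath E → ℝ≥0∞}
    (hΨ : Measurable Ψ) {Φ : CadlagPath E → ℝ≥0∞} {Ψ₀ : CadlagPath E → CadlagPath E → ℝ≥0∞}
    (hΦ : ∀ ω, τ ω ≠ ⊤ → Φ ω = Ψ (U ω, shift ((τ ω).untopD 0) ω))
    (hΨ₀ : ∀ ω ω', τ ω ≠ ⊤ → Ψ₀ ω ω' = Ψ (U ω, ω')) (htop : ∀ ω ω', τ ω = ⊤ → Ψ₀ ω ω' = Φ ω) :
    ∫⁻ ω, Φ ω ∂P x = ∫⁻ ω, ∫⁻ ω', Ψ₀ ω ω' ∂P (evalAt (τ ω) ω) ∂P x := by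
  have hm : MeasurableSet {ω | τ ω ≠ ⊤} :=
    hτ.measurable' (measurableSet_singleton (⊤ : WithTop ℝ≥0)).compl
  rw [← lintegral_add_compl _ hm, ← lintegral_add_compl (fun ω => ∫⁻ ω', Ψ₀ ω ω' ∂P _) hm]
  congr 1
  · rw [setLIntegral_congr_fun hm fun ω hω => hΦ ω hω, lintegral_strongMarkov hP hτ x hU hΨ]
    exact setLIntegral_congr_fun hm fun ω hω => lintegral_congr fun ω' => (hΨ₀ ω ω' hω).symm
  · refine setLIntegral_congr_fun hm.compl fun ω hω => ?_
    have hω : τ ω = ⊤ := by simpa using hω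
    simp [htop ω _ hω]

/-- The past of the pair of a path and its density up to `τ`, together with `τ`. -/
def pastPair (ζ : CadlagPath E → CadlagPath ℝ≥0) (τ : CadlagPath E → WithTop ℝ≥0)
    (ω : CadlagPath E) : CadlagPath (E × ℝ≥0) × WithTop ℝ≥0 :=
  (stopPath (τ ω) (augment 1 ω (ζ ω)), τ ω)

/-- The state at `τ`, weighted by `z`, as a function of the past. -/
def endState (z : ℝ≥0) (u : CadlagPath (E × ℝ≥0) × WithTop ℝ≥0) : E × ℝ≥0 :=
  ((evalAt u.2 u.1).1, z * (evalAt u.2 u.1).2)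

omit [MeasurableSpace E] [TopologicalSpace.PseudoMetrizableSpace E] [BorelSpace E] in
theorem endState_pastPair (z : ℝ≥0) (ζ : CadlagPath E → CadlagPath ℝ≥0) (ω : CadlagPath E) :
    endState z (pastPair ζ τ ω) = evalAt (τ ω) (augment z ω (ζ ω)) := by
  simp only [endState, pastPair, evalAt_stopPath]
  simp only [evalAt, augment, one_mul]

omit [MeasurableSpace E] [TopologicalSpace.PseudoMetrizableSpace E] [BorelSpace E] in
theorem fst_pastPair (ζ : CadlagPath E → CadlagPath ℝ≥0) (ω : CadlagPath E) :
    (pastPair ζ τ ω).1.fst = stopPath (τ ω) ω := by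
  refine CadlagPath.ext fun t => ?_
  rw [stopPath_apply]
  change ((stopPath (τ ω) (augment 1 ω (ζ ω))) t).1 = _
  rw [stopPath_apply]
  rfl

omit [TopologicalSpace.PseudoMetrizableSpace E] [BorelSpace E] [IsMarkovKernel P] in
theorem IsDensityProcess.measurable_nullExt {x : E} {Q : Measure (CadlagPath E)}
    {ζ : CadlagPath E → CadlagPath ℝ≥0} (hζ : IsDensityProcess (P x) Q ζ) (t : ℝ≥0) :
    Measurable[nullExt (P x) (pathFiltration E t)] fun ω => ζ ω t := by
  have h1 : Measurable[pathFiltration E t] fun ω =>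
      (((P x)[fun ω => (Q.rnDeriv (P x) ω).toReal | pathFiltration E t]) ω).toNNReal :=
    stronglyMeasurable_condExp.measurable.real_toNNReal
  refine Measurable.eventuallyMeasurable_of_eventuallyEq (l := ae (P x)) h1 ?_
  filter_upwards [hζ.version t] with ω hω
  rw [← hω, Real.toNNReal_coe]

omit [TopologicalSpace.PseudoMetrizableSpace E] [BorelSpace E] [IsMarkovKernel P] in
theorem IsDensityProcess.measurable_augment_nullExt {x : E} {Q : Measure (CadlagPath E)}
    {ζ : CadlagPath E → CadlagPath ℝ≥0} (hζ : IsDensityProcess (P x) Q ζ) (z : ℝ≥0)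
    {s t : ℝ≥0} (hst : s ≤ t) :
    Measurable[nullExt (P x) (pathFiltration E t)] fun ω => augment z ω (ζ ω) s := by
  refine Measurable.prodMk ?_ ?_
  · exact (measurable_coordinate_rawFiltration hst).mono
      ((rawFiltration_le_pathFiltration t).trans le_eventuallyMeasurableSpace) le_rfl
  · exact ((hζ.measurable_nullExt s).mono (nullExt_mono ((pathFiltration E).mono hst))
      le_rfl).const_mul z

-- The path is adapted exactly and its density only up to null sets, so the pair lies in the
-- completed past of `τ`. This is what forces the strong Markov property to be stated with
-- `nullExt`.
omit [IsMarkovKernel P] in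
theorem IsDensityProcess.measurable_pastPair {x : E} {Q : Measure (CadlagPath E)}
    {ζ : CadlagPath E → CadlagPath ℝ≥0} (hζ : IsDensityProcess (P x) Q ζ) :
    Measurable[nullExt (P x) hτ.measurableSpace] (pastPair ζ τ) := by
  refine Measurable.prodMk ?_ (hτ.measurable.mono le_eventuallyMeasurableSpace le_rfl)
  refine measurable_path_iff.2 fun t => ?_
  simp only [stopPath_apply]
  exact measurable_nullExt_stopped (Y := fun s ω => augment 1 ω (ζ ω) s)
    (fun s => hζ.measurable_augment_nullExt 1 le_rfl)
    (fun ω s => (augment 1 ω (ζ ω)).rightCts s) hτ t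

omit [TopologicalSpace.PseudoMetrizableSpace E] [BorelSpace E] [IsMarkovKernel P] in
/-- A stopping time of the augmented path is almost surely a stopping time. -/
theorem IsDensityProcess.exists_isStoppingTime {x : E} {Q : Measure (CadlagPath E)}
    {ζ : CadlagPath E → CadlagPath ℝ≥0} (hζ : IsDensityProcess (P x) Q ζ) (z : ℝ≥0)
    {σ : CadlagPath (E × ℝ≥0) → WithTop ℝ≥0}
    (hσ : IsStoppingTime (pathFiltration (E × ℝ≥0)) σ) :
    ∃ τ, IsStoppingTime (pathFiltration E) τ ∧
      τ =ᵐ[P x] fun ω => σ (augment z ω (ζ ω)) := by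
  refine exists_isStoppingTime_ae_eq fun t => ?_
  have h : Measurable[nullExt (P x) (pathFiltration E t), rawFiltration (E × ℝ≥0) t]
      fun ω => augment z ω (ζ ω) :=
    measurable_rawFiltration_iff.2 fun s hs => hζ.measurable_augment_nullExt z hs
  exact h (measurableSet_lt_of_rightCont hσ t)

theorem measurable_endState (z : ℝ≥0) :
    Measurable (endState z : CadlagPath (E × ℝ≥0) × WithTop ℝ≥0 → E × ℝ≥0) :=
  (measurable_fst.evalAt measurable_snd).fst.prodMk
    ((measurable_fst.evalAt measurable_snd).snd.const_mul z)

/-- The second component of a path in a product. -/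
def CadlagPath.snd {E G : Type*} [TopologicalSpace E] [TopologicalSpace G]
    (ω : CadlagPath (E × G)) : CadlagPath G where
  toFun := fun t => (ω t).2
  rightCts := fun t => continuous_snd.continuousAt.comp_continuousWithinAt (ω.rightCts t)
  leftLim := fun t => by
    obtain ⟨l, hl⟩ := ω.leftLim t
    exact ⟨l.2, (continuous_snd.tendsto l).comp hl⟩

theorem CadlagPath.measurable_snd {E G : Type*} [TopologicalSpace E] [TopologicalSpace G]
    [MeasurableSpace E] [MeasurableSpace G] :
    Measurable (CadlagPath.snd : CadlagPath (E × G) → CadlagPath G) :=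
  measurable_path_iff.2 fun t => Measurable.snd (measurable_coordinate t)

omit [MeasurableSpace E] [TopologicalSpace.PseudoMetrizableSpace E] [BorelSpace E] in
theorem augment_pastPair (z : ℝ≥0) (ζ : CadlagPath E → CadlagPath ℝ≥0) (ω : CadlagPath E) :
    augment z (pastPair ζ τ ω).1.fst (pastPair ζ τ ω).1.snd =
      stopPath (τ ω) (augment z ω (ζ ω)) := by
  refine CadlagPath.ext fun t => ?_
  rw [stopPath_apply]
  change (((stopPath (τ ω) (augment 1 ω (ζ ω))) t).1,
    z * ((stopPath (τ ω) (augment 1 ω (ζ ω))) t).2) = _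
  rw [stopPath_apply]
  simp only [augment, one_mul]

variable [SecondCountableTopology E]

theorem countablyGenerated_past :
    MeasurableSpace.CountablyGenerated (CadlagPath (E × ℝ≥0) × WithTop ℝ≥0) := by
  have := countablyGenerated_augmentedPath (E := E)
  infer_instance

include hP hτ in
/-- Pasting the transition laws of a strong Markov family does nothing. -/
theorem pasteLaw_strongMarkov {x : E} {Q : Measure (CadlagPath E)}
    {ζ : CadlagPath E → CadlagPath ℝ≥0} (hζ : IsDensityProcess (P x) Q ζ) :
    pasteLaw (P x) τ (P.comap (fun ω => evalAt (τ ω) ω) (measurable_id.evalAt hτ.measurable')) =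
      P x := by
  have := countablyGenerated_past (E := E)
  ext A hA
  have hG : Measurable (A.indicator (1 : CadlagPath E → ℝ≥0∞)) := measurable_one.indicator hA
  rw [← lintegral_indicator_one hA, lintegral_pasteLaw hτ.measurable' hG,
    ← lintegral_indicator_one hA]
  refine (lintegral_strongMarkov_of_eq hP hτ x (hζ.measurable_pastPair hτ)
    (Ψ := fun q => A.indicator 1 (splice q.1.1.fst q.1.2 q.2)) ?_ ?_ ?_ ?_).symm
  · exact hG.comp (((CadlagPath.measurable_fst.comp measurable_fst).comp measurable_fst).splice
      measurable_fst.snd measurable_snd)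
  · intro ω hω
    rw [fst_pastPair]
    change _ = A.indicator 1 (splice (stopPath (τ ω) ω) (τ ω) _)
    rw [splice_stopPath]
    lift τ ω to ℝ≥0 using hω with u
    rw [WithTop.untopD_coe, splice_shift]
  · intro ω ω' hω
    rw [fst_pastPair]
    change _ = A.indicator 1 (splice (stopPath (τ ω) ω) (τ ω) _)
    rw [splice_stopPath]
  · intro ω ω' hω
    rw [hω]
    rfl

end Paste

/-! ### The density process of a pasted measure -/

section PasteDensity

variable {E : Type*} [TopologicalSpace E] [MeasurableSpace E]

/-- The candidate for the density process of a pasted measure. -/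
def pasteDensity (z : ℝ≥0) (ζ : CadlagPath E → CadlagPath ℝ≥0) (τ : CadlagPath E → WithTop ℝ≥0)
    (Z : (E × ℝ≥0) × CadlagPath E → CadlagPath ℝ≥0) (ω : CadlagPath E) : CadlagPath ℝ≥0 :=
  splice (ζ ω) (τ ω) (scalePath (evalAt (τ ω) (ζ ω))
    (Z (evalAt (τ ω) (augment z ω (ζ ω)), shift ((τ ω).untopD 0) ω)))

-- After `τ` the factor `z` times `ζ` at `τ` is the weight coordinate of the augmented state at `τ`.
-- The future is thus an augmented path started with that weight, matching the kernel used in the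
-- concatenated law.
omit [MeasurableSpace E] in
theorem augment_pasteDensity (z : ℝ≥0) (ζ : CadlagPath E → CadlagPath ℝ≥0)
    {τ : CadlagPath E → WithTop ℝ≥0} (Z : (E × ℝ≥0) × CadlagPath E → CadlagPath ℝ≥0)
    (ω : CadlagPath E) :
    augment z ω (pasteDensity z ζ τ Z ω) = splice (augment z ω (ζ ω)) (τ ω)
      (augment (evalAt (τ ω) (augment z ω (ζ ω))).2 (shift ((τ ω).untopD 0) ω)
        (Z (evalAt (τ ω) (augment z ω (ζ ω)), shift ((τ ω).untopD 0) ω))) := by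
  refine CadlagPath.ext fun t => ?_
  change (ω t, z * pasteDensity z ζ τ Z ω t) = _
  rw [pasteDensity, splice_apply, splice_apply]
  split_ifs with h
  · rfl
  · have h' : (τ ω).untopD 0 ≤ t := WithTop.untopD_le (not_lt.1 h)
    refine Prod.ext ?_ ?_
    · change ω t = ω ((τ ω).untopD 0 + (t - (τ ω).untopD 0))
      rw [add_tsub_cancel_of_le h']
    · exact (mul_assoc _ _ _).symm

variable [TopologicalSpace.PseudoMetrizableSpace E] [BorelSpace E] [SecondCountableTopology E]
  {P : Kernel E (CadlagPath E)} [IsMarkovKernel P] (hP : IsCanonicalStrongMarkov P)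
  {x : E} {Q : Measure (CadlagPath E)}
  {ζ : CadlagPath E → CadlagPath ℝ≥0} (hζ : IsDensityProcess (P x) Q ζ)
  {τ : CadlagPath E → WithTop ℝ≥0} (hτ : IsStoppingTime (pathFiltration E) τ)
  {z : ℝ≥0} {Z : (E × ℝ≥0) × CadlagPath E → CadlagPath ℝ≥0} (hZ : Measurable Z)

include hζ hτ in
omit [SecondCountableTopology E] [IsMarkovKernel P] in
theorem IsDensityProcess.measurable_evalAt_augment (z : ℝ≥0) :
    Measurable fun ω => evalAt (τ ω) (augment z ω (ζ ω)) :=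
  (Measurable.augment measurable_const measurable_id hζ.meas).evalAt hτ.measurable'

include hζ hτ hZ in
omit [SecondCountableTopology E] [IsMarkovKernel P] in
theorem measurable_pasteDensity : Measurable (pasteDensity z ζ τ Z) := by
  have hτm : Measurable τ := hτ.measurable'
  exact hζ.meas.splice hτm (Measurable.scalePath (hζ.meas.evalAt hτm)
    (hZ.comp ((hζ.measurable_evalAt_augment hτ z).prodMk
      (measurable_id.shift (hτm.untopD 0)))))

include hP hτ hZ hζ in
/-- The law of the augmented path with the pasted density is the concatenated law. -/
theorem lintegral_augment_pasteDensity {G : CadlagPath (E × ℝ≥0) → ℝ≥0∞} (hG : Measurable G) :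
    ∫⁻ ω, G (augment z ω (pasteDensity z ζ τ Z ω)) ∂P x =
      ∫⁻ ω, ∫⁻ ω', G (splice (augment z ω (ζ ω)) (τ ω)
        (augment (evalAt (τ ω) (augment z ω (ζ ω))).2 ω'
          (Z (evalAt (τ ω) (augment z ω (ζ ω)), ω')))) ∂P (evalAt (τ ω) ω) ∂P x := by
  have := countablyGenerated_past (E := E)
  have hend : Measurable fun q : (CadlagPath (E × ℝ≥0) × WithTop ℝ≥0) × CadlagPath E =>
      endState z q.1 := (measurable_endState z).comp measurable_fst
  refine lintegral_strongMarkov_of_eq hP hτ x (hζ.measurable_pastPair hτ)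
    (Ψ := fun q => G (splice (augment z q.1.1.fst q.1.1.snd) q.1.2
      (augment (endState z q.1).2 q.2 (Z (endState z q.1, q.2))))) ?_ ?_ ?_ ?_
  · refine hG.comp (Measurable.splice ?_ measurable_fst.snd ?_)
    · exact Measurable.augment measurable_const
        ((CadlagPath.measurable_fst.comp measurable_fst).comp measurable_fst)
        ((CadlagPath.measurable_snd.comp measurable_fst).comp measurable_fst)
    · exact Measurable.augment hend.snd measurable_snd (hZ.comp (hend.prodMk measurable_snd))
  · intro ω _
    rw [augment_pasteDensity, endState_pastPair, augment_pastPair]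
    exact congrArg G (splice_stopPath _ _ _).symm
  · intro ω ω' _
    rw [endState_pastPair, augment_pastPair]
    exact congrArg G (splice_stopPath _ _ _).symm
  · intro ω ω' hω
    rw [augment_pasteDensity, hω]
    rfl

-- The characterisation by past and future events is checked separately on `t < τ` and `τ ≤ t`. In
-- the first case nothing has been pasted up to `t` and the statement is that for `Q`. In the
-- second, the characterisation for `K` integrates the future after `τ`, the value of `ζ` at `τ`
-- exchanges `Q` for `P x` on the past, and the strong Markov property puts the path together again.
include hP hτ hZ hζ in
theorem isDensityProcess_pasteLaw [IsProbabilityMeasure Q] (hQ : Q ≪ P x)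
    {K : Kernel (E × ℝ≥0) (CadlagPath E)} [IsMarkovKernel K]
    (hK : ∀ᵐ ω ∂P x, K (evalAt (τ ω) (augment z ω (ζ ω))) ≪ P (evalAt (τ ω) ω))
    (hKZ : ∀ᵐ ω ∂P x, IsDensityProcess (P (evalAt (τ ω) ω)) (K (evalAt (τ ω) (augment z ω (ζ ω))))
      fun ω' => Z (evalAt (τ ω) (augment z ω (ζ ω)), ω'))
    (hQhat : pasteLaw Q τ (K.comap _ (hζ.measurable_evalAt_augment hτ z)) ≪ P x) :
    IsDensityProcess (P x) (pasteLaw Q τ (K.comap _ (hζ.measurable_evalAt_augment hτ z)))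
      (pasteDensity z ζ τ Z) := by
  have := countablyGenerated_past (E := E)
  have hτm : Measurable τ := hτ.measurable'
  have hp := hζ.measurable_evalAt_augment hτ z
  have := isProbabilityMeasure_pasteLaw (μ := Q) (L := K.comap _ hp) hτm
  refine isDensityProcess_of_setLIntegral hP hQhat (measurable_pasteDensity hζ hτ hZ) ?_
  intro t A B hA hB
  have hAm : MeasurableSet A := (rawFiltration E).le t A hA
  have hJ : Measurable (A.indicator fun ω : CadlagPath E => P (ω t) B) :=
    ((P.measurable_coe hB).comp (measurable_coordinate t)).indicator hAm
  rw [← lintegral_indicator hAm, lintegral_pasteLaw hτm hJ]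
  set C : Set (CadlagPath E) := {ω | (t : WithTop ℝ≥0) < τ ω} with hC
  have hCt : MeasurableSet[pathFiltration E t] C := hτ.measurableSet_gt t
  have hCm : MeasurableSet C := (pathFiltration E).le t _ hCt
  have hABm : MeasurableSet (A ∩ shift t ⁻¹' B) := hAm.inter (shift_measurable t hB)
  -- The integrand for `τ ≤ t` without the factor `ζ` at `τ`, as a function of the past pair and the
  -- future; it vanishes for `t < τ`.
  set Ψ : (CadlagPath (E × ℝ≥0) × WithTop ℝ≥0) × CadlagPath E → ℝ≥0∞ := fun q =>
    if q.1.2 ≤ (t : WithTop ℝ≥0) then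
      A.indicator 1 (splice q.1.1.fst q.1.2 q.2) *
        (B.indicator 1 (shift (t - q.1.2.untopD 0) q.2) *
          (Z (endState z q.1, q.2) (t - q.1.2.untopD 0) : ℝ≥0∞)) else 0 with hΨ
  have hsub : Measurable fun q : (CadlagPath (E × ℝ≥0) × WithTop ℝ≥0) × CadlagPath E =>
      t - q.1.2.untopD 0 := measurable_const.sub (measurable_fst.snd.untopD 0)
  have hend : Measurable fun q : (CadlagPath (E × ℝ≥0) × WithTop ℝ≥0) × CadlagPath E =>
      endState z q.1 := (measurable_endState z).comp measurable_fst
  have hΨm : Measurable Ψ := by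
    refine Measurable.ite (measurableSet_le measurable_fst.snd measurable_const) ?_
      measurable_const
    refine Measurable.mul ?_ (Measurable.mul ?_ ?_)
    · exact (measurable_one.indicator hAm).comp
        (((CadlagPath.measurable_fst.comp measurable_fst).comp measurable_fst).splice
          measurable_fst.snd measurable_snd)
    · exact (measurable_one.indicator hB).comp (measurable_snd.shift hsub)
    · exact ((hZ.comp (hend.prodMk measurable_snd)).path_apply hsub).coe_nnreal_ennreal
  set h : CadlagPath (E × ℝ≥0) × WithTop ℝ≥0 → ℝ≥0∞ := fun u =>
    ∫⁻ ω', Ψ (u, ω') ∂P (endState z u).1 with hh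
  have hhm : Measurable h := by
    have : Measurable fun u => ∫⁻ ω', Ψ (u, ω') ∂(P.comap _ (measurable_endState z).fst) u :=
      hΨm.lintegral_kernel_prod_right'
    exact this
  have hΨpast : ∀ ω ω', τ ω ≤ t → Ψ (pastPair ζ τ ω, ω') =
      A.indicator 1 (splice ω (τ ω) ω') * (B.indicator 1 (shift (t - (τ ω).untopD 0) ω') *
        (Z (evalAt (τ ω) (augment z ω (ζ ω)), ω') (t - (τ ω).untopD 0) : ℝ≥0∞)) := by
    intro ω ω' hω
    simp only [hΨ, endState_pastPair, fst_pastPair]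
    rw [if_pos (by exact hω)]
    change A.indicator 1 (splice (stopPath (τ ω) ω) (τ ω) ω') * _ = _
    rw [splice_stopPath]
    rfl
  have hΨpast0 : ∀ ω ω', ω ∈ C → Ψ (pastPair ζ τ ω, ω') = 0 := fun ω ω' hω =>
    if_neg (not_le.2 hω)
  have hfst : ∀ ω, (endState z (pastPair ζ τ ω)).1 = evalAt (τ ω) ω := fun ω => by
    rw [endState_pastPair]
    rfl
  have hne : MeasurableSet {ω | τ ω ≠ ⊤} :=
    hτm (measurableSet_singleton (⊤ : WithTop ℝ≥0)).compl
  have hCle : ∀ ω ∈ Cᶜ, τ ω ≤ t := fun ω hω => not_lt.1 (show ¬(t : WithTop ℝ≥0) < τ ω from hω)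
  have hCne : Cᶜ ⊆ {ω | τ ω ≠ ⊤} := fun ω hω =>
    ((hCle ω hω).trans_lt (WithTop.coe_lt_top t)).ne
  -- integrals over `{τ ≠ ⊤}` of functions vanishing on `C`
  have hrestrict : ∀ (μ : Measure (CadlagPath E)) (f : CadlagPath E → ℝ≥0∞),
      (∀ ω ∈ C, f ω = 0) → ∫⁻ ω in {ω | τ ω ≠ ⊤}, f ω ∂μ = ∫⁻ ω in Cᶜ, f ω ∂μ := by
    intro μ f hf
    rw [← lintegral_indicator hne, ← lintegral_indicator hCm.compl]
    refine lintegral_congr fun ω => ?_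
    by_cases hω : ω ∈ C
    · rw [indicator_of_notMem (notMem_compl_iff.2 hω), indicator_apply]
      split_ifs
      · exact hf ω hω
      · rfl
    · rw [indicator_of_mem (hCne hω), indicator_of_mem hω]
  -- before `τ`
  have hbefore : ∫⁻ ω in A ∩ shift t ⁻¹' B ∩ C, (pasteDensity z ζ τ Z ω t : ℝ≥0∞) ∂P x =
      ∫⁻ ω in C, ∫⁻ ω', A.indicator (fun ω : CadlagPath E => P (ω t) B) (splice ω (τ ω) ω')
        ∂(K.comap _ hp) ω ∂Q := by
    have h1 : ∫⁻ ω in A ∩ shift t ⁻¹' B ∩ C, (pasteDensity z ζ τ Z ω t : ℝ≥0∞) ∂P x =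
        ∫⁻ ω in (A ∩ C) ∩ shift t ⁻¹' B, (ζ ω t : ℝ≥0∞) ∂P x := by
      rw [inter_right_comm]
      refine setLIntegral_congr_fun ((hAm.inter hCm).inter (shift_measurable t hB)) fun ω hω => ?_
      have hω : (t : WithTop ℝ≥0) < τ ω := hω.1.2
      simp only [pasteDensity, splice_apply, if_pos hω]
    rw [h1, hζ.setLIntegral hP hQ t ((rawFiltration_le_pathFiltration t A hA).inter hCt) hB,
      ← setLIntegral_indicator hAm]
    refine setLIntegral_congr_fun hCm fun ω hω => ?_
    have hω : (t : WithTop ℝ≥0) < τ ω := hω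
    have h2 : ∀ ω', A.indicator (fun ω : CadlagPath E => P (ω t) B) (splice ω (τ ω) ω') =
        A.indicator (fun ω : CadlagPath E => P (ω t) B) ω := by
      intro ω'
      have h3 : ∀ s ≤ t, splice ω (τ ω) ω' s = ω s := fun s hs => by
        rw [splice_apply, if_pos ((WithTop.coe_le_coe.2 hs).trans_lt hω)]
      by_cases ha : ω ∈ A
      · rw [indicator_of_mem ha,
          indicator_of_mem ((mem_iff_of_eqOn_of_rawFiltration hA h3).2 ha), h3 t le_rfl]
      · rw [indicator_of_notMem ha,
          indicator_of_notMem fun h' => ha ((mem_iff_of_eqOn_of_rawFiltration hA h3).1 h')]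
    simp [h2]
  -- after `τ`
  have hafter : ∫⁻ ω in (A ∩ shift t ⁻¹' B) \ C, (pasteDensity z ζ τ Z ω t : ℝ≥0∞) ∂P x =
      ∫⁻ ω in Cᶜ, ∫⁻ ω', A.indicator (fun ω : CadlagPath E => P (ω t) B) (splice ω (τ ω) ω')
        ∂(K.comap _ hp) ω ∂Q := by
    -- With the past frozen and `τ = u`, the futures bringing the concatenation into `A` form an
    -- event up to `t - u`, so the density property of `K` applies at time `t - u`.
    have h1 : ∀ᵐ ω ∂Q, ω ∈ Cᶜ → ∫⁻ ω', A.indicator (fun ω : CadlagPath E => P (ω t) B)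
        (splice ω (τ ω) ω') ∂(K.comap _ hp) ω = h (pastPair ζ τ ω) := by
      filter_upwards [hQ.ae_le hK, hQ.ae_le hKZ] with ω hω1 hω2 hωC
      have hωt : τ ω ≤ t := hCle ω hωC
      simp only [hh, hΨpast ω _ hωt, hfst]
      obtain ⟨u, hu⟩ := WithTop.ne_top_iff_exists.1 (hCne hωC)
      rw [← hu, WithTop.coe_le_coe] at hωt
      rw [Kernel.comap_apply]
      simp only [← hu, WithTop.untopD_coe] at hω1 hω2 ⊢
      set A' := (fun ω' => splice ω (u : WithTop ℝ≥0) ω') ⁻¹' A with hA'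
      have hA'm : MeasurableSet[rawFiltration E (t - u)] A' :=
        measurable_splice_rawFiltration ω u t hA
      have hA'm' : MeasurableSet A' := (rawFiltration E).le _ _ hA'm
      have h2 := hω2.setLIntegral hP hω1 (t - u)
        (rawFiltration_le_pathFiltration _ _ hA'm) hB
      have h3 : ∀ ω', A.indicator (fun ω : CadlagPath E => P (ω t) B)
          (splice ω (u : WithTop ℝ≥0) ω') =
          A'.indicator (fun ω' : CadlagPath E => P (ω' (t - u)) B) ω' := fun ω' => by
        have : splice ω (u : WithTop ℝ≥0) ω' t = ω' (t - u) := by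
          rw [splice_apply, if_neg (not_lt.2 (WithTop.coe_le_coe.2 hωt))]
          rfl
        by_cases ha : splice ω (u : WithTop ℝ≥0) ω' ∈ A
        · rw [indicator_of_mem ha, indicator_of_mem (show ω' ∈ A' from ha), this]
        · rw [indicator_of_notMem ha, indicator_of_notMem (show ω' ∉ A' from ha)]
      simp only [h3]
      rw [lintegral_indicator hA'm', ← h2,
        ← lintegral_indicator (hA'm'.inter (shift_measurable _ hB))]
      refine lintegral_congr fun ω' => ?_
      by_cases ha : splice ω (u : WithTop ℝ≥0) ω' ∈ A <;>
        by_cases hb : shift (t - u) ω' ∈ B <;> simp [hA', ha, hb]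
    have hh0 : ∀ ω ∈ C, h (pastPair ζ τ ω) = 0 := fun ω hω => by
      simp [hh, hΨpast0 ω _ hω]
    -- The inner integral is now a function of the past of `τ`, so `Q` can be replaced by `P x` at
    -- the price of the factor `ζ` at `τ`.
    rw [setLIntegral_congr_fun_ae hCm.compl h1, ← hrestrict Q _ hh0,
      hζ.lintegral_stopped hQ hτ (hζ.measurable_pastPair hτ) hhm]
    have h4 := lintegral_strongMarkov hP hτ x (hζ.measurable_pastPair hτ)
      (Ψ := fun q => Ψ q * ((evalAt q.1.2 q.1.1).2 : ℝ≥0∞))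
      (hΨm.mul ((measurable_fst.fst.evalAt measurable_fst.snd).snd.coe_nnreal_ennreal))
    have h5 : ∀ ω, (evalAt (pastPair ζ τ ω).2 (pastPair ζ τ ω).1).2 = evalAt (τ ω) (ζ ω) :=
      fun ω => by
        simp only [pastPair, evalAt_stopPath]
        simp only [evalAt, augment, one_mul]
    have h6 : ∀ ω, ∫⁻ ω', Ψ (pastPair ζ τ ω, ω') * (evalAt (τ ω) (ζ ω) : ℝ≥0)
        ∂P (evalAt (τ ω) ω) = h (pastPair ζ τ ω) * (evalAt (τ ω) (ζ ω) : ℝ≥0) := fun ω => by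
      rw [lintegral_mul_const _ (f := fun ω' => Ψ (pastPair ζ τ ω, ω'))
        (hΨm.comp measurable_prodMk_left), hh]
      beta_reduce
      rw [hfst]
    simp only [h5, h6] at h4
    rw [← h4, hrestrict _ _ fun ω hω => by rw [hΨpast0 ω _ hω, zero_mul], Set.sdiff_eq,
      ← setLIntegral_indicator hABm]
    refine setLIntegral_congr_fun hCm.compl fun ω hω => ?_
    have hωt : τ ω ≤ t := hCle ω hω
    rw [hΨpast ω _ hωt]
    obtain ⟨u, hu⟩ := WithTop.ne_top_iff_exists.1 (hCne hω)
    rw [← hu, WithTop.coe_le_coe] at hωt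
    have h7 : shift (t - u) (shift u ω) = shift t ω := CadlagPath.ext fun s => by
      change ω (u + (t - u + s)) = ω (t + s)
      rw [← add_assoc, add_tsub_cancel_of_le hωt]
    have h8 : pasteDensity z ζ τ Z ω t = evalAt (u : WithTop ℝ≥0) (ζ ω) *
        Z (evalAt (u : WithTop ℝ≥0) (augment z ω (ζ ω)), shift u ω) (t - u) := by
      rw [pasteDensity, splice_apply, if_neg (not_lt.2 (hCle ω hω)), ← hu]
      rfl
    simp only [← hu, WithTop.untopD_coe, splice_shift, h7]
    by_cases ha : ω ∈ A <;> by_cases hb : shift t ω ∈ B <;> simp [h8, ha, hb, mul_comm]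
  rw [← lintegral_inter_add_sdiff _ (A ∩ shift t ⁻¹' B) hCm, hbefore, hafter,
    lintegral_add_compl _ hCm]

end PasteDensity

/-! ### The stopped price process along concatenated paths -/

section SplicedPrice

variable {d : ℕ} {F : Type*} [TopologicalSpace F] {n : ℕ} {i : Fin d}
  {ω ω' : CadlagPath (State d F)} {t u : ℝ≥0}

theorem runningSup_congr (h : ∀ s ≤ t, ω s = ω' s) : runningSup t ω = runningSup t ω' := by
  refine le_antisymm (runningSup_le_iff.2 fun s hs => ?_) (runningSup_le_iff.2 fun s hs => ?_)
  · rw [price, h s hs]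
    exact enorm_price_le_runningSup hs ω'
  · rw [price, ← h s hs]
    exact enorm_price_le_runningSup hs ω

theorem stoppedPrice_congr (h : ∀ s ≤ t, ω s = ω' s) :
    stoppedPrice n i t ω = stoppedPrice n i t ω' := by
  have key : ∀ {ω ω' : CadlagPath (State d F)}, (∀ s ≤ t, ω s = ω' s) →
      min (t : WithTop ℝ≥0) (levelTime n ω) ≤ min (t : WithTop ℝ≥0) (levelTime n ω') := by
    intro ω ω' h
    refine le_of_forall_coe_le fun s hs => ?_
    rcases le_or_gt t s with hts | hst
    · exact (min_le_left _ _).trans (WithTop.coe_le_coe.2 hts)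
    · have h1 : levelTime n ω' ≤ s :=
        (min_le_iff.1 hs).resolve_left (not_le.2 (WithTop.coe_lt_coe.2 hst))
      rw [levelTime_le_iff, ← runningSup_congr fun r hr => h r (hr.trans hst.le),
        ← levelTime_le_iff] at h1
      exact (min_le_right _ _).trans h1
  have h1 := le_antisymm (key h) (key fun s hs => (h s hs).symm)
  simp only [stoppedPrice, price]
  rw [h1, h _ (WithTop.untopD_le (min_le_left _ _))]

theorem splice_eq_of_le (h0 : ω' 0 = ω u) {s : ℝ≥0} (hs : s ≤ u) :
    splice ω (u : WithTop ℝ≥0) ω' s = ω s := by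
  rw [splice_apply]
  split_ifs with h
  · rfl
  · have : s = u := le_antisymm hs (WithTop.coe_le_coe.1 (not_lt.1 h))
    rw [this, WithTop.untopD_coe, tsub_self, h0]

theorem splice_add (ω ω' : CadlagPath (State d F)) (u s : ℝ≥0) :
    splice ω (u : WithTop ℝ≥0) ω' (u + s) = ω' s := by
  rw [splice_apply, if_neg (not_lt.2 (WithTop.coe_le_coe.2 le_self_add)), WithTop.untopD_coe,
    add_tsub_cancel_left]

/-- Up to `u + s` the running supremum of the concatenation is at most the maximum of those of the
two pieces; as the past stays below the level, only the future can reach it. -/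
theorem levelTime_splice_le_iff (h0 : ω' 0 = ω u) (hu : u < levelTime n ω) {s : ℝ≥0} :
    levelTime n (splice ω (u : WithTop ℝ≥0) ω') ≤ (u + s : ℝ≥0) ↔ levelTime n ω' ≤ s := by
  rw [levelTime_le_iff, levelTime_le_iff]
  constructor
  · intro h
    have h1 : runningSup (u + s) (splice ω (u : WithTop ℝ≥0) ω') ≤
        max (runningSup u ω) (runningSup s ω') := by
      refine runningSup_le_iff.2 fun r hr => ?_
      rcases le_total r u with hru | hur
      · rw [price, splice_eq_of_le h0 hru]
        exact (enorm_price_le_runningSup hru ω).trans (le_max_left _ _)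
      · obtain ⟨e, rfl⟩ := exists_add_of_le hur
        rw [price, splice_add]
        exact (enorm_price_le_runningSup (le_of_add_le_add_left hr) ω').trans (le_max_right _ _)
    exact (le_max_iff.1 (h.trans h1)).resolve_left (not_le.2 (lt_levelTime_iff.1 hu))
  · refine fun h => h.trans (runningSup_le_iff.2 fun r hr => ?_)
    rw [price, ← splice_add ω ω' u r]
    exact enorm_price_le_runningSup (add_le_add_right hr u) _

/-- A concatenation that has not reached the level by `u` stops when its future does, so the price
moves after `u` by the increment of the stopped future; otherwise it is already frozen. For `t ≤ u`
the truncated difference `t - u` is `0` and the correction vanishes. -/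
theorem stoppedPrice_splice (h0 : ω' 0 = ω u) :
    stoppedPrice n i t (splice ω (u : WithTop ℝ≥0) ω') =
      stoppedPrice n i (min t u) ω + if u < levelTime n ω then
        stoppedPrice n i (t - u) ω' - stoppedPrice n i 0 ω' else 0 := by
  set π := splice ω (u : WithTop ℝ≥0) ω' with hπ
  have hagree : ∀ s ≤ u, π s = ω s := fun s hs => splice_eq_of_le h0 hs
  rcases le_total t u with htu | hut
  · rw [min_eq_left htu, tsub_eq_zero_of_le htu, sub_self, ite_self, add_zero]
    exact stoppedPrice_congr fun s hs => hagree s (hs.trans htu)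
  rw [min_eq_right hut]
  split_ifs with hu
  · have h1 : stoppedPrice n i u ω = stoppedPrice n i 0 ω' := by
      rw [stoppedPrice_zero, h0, stoppedPrice, min_eq_left hu.le]
      rfl
    rw [h1, add_sub_cancel]
    obtain ⟨r, rfl⟩ := exists_add_of_le hut
    rw [add_tsub_cancel_left]
    set v := (min (r : WithTop ℝ≥0) (levelTime n ω')).untopD 0 with hv
    have hvc : (v : WithTop ℝ≥0) = min (r : WithTop ℝ≥0) (levelTime n ω') := coe_untopD_min _ _
    -- The two stopping instants are identified by comparing their finite upper bounds: none lies
    -- before `u`, and beyond `u` the level times correspond.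
    have key : ∀ c : ℝ≥0, min ((u + r : ℝ≥0) : WithTop ℝ≥0) (levelTime n π) ≤ c ↔
        ((u + v : ℝ≥0) : WithTop ℝ≥0) ≤ c := by
      intro c
      rcases lt_or_ge c u with hcu | huc
      · refine iff_of_false ?_ ?_
        · rw [not_le, lt_min_iff]
          refine ⟨WithTop.coe_lt_coe.2 (hcu.trans_le le_self_add), lt_levelTime_iff.2 ?_⟩
          refine (runningSup_mono π hcu.le).trans_lt ?_
          exact (runningSup_congr hagree).trans_lt (lt_levelTime_iff.1 hu)
        · exact not_le.2 (WithTop.coe_lt_coe.2 (hcu.trans_le le_self_add))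
      · obtain ⟨e, rfl⟩ := exists_add_of_le huc
        have hve : v ≤ e ↔ r ≤ e ∨ levelTime n ω' ≤ e := by
          rw [← WithTop.coe_le_coe, hvc, min_le_iff, WithTop.coe_le_coe]
        rw [min_le_iff, levelTime_splice_le_iff h0 hu, WithTop.coe_le_coe, WithTop.coe_le_coe,
          add_le_add_iff_left, add_le_add_iff_left, hve]
    have h2 : min ((u + r : ℝ≥0) : WithTop ℝ≥0) (levelTime n π) = ((u + v : ℝ≥0) : WithTop ℝ≥0) :=
      le_antisymm (le_of_forall_coe_le fun c => (key c).2)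
        (le_of_forall_coe_le fun c => (key c).1)
    rw [stoppedPrice, h2, WithTop.untopD_coe, price, hπ, splice_add]
    rfl
  · have hu' : levelTime n π ≤ u := by
      rw [levelTime_le_iff, runningSup_congr hagree, ← levelTime_le_iff]
      exact not_lt.1 hu
    rw [add_zero, ← stoppedPrice_congr hagree, stoppedPrice, stoppedPrice, min_eq_right hu',
      min_eq_right (hu'.trans (WithTop.coe_le_coe.2 hut))]

end SplicedPrice

/-! ### The pasted measure is a local martingale measure -/

section PastedMartingale

variable {d : ℕ} {F : Type*} [TopologicalSpace F] [MeasurableSpace F]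
  [SecondCountableTopology F] [BorelSpace F] [TopologicalSpace.PseudoMetrizableSpace F]

/-- The data of a law of the future that continues the price process of a given past as a
martingale. -/
structure IsMartingaleContinuation (n : ℕ) (i : Fin d) (ω : CadlagPath (State d F))
    (σ : WithTop ℝ≥0) (L : Measure (CadlagPath (State d F))) : Prop where
  prob : IsProbabilityMeasure L
  start : ∀ᵐ ω' ∂L, ω' 0 = evalAt σ ω
  martingale : σ < levelTime n ω → Martingale (stoppedPrice n i) (rawFiltration (State d F)) L

variable {n : ℕ} {i : Fin d} {ω : CadlagPath (State d F)} {σ : WithTop ℝ≥0}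
  {L : Measure (CadlagPath (State d F))}

-- Increments of the stopped future have mean zero, so averaging over the future leaves the price of
-- the past stopped at `σ`.
omit [SecondCountableTopology F] [BorelSpace F] [TopologicalSpace.PseudoMetrizableSpace F] in
theorem IsMartingaleContinuation.integrable (h : IsMartingaleContinuation n i ω σ L) (t : ℝ≥0) :
    Integrable (fun ω' => stoppedPrice n i t (splice ω σ ω')) L ∧
      ∫ ω', stoppedPrice n i t (splice ω σ ω') ∂L =
        stoppedPrice n i ((min (t : WithTop ℝ≥0) σ).untopD 0) ω := by
  have := h.prob
  induction σ with
  | top => simp [splice]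
  | coe u =>
    have h1 : (fun ω' => stoppedPrice n i (min t u) ω + if u < levelTime n ω then
        stoppedPrice n i (t - u) ω' - stoppedPrice n i 0 ω' else 0) =ᵐ[L]
        fun ω' => stoppedPrice n i t (splice ω (u : WithTop ℝ≥0) ω') := by
      filter_upwards [h.start] with ω' hω'
      exact (stoppedPrice_splice hω').symm
    have h2 : (min (t : WithTop ℝ≥0) (u : WithTop ℝ≥0)).untopD 0 = min t u := by
      rw [← WithTop.coe_min, WithTop.untopD_coe]
    rw [← integral_congr_ae h1, h2, ← integrable_congr h1]
    split_ifs with hu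
    · have hM := h.martingale hu
      refine ⟨(integrable_const _).add ((hM.integrable _).sub (hM.integrable _)), ?_⟩
      rw [integral_add (g := fun ω' => stoppedPrice n i (t - u) ω' - stoppedPrice n i 0 ω')
        (integrable_const _) ((hM.integrable _).sub (hM.integrable _)),
        integral_sub (hM.integrable _) (hM.integrable _)]
      have h3 := hM.setIntegral_eq (zero_le (a := t - u)) MeasurableSet.univ
      simp only [setIntegral_univ] at h3
      simp [h3]
    · simp

-- The increment splits into one of the past and one of the future. The latter averages to zero over
-- events up to `s - σ`. The former vanishes if `σ ≤ s`, and otherwise membership in `A` is already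
-- decided by the past.
omit [SecondCountableTopology F] [BorelSpace F] [TopologicalSpace.PseudoMetrizableSpace F] in
theorem IsMartingaleContinuation.setIntegral_sub (h : IsMartingaleContinuation n i ω σ L)
    {s t : ℝ≥0} (hst : s ≤ t) {A : Set (CadlagPath (State d F))}
    (hA : MeasurableSet[rawFiltration (State d F) s] A) :
    ∫ ω', A.indicator (fun π => stoppedPrice n i t π - stoppedPrice n i s π) (splice ω σ ω') ∂L =
      A.indicator (fun ω => stoppedPrice n i ((min (t : WithTop ℝ≥0) σ).untopD 0) ω -
        stoppedPrice n i ((min (s : WithTop ℝ≥0) σ).untopD 0) ω) ω := by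
  have := h.prob
  induction σ with
  | top => simp [splice]
  | coe u =>
    have h2 : ∀ t : ℝ≥0, (min (t : WithTop ℝ≥0) (u : WithTop ℝ≥0)).untopD 0 = min t u := fun t => by
      rw [← WithTop.coe_min, WithTop.untopD_coe]
    simp only [h2]
    set A' := (fun ω' => splice ω (u : WithTop ℝ≥0) ω') ⁻¹' A with hA'
    have hA'm : MeasurableSet[rawFiltration (State d F) (s - u)] A' :=
      measurable_splice_rawFiltration ω u s hA
    have hA'm' : MeasurableSet A' := (rawFiltration _).le _ _ hA'm
    have h1 : (fun ω' => A.indicator (fun π => stoppedPrice n i t π - stoppedPrice n i s π)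
        (splice ω (u : WithTop ℝ≥0) ω')) =ᵐ[L] fun ω' =>
        A.indicator (fun ω => stoppedPrice n i (min t u) ω - stoppedPrice n i (min s u) ω) ω +
        A'.indicator (fun ω' => if u < levelTime n ω then
          stoppedPrice n i (t - u) ω' - stoppedPrice n i (s - u) ω' else 0) ω' := by
      filter_upwards [h.start] with ω' hω'
      replace hω' : ω' 0 = ω u := hω'
      have h3 : A.indicator (fun ω => stoppedPrice n i (min t u) ω -
          stoppedPrice n i (min s u) ω) ω = A'.indicator (fun _ => stoppedPrice n i (min t u) ω -
          stoppedPrice n i (min s u) ω) ω' := by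
        rcases le_total u s with hus | hsu
        · rw [min_eq_right hus, min_eq_right (hus.trans hst)]
          simp [indicator]
        · have hiff : ω ∈ A ↔ ω' ∈ A' := mem_iff_of_eqOn_of_rawFiltration hA fun r hr =>
            (splice_eq_of_le hω' (hr.trans hsu)).symm
          by_cases ha : ω' ∈ A'
          · rw [indicator_of_mem (hiff.2 ha), indicator_of_mem ha]
          · rw [indicator_of_notMem (mt hiff.1 ha), indicator_of_notMem ha]
      rw [h3]
      by_cases ha : ω' ∈ A'
      · rw [indicator_of_mem (show splice ω (u : WithTop ℝ≥0) ω' ∈ A from ha),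
          indicator_of_mem ha, indicator_of_mem ha, stoppedPrice_splice hω',
          stoppedPrice_splice hω']
        split_ifs <;> ring
      · rw [indicator_of_notMem (show splice ω (u : WithTop ℝ≥0) ω' ∉ A from ha),
          indicator_of_notMem ha, indicator_of_notMem ha, add_zero]
    rw [integral_congr_ae h1]
    split_ifs with hu
    · have hM := h.martingale hu
      rw [integral_add (g := A'.indicator fun ω' =>
        stoppedPrice n i (t - u) ω' - stoppedPrice n i (s - u) ω') (integrable_const _)
        (((hM.integrable _).sub (hM.integrable _)).indicator hA'm'), integral_indicator hA'm',
        integral_sub (hM.integrable _).integrableOn (hM.integrable _).integrableOn,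
        ← hM.setIntegral_eq (tsub_le_tsub_right hst u) hA'm]
      simp
    · simp

/-- Averaging over the future reduces the martingale identity to that of the price stopped
additionally at `τ` under `Q`, which is optional stopping. -/
theorem martingale_pasteLaw {Q : Measure (CadlagPath (State d F))} [IsProbabilityMeasure Q]
    {τ : CadlagPath (State d F) → WithTop ℝ≥0} (hτ : IsStoppingTime (pathFiltration (State d F)) τ)
    {L : Kernel (CadlagPath (State d F)) (CadlagPath (State d F))} [IsMarkovKernel L]
    (hL : ∀ᵐ ω ∂Q, IsMartingaleContinuation n i ω (τ ω) (L ω)) {a : ℝ}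
    (ha : ∀ t, ∀ᵐ ω ∂pasteLaw Q τ L, a ≤ stoppedPrice n i t ω)
    (hQ : Martingale (stoppedPrice n i) (rawFiltration (State d F)) Q) :
    Martingale (stoppedPrice n i) (rawFiltration (State d F)) (pasteLaw Q τ L) := by
  have hτm : Measurable τ := hτ.measurable'
  have hs := measurable_splice_pair hτm
  have hpaste : pasteLaw Q τ L = (Q ⊗ₘ L).map fun q => splice q.1 (τ q.1) q.2 := by
    ext A hA
    have hG : Measurable (A.indicator (1 : CadlagPath (State d F) → ℝ≥0∞)) :=
      measurable_one.indicator hA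
    rw [← lintegral_indicator_one hA, lintegral_pasteLaw hτm hG, ← lintegral_indicator_one hA,
      lintegral_map hG hs]
    exact (Measure.lintegral_compProd (hG.comp hs)).symm
  have := isProbabilityMeasure_pasteLaw (μ := Q) (L := L) hτm
  have hMm : ∀ t, StronglyMeasurable[rawFiltration (State d F) t]
      (stoppedPrice n i t : CadlagPath (State d F) → ℝ) :=
    fun t => (measurable_stoppedPrice n i t).stronglyMeasurable
  have hMm' : ∀ t, StronglyMeasurable (stoppedPrice n i t : CadlagPath (State d F) → ℝ) :=
    fun t => (hMm t).mono ((rawFiltration _).le t)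
  have hMτ : ∀ t : ℝ≥0, Integrable
      (fun ω => stoppedPrice n i ((min (t : WithTop ℝ≥0) (τ ω)).untopD 0) ω) Q :=
    fun t => integrable_stopped hQ (rightCts_stoppedPrice n i) hτ t
  have hint : ∀ t, Integrable (stoppedPrice n i t) (pasteLaw Q τ L) := by
    intro t
    have h1 : Integrable (fun ω => stoppedPrice n i t ω - a) (pasteLaw Q τ L) := by
      have ha := ha t
      rw [hpaste, ae_map_iff hs.aemeasurable
        (measurableSet_le measurable_const (hMm' t).measurable)] at ha
      have ha := Measure.ae_ae_of_ae_compProd ha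
      have hm : StronglyMeasurable fun ω : CadlagPath (State d F) => stoppedPrice n i t ω - a :=
        (hMm' t).sub stronglyMeasurable_const
      rw [hpaste, integrable_map_measure hm.aestronglyMeasurable hs.aemeasurable,
        Measure.integrable_compProd_iff (hm.comp_measurable hs).aestronglyMeasurable]
      -- Above the lower bound `a` absolute values disappear, so joint integrability only requires
      -- the fibre means, which are the integrable stopped prices of the past; no uniform control of
      -- the kernel is needed.
      refine ⟨?_, ((hMτ t).sub (integrable_const a)).congr ?_⟩
      · filter_upwards [hL] with ω hω
        exact (hω.integrable t).1.sub (integrable_const a)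
      · filter_upwards [hL, ha] with ω hω haω
        have h2 : (fun ω' => ‖stoppedPrice n i t (splice ω (τ ω) ω') - a‖) =ᵐ[L ω]
            fun ω' => stoppedPrice n i t (splice ω (τ ω) ω') - a := by
          filter_upwards [haω] with ω' hω'
          exact Real.norm_of_nonneg (sub_nonneg.2 hω')
        refine Eq.trans ?_ (integral_congr_ae h2).symm
        rw [integral_sub (hω.integrable t).1 (integrable_const a), (hω.integrable t).2]
        simp
    exact (h1.add (integrable_const a)).congr (Eventually.of_forall fun ω => sub_add_cancel _ _)
  refine martingale_of_setIntegral_eq hMm hint fun s t hst A hA => ?_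
  have hA' : MeasurableSet A := (rawFiltration _).le s A hA
  rw [eq_comm, ← sub_eq_zero, ← integral_sub (hint t).integrableOn (hint s).integrableOn,
    ← integral_indicator hA']
  have hf : Integrable (A.indicator fun ω => stoppedPrice n i t ω - stoppedPrice n i s ω)
      (pasteLaw Q τ L) := ((hint t).sub (hint s)).indicator hA'
  have hfm : StronglyMeasurable
      (A.indicator fun ω : CadlagPath (State d F) => stoppedPrice n i t ω - stoppedPrice n i s ω) :=
    ((hMm' t).sub (hMm' s)).indicator hA'
  rw [hpaste, integrable_map_measure hfm.aestronglyMeasurable hs.aemeasurable] at hf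
  rw [hpaste, integral_map hs.aemeasurable hfm.aestronglyMeasurable]
  refine (Measure.integral_compProd hf).trans ?_
  have h1 : (fun ω => ∫ ω', A.indicator (fun ω => stoppedPrice n i t ω - stoppedPrice n i s ω)
      (splice ω (τ ω) ω') ∂L ω) =ᵐ[Q] fun ω => A.indicator (fun ω =>
        stoppedPrice n i ((min (t : WithTop ℝ≥0) (τ ω)).untopD 0) ω -
        stoppedPrice n i ((min (s : WithTop ℝ≥0) (τ ω)).untopD 0) ω) ω := by
    filter_upwards [hL] with ω hω
    rw [hω.setIntegral_sub hst hA]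
    rfl
  refine (integral_congr_ae h1).trans ?_
  rw [integral_indicator hA',
    integral_sub (hMτ t).integrableOn (hMτ s).integrableOn, sub_eq_zero]
  exact setIntegral_stopped hQ (rightCts_stoppedPrice n i) hτ hst hA

end PastedMartingale

/-! ### Concatenation of augmented laws -/

section Concatenation

variable {E : Type*} [TopologicalSpace E] [MeasurableSpace E]

theorem IsDensityProcess.congr {P Q : Measure (CadlagPath E)}
    {ζ ζ' : CadlagPath E → CadlagPath ℝ≥0} (hζ : IsDensityProcess P Q ζ) (hm : Measurable ζ')
    (h : ζ' =ᵐ[P] ζ) : IsDensityProcess P Q ζ' := by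
  refine ⟨hm, fun t => ?_⟩
  filter_upwards [h, hζ.version t] with ω h1 h2
  rw [h1, h2]

variable [TopologicalSpace.PseudoMetrizableSpace E] [BorelSpace E] [SecondCountableTopology E]
  {P : Kernel E (CadlagPath E)} [IsMarkovKernel P]

/-- Both sides are the law of an augmented past followed by an augmented future drawn from `P` at
the state at `τ`: on the left by construction, on the right by the strong Markov property. -/
theorem concatLaw_map_augment (hP : IsCanonicalStrongMarkov P) {x : E} {Q : Measure (CadlagPath E)}
    {ζ : CadlagPath E → CadlagPath ℝ≥0} (hζ : IsDensityProcess (P x) Q ζ)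
    {τ : CadlagPath E → WithTop ℝ≥0} (hτ : IsStoppingTime (pathFiltration E) τ) {z : ℝ≥0}
    {Z : (E × ℝ≥0) × CadlagPath E → CadlagPath ℝ≥0} (hZ : Measurable Z)
    {σ : CadlagPath (E × ℝ≥0) → WithTop ℝ≥0} (hσ : Measurable σ)
    (hτσ : τ =ᵐ[P x] fun ω => σ (augment z ω (ζ ω)))
    {ν : E × ℝ≥0 → Measure (CadlagPath (E × ℝ≥0))} (hν : IsUniversallyMeasurableKernel ν)
    (hνZ : ∀ᵐ ω ∂P x, ν (evalAt (τ ω) (augment z ω (ζ ω))) = (P (evalAt (τ ω) ω)).map fun ω' =>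
      augment (evalAt (τ ω) (augment z ω (ζ ω))).2 ω'
        (Z (evalAt (τ ω) (augment z ω (ζ ω)), ω'))) :
    concatLaw ((P x).map fun ω => augment z ω (ζ ω)) σ ν =
      (P x).map fun ω => augment z ω (pasteDensity z ζ τ Z ω) := by
  have := countablyGenerated_augmentedPath (E := E)
  have haug : Measurable fun ω => augment z ω (ζ ω) :=
    Measurable.augment measurable_const measurable_id hζ.meas
  have hψ : Measurable fun y : CadlagPath (E × ℝ≥0) => evalAt (σ y) y := measurable_id.evalAt hσ
  set μ := (P x).map fun ω => augment z ω (ζ ω) with hμ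
  have : IsProbabilityMeasure μ := Measure.isProbabilityMeasure_map haug.aemeasurable
  have : IsProbabilityMeasure (μ.map fun y => evalAt (σ y) y) :=
    Measure.isProbabilityMeasure_map hψ.aemeasurable
  obtain ⟨K, hK, hKν⟩ := hν.exists_kernel (μ.map fun y => evalAt (σ y) y)
  have hKν := ae_of_ae_map hψ.aemeasurable hKν
  have h1 : concatLaw μ σ ν = pasteLaw μ σ (K.comap _ hψ) :=
    pasteLaw_congr (.refl _ _) (hKν.mono fun y hy => hy.symm)
  have hKν := ae_of_ae_map haug.aemeasurable hKν
  have hdens : Measurable fun ω => augment z ω (pasteDensity z ζ τ Z ω) :=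
    Measurable.augment measurable_const measurable_id (measurable_pasteDensity hζ hτ hZ)
  ext B hB
  have hG : Measurable (B.indicator (1 : CadlagPath (E × ℝ≥0) → ℝ≥0∞)) :=
    measurable_one.indicator hB
  have hGp : Measurable fun q : CadlagPath (E × ℝ≥0) × CadlagPath (E × ℝ≥0) =>
      B.indicator (1 : CadlagPath (E × ℝ≥0) → ℝ≥0∞) (splice q.1 (σ q.1) q.2) :=
    hG.comp (measurable_splice_pair hσ)
  rw [h1, ← lintegral_indicator_one hB, ← lintegral_indicator_one hB, lintegral_pasteLaw hσ hG,
    lintegral_map hG hdens, lintegral_augment_pasteDensity hP hζ hτ hZ hG, hμ,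
    lintegral_map (hGp.lintegral_kernel_prod_right' (κ := K.comap _ hψ)) haug]
  refine lintegral_congr_ae ?_
  filter_upwards [hKν, hνZ, hτσ] with ω h2 h3 h4
  rw [Kernel.comap_apply, h2, ← h4, h3, lintegral_map]
  · rw [h4]
    exact hGp.comp measurable_prodMk_left
  · exact Measurable.augment measurable_const measurable_id (hZ.comp measurable_prodMk_left)

end Concatenation

/-! ### Closure of the augmented family under concatenation -/

section Market

variable {d : ℕ} {F : Type*} [TopologicalSpace F] [MeasurableSpace F]
  [SecondCountableTopology F] [BorelSpace F] [TopologicalSpace.PseudoMetrizableSpace F]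
  {P : Kernel (State d F) (CadlagPath (State d F))} [IsMarkovKernel P]

/-- Equivalence follows by comparison with `P x` written as its own pasting. For the martingale
property at level `n`, only pasts with `τ` before the level time matter; they leave a price of norm
below `n` at `τ`, so the stopped price is a martingale under the continuation. -/
theorem pasteLaw_mem_martingaleMeasures (hP : IsCanonicalStrongMarkov P)
    (hBelow : UniformlyLocallyBoundedBelow P) {x : State d F}
    {Q : Measure (CadlagPath (State d F))} (hQ : Q ∈ martingaleMeasures P x)
    {ζ : CadlagPath (State d F) → CadlagPath ℝ≥0} (hζ : IsDensityProcess (P x) Q ζ)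
    {τ : CadlagPath (State d F) → WithTop ℝ≥0} (hτ : IsStoppingTime (pathFiltration (State d F)) τ)
    {L : Kernel (CadlagPath (State d F)) (CadlagPath (State d F))} [IsMarkovKernel L]
    (hL : ∀ᵐ ω ∂P x, L ω ∈ martingaleMeasures P (evalAt (τ ω) ω)) :
    pasteLaw Q τ L ∈ martingaleMeasures P x := by
  have hτm : Measurable τ := hτ.measurable'
  have hQprob : IsProbabilityMeasure Q := hQ.1
  have hprob := isProbabilityMeasure_pasteLaw (μ := Q) (L := L) hτm
  have hPpaste := pasteLaw_strongMarkov hP hτ hζ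
  have hac : pasteLaw Q τ L ≪ P x := by
    rw [← hPpaste]
    exact absolutelyContinuous_pasteLaw hQ.2.1 (hQ.2.1.ae_le (hL.mono fun ω h => h.2.1)) hτm
  refine ⟨hprob, hac, ?_, locally_martingale_of_stoppedPrice (x := x)
    (hac.ae_le (hP.start x)) fun n hn i => ?_⟩
  · nth_rewrite 1 [← hPpaste]
    exact absolutelyContinuous_pasteLaw hQ.2.2.1 (hL.mono fun ω h => h.2.2.1) hτm
  · obtain ⟨a, ha⟩ := hBelow.exists_le_price n
    refine martingale_pasteLaw hτ (a := a) ?_ (fun t => ?_)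
      (martingale_stoppedPrice hBelow (hP.start x) hQ hn i)
    · filter_upwards [hQ.2.1.ae_le hL] with ω hω
      refine ⟨hω.1, hω.2.1.ae_le (hP.start _), fun h => ?_⟩
      refine martingale_stoppedPrice hBelow (hP.start _) hω ?_ i
      obtain ⟨u, hu⟩ := WithTop.ne_top_iff_exists.1 (h.trans_le le_top).ne
      rw [← hu] at h ⊢
      exact norm_price_lt h
    · filter_upwards [hac.ae_le (ha x hn)] with ω hω
      refine hω _ ?_ i
      rw [coe_untopD_min]
      exact min_le_right _ _

theorem exists_pasted_selector (hP : IsCanonicalStrongMarkov P)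
    (hBelow : UniformlyLocallyBoundedBelow P) {x : State d F} {z : ℝ≥0}
    {Q : Measure (CadlagPath (State d F))} (hQ : Q ∈ martingaleMeasures P x)
    {ζ : CadlagPath (State d F) → CadlagPath ℝ≥0} (hζ : IsDensityProcess (P x) Q ζ)
    {σ : CadlagPath (State d F × ℝ≥0) → WithTop ℝ≥0}
    (hσ : IsStoppingTime (pathFiltration (State d F × ℝ≥0)) σ)
    {ν : State d F × ℝ≥0 → Measure (CadlagPath (State d F × ℝ≥0))}
    (hν : IsSelector (augmentedFamily P) ν) :
    ∃ κ : State d F × ℝ≥0 → Measure (CadlagPath (State d F)),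
      IsSelector (fun p => martingaleMeasures P p.1) κ ∧
      (∀ p, IsAugmentedLaw P p.1 p.2 (κ p) (ν p)) ∧
      ∃ Qhat ∈ martingaleMeasures P x,
        Qhat = pasteLaw Q (fun ω => σ (augment z ω (ζ ω)))
          (fun ω => κ (evalAt (σ (augment z ω (ζ ω))) (augment z ω (ζ ω)))) ∧
        IsAugmentedLaw P x z Qhat (concatLaw ((P x).map fun ω => augment z ω (ζ ω)) σ ν) := by
  have := countablyGenerated_path (E := State d F)
  obtain ⟨κ, ξ, hκ, hξ, hνξ, hZex⟩ := exists_selector_of_augmented hν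
  refine ⟨κ, hκ, fun p => ⟨ξ p, hξ p, hνξ p⟩, ?_⟩
  obtain ⟨τ, hτ, hτσ⟩ := hζ.exists_isStoppingTime z hσ
  have hp := hζ.measurable_evalAt_augment hτ z
  -- Only the law of this state under `P x` matters: off a null set for it the universally
  -- measurable `κ` and the densities `ξ` agree with Borel versions `K` and `Z`. These null sets
  -- stay null under `Q`.
  set p := fun ω => evalAt (τ ω) (augment z ω (ζ ω)) with hpdef
  have hpprob : IsProbabilityMeasure ((P x).map p) :=
    Measure.isProbabilityMeasure_map hp.aemeasurable
  obtain ⟨Z, hZ, hZξ⟩ := hZex _ hpprob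
  obtain ⟨K, hK, hKκ⟩ := hκ.kernel.exists_kernel ((P x).map p)
  have hZξ := ae_of_ae_map hp.aemeasurable hZξ
  have hKκ := ae_of_ae_map hp.aemeasurable hKκ
  have hQprob : IsProbabilityMeasure Q := hQ.1
  have hmem := pasteLaw_mem_martingaleMeasures hP hBelow hQ hζ hτ (L := K.comap p hp) (by
    filter_upwards [hKκ] with ω hω
    rw [Kernel.comap_apply, hω]
    exact hκ.mem (p ω))
  refine ⟨pasteLaw Q τ (K.comap p hp), hmem, pasteLaw_congr (hQ.2.1.ae_le hτσ) ?_,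
    pasteDensity z ζ τ Z, ?_, ?_⟩
  · filter_upwards [hQ.2.1.ae_le hKκ, hQ.2.1.ae_le hτσ] with ω h1 h2
    rw [Kernel.comap_apply, h1, ← h2]
  · refine isDensityProcess_pasteLaw hP hζ hτ hZ hQ.2.1 ?_ ?_ hmem.2.1
    · filter_upwards [hKκ] with ω hω
      exact hω ▸ (hκ.mem (p ω)).2.1
    · filter_upwards [hKκ, hZξ] with ω h1 h2
      have h3 : IsDensityProcess (P (p ω).1) (K (p ω)) fun ω' => Z (p ω, ω') :=
        h1 ▸ (hξ (p ω)).congr (hZ.comp measurable_prodMk_left) h2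
      exact h3
  · refine concatLaw_map_augment hP hζ hτ hZ hσ.measurable' hτσ hν.kernel ?_
    filter_upwards [hZξ] with ω hω
    refine (hνξ (p ω)).trans (Measure.map_congr ?_)
    filter_upwards [hω] with ω' hω'
    rw [hω']

end Market

end MarkovControl

end

theorem mainTheorem9 {d : ℕ} {F : Type*} [TopologicalSpace F] [LocallyCompactSpace F] [T2Space F]
    [SecondCountableTopology F] [MeasurableSpace F] [BorelSpace F]
    (P : Kernel (State d F) (CadlagPath (State d F))) [IsMarkovKernel P]
    (hMarkov : IsCanonicalStrongMarkov P) (hHorizon : FiniteHorizon P) (hNFLVR : NFLVR P)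
    (hBelow : UniformlyLocallyBoundedBelow P) :
    ClosedUnderConcatenation (augmentedFamily P)
        {τ | IsStoppingTime (pathFiltration (State d F × ℝ≥0)) τ} ∧
      ∀ (x : State d F) (z : ℝ≥0) (Q₀ : Measure (CadlagPath (State d F)))
        (ζ₀ : CadlagPath (State d F) → CadlagPath ℝ≥0)
        (τ : CadlagPath (State d F × ℝ≥0) → WithTop ℝ≥0)
        (ν : State d F × ℝ≥0 → Measure (CadlagPath (State d F × ℝ≥0))),
        Q₀ ∈ martingaleMeasures P x → IsDensityProcess (P x) Q₀ ζ₀ →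
        IsStoppingTime (pathFiltration (State d F × ℝ≥0)) τ →
        IsSelector (augmentedFamily P) ν →
        ∃ κ : State d F × ℝ≥0 → Measure (CadlagPath (State d F)),
          IsSelector (fun p => martingaleMeasures P p.1) κ ∧
          (∀ p, IsAugmentedLaw P p.1 p.2 (κ p) (ν p)) ∧
          ∃ Qhat ∈ martingaleMeasures P x,
            Qhat = pasteLaw Q₀ (fun ω => τ (augment z ω (ζ₀ ω)))
              (fun ω => κ (evalAt (τ (augment z ω (ζ₀ ω))) (augment z ω (ζ₀ ω)))) ∧
            IsAugmentedLaw P x z Qhat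
              (concatLaw ((P x).map fun ω => augment z ω (ζ₀ ω)) τ ν) := by
  -- A locally compact Hausdorff space is regular, so Urysohn's metrization theorem applies; the
  -- lemmas above need only a second countable pseudometrizable factor space.
  have : TopologicalSpace.MetrizableSpace F := TopologicalSpace.metrizableSpace_of_t3_secondCountable F
  refine ⟨?_, fun x z Q₀ ζ₀ τ ν hQ hζ hτ hν => exists_pasted_selector hMarkov hBelow hQ hζ hτ hν⟩
  rintro ⟨x, z⟩ μ ⟨Q, hQ, ζ, hζ, rfl⟩ τ hτ ν hν
  obtain ⟨κ, -, -, Qhat, hmem, -, hlaw⟩ := exists_pasted_selector hMarkov hBelow hQ hζ hτ hν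
  exact ⟨Qhat, hmem, hlaw⟩
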